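/- Let $M$ be a smooth 6-manifold with a nearly Kähler structure $(g,I,\omega,\Omega)$, that is: $g$ is a smooth Riemannian metric, $I$ a smooth $g$-orthogonal almost complex structure, $\omega=g(I\cdot,\cdot)$ its Hermitian form, and $\Omega$ a smooth $(3,0)$-form of unit length (i.e. $|\Omega(e_1,e_2,e_3)|=1$ for every unitary frame $e_1,e_2,e_3$ of a tangent space), such that $$d\omega = 3\lambda\,\mathrm{Re}\,\Omega,\qquad d\,\mathrm{Im}\,\Omega=-2\lambda\,\omega\wedge\omega$$ for some non-zero real constant $\lambda$. On complex-valued smooth differential forms, let $d^{i,j}$ ($i+j=1$) denote the component of the de Rham differential $d$ that maps $\Lambda^{p,q}(M)$ to $\Lambda^{p+i,q+j}(M)$ for all $p,q$, so that $d=N+\partial+\bar\partial+\bar N$ with $N=d^{2,-1}$, $\partial=d^{1,0}$, $\bar\partial=d^{0,1}$, $\bar N=d^{-1,2}$. For each $D\in\{d,\partial,\bar\partial,N+\bar N\}$ let $D^*=-{*}D{*}$ be its Hermitian adjoint, where $*$ is the conjugate-linear Hodge star operator, characterized by $\alpha\wedge *\beta=\langle\alpha,\beta\rangle\,\omega^3/3!$,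 and let $\Delta_D=DD^*+D^*D$. Write $\{A,B\}=AB+BA$. Then $$\Delta_d=\Delta_\partial+\Delta_{\bar\partial}+\Delta_{N+\bar N}-\{\partial,\bar\partial^*\}-\{\bar\partial,\partial^*\}$$ as operators on smooth complex-valued differential forms on $M$. -/

import Mathlib

open scoped Manifold ContDiff Bundle

noncomputable section

namespace NearlyKahler

/-! ## Linear algebra of complex-valued alternating forms on a real vector space -/

theorem update_castAdd {X : Type*} {k l : ℕ} (v : Fin (k + l) → X) (i : Fin k) (z : X) :
    (fun a => Function.update v (Fin.castAdd l i) z (Fin.castAdd l a)) =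
        Function.update (fun a => v (Fin.castAdd l a)) i z ∧
      (fun a => Function.update v (Fin.castAdd l i) z (Fin.natAdd k a)) =
        (fun a => v (Fin.natAdd k a)) := by
  constructor
  · funext a; simp [Function.update_apply]
  · funext a
    rw [Function.update_of_ne]
    intro h; have := congrArg Fin.val h; simp at this; omega

theorem update_natAdd {X : Type*} {k l : ℕ} (v : Fin (k + l) → X) (j : Fin l) (z : X) :
    (fun a => Function.update v (Fin.natAdd k j) z (Fin.castAdd l a)) =
        (fun a => v (Fin.castAdd l a)) ∧
      (fun a => Function.update v (Fin.natAdd k j) z (Fin.natAdd k a)) =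
        Function.update (fun a => v (Fin.natAdd k a)) j z := by
  constructor
  · funext a
    rw [Function.update_of_ne]
    intro h; have := congrArg Fin.val h; simp at this; omega
  · funext a; simp [Function.update_apply]

theorem append_cast_update {X : Type*} {k m n : ℕ} (h : k + m = n) (w : Fin k → X)
    (v : Fin m → X) (i : Fin m) (z : X) :
    (fun a : Fin n => Fin.append w (Function.update v i z) (Fin.cast h.symm a)) =
      Function.update (fun a : Fin n => Fin.append w v (Fin.cast h.symm a))
        (Fin.cast h (Fin.natAdd k i)) z := by
  subst h
  funext a
  refine Fin.addCases (fun b => ?_) (fun b => ?_) a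
  · rw [Function.update_of_ne]
    · simp
    · intro h; have := congrArg Fin.val h; simp at this; omega
  · simp [Function.update_apply]

section Pointwise

variable {V : Type*} [AddCommGroup V] [Module ℝ V] [TopologicalSpace V]

/-- The multilinear map `(v₁,…,vₖ₊ₗ) ↦ α(v₁,…,vₖ) β(vₖ₊₁,…,vₖ₊ₗ)`. -/
def tensorMul {k l : ℕ} (α : V [⋀^Fin k]→L[ℝ] ℂ) (β : V [⋀^Fin l]→L[ℝ] ℂ) :
    ContinuousMultilinearMap ℝ (fun _ : Fin (k + l) => V) ℂ where
  toMultilinearMap := MultilinearMap.mk'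
    (fun v => α (fun i => v (Fin.castAdd l i)) * β (fun j => v (Fin.natAdd k j)))
    (by
      intro v i x y
      refine Fin.addCases (fun i => ?_) (fun j => ?_) i
      · rw [(update_castAdd v i _).1, (update_castAdd v i _).2, (update_castAdd v i _).1,
          (update_castAdd v i _).2, (update_castAdd v i _).1, (update_castAdd v i _).2,
          ContinuousAlternatingMap.map_update_add, add_mul]
      · rw [(update_natAdd v j _).1, (update_natAdd v j _).2, (update_natAdd v j _).1,
          (update_natAdd v j _).2, (update_natAdd v j _).1, (update_natAdd v j _).2,
          ContinuousAlternatingMap.map_update_add, mul_add])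
    (by
      intro v i c x
      refine Fin.addCases (fun i => ?_) (fun j => ?_) i
      · rw [(update_castAdd v i _).1, (update_castAdd v i _).2, (update_castAdd v i _).1,
          (update_castAdd v i _).2, ContinuousAlternatingMap.map_update_smul, smul_mul_assoc]
      · rw [(update_natAdd v j _).1, (update_natAdd v j _).2, (update_natAdd v j _).1,
          (update_natAdd v j _).2, ContinuousAlternatingMap.map_update_smul, mul_smul_comm])
  cont := by
    refine Continuous.mul ?_ ?_
    · exact (ContinuousAlternatingMap.coe_continuous α).comp (by fun_prop)
    · exact (ContinuousAlternatingMap.coe_continuous β).comp (by fun_prop)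

/-- The wedge product,
`(α ∧ β)(v₁,…,vₖ₊ₗ) = 1/(k! l!) ∑_σ sgn(σ) α(v_σ(1),…,v_σ(k)) β(v_σ(k+1),…,v_σ(k+l))`. -/
def wedge {k l : ℕ} (α : V [⋀^Fin k]→L[ℝ] ℂ) (β : V [⋀^Fin l]→L[ℝ] ℂ) :
    V [⋀^Fin (k + l)]→L[ℝ] ℂ :=
  ((k.factorial : ℂ) * (l.factorial : ℂ))⁻¹ •
    ContinuousMultilinearMap.alternatization (tensorMul α β)

/-- `slotInsert J η S` is the multilinear map obtained from the complex multilinear extension of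
`η` by inserting `π^{1,0} vᵢ = (vᵢ - √-1 J vᵢ)/2` in the slots `i ∈ S` and
`π^{0,1} vᵢ = (vᵢ + √-1 J vᵢ)/2` in the slots `i ∉ S`. In the expanded sum, `T` is the set of
slots where the term with `J` is taken. -/
def slotInsert (J : V →L[ℝ] V) {k : ℕ} (η : V [⋀^Fin k]→L[ℝ] ℂ) (S : Finset (Fin k)) :
    ContinuousMultilinearMap ℝ (fun _ : Fin k => V) ℂ :=
  ∑ T : Finset (Fin k),
    (∏ i, (if i ∈ T then (if i ∈ S then -Complex.I / 2 else Complex.I / 2) else 1 / 2 : ℂ)) •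
      η.toContinuousMultilinearMap.compContinuousLinearMap
        (fun i => if i ∈ T then J else ContinuousLinearMap.id ℝ V)

theorem slotInsert_apply (J : V →L[ℝ] V) {k : ℕ} (η : V [⋀^Fin k]→L[ℝ] ℂ) (S : Finset (Fin k))
    (v : Fin k → V) :
    slotInsert J η S v = ∑ T : Finset (Fin k),
      (∏ i, (if i ∈ T then (if i ∈ S then -Complex.I / 2 else Complex.I / 2) else 1 / 2 : ℂ)) *
        η (fun i => if i ∈ T then J (v i) else v i) := by
  simp only [slotInsert, sum_apply, smul_apply,
    ContinuousMultilinearMap.compContinuousLinearMap_apply, smul_eq_mul]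
  refine Finset.sum_congr rfl fun T _ => ?_
  congr 1
  refine congrArg η (funext fun i => ?_)
  split_ifs <;> rfl

theorem slotInsert_comp_perm (J : V →L[ℝ] V) {k : ℕ} (η : V [⋀^Fin k]→L[ℝ] ℂ)
    (S : Finset (Fin k)) (σ : Equiv.Perm (Fin k)) (v : Fin k → V) :
    slotInsert J η S (v ∘ σ) =
      ((Equiv.Perm.sign σ : ℤ) : ℂ) * slotInsert J η (S.map σ.toEmbedding) v := by
  rw [slotInsert_apply, slotInsert_apply, Finset.mul_sum]
  refine Finset.sum_equiv σ.finsetCongr (by simp) fun T _ => ?_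
  have hmem : ∀ (U : Finset (Fin k)) (i : Fin k), σ i ∈ U.map σ.toEmbedding ↔ i ∈ U := by
    intro U i; simp
  have h1 : (∏ i, (if i ∈ T then (if i ∈ S then -Complex.I / 2 else Complex.I / 2)
        else 1 / 2 : ℂ)) =
      ∏ i, (if i ∈ T.map σ.toEmbedding then
        (if i ∈ S.map σ.toEmbedding then -Complex.I / 2 else Complex.I / 2) else 1 / 2 : ℂ) := by
    refine Eq.trans ?_ (Equiv.prod_comp σ _)
    simp only [hmem]
  have h2 : (fun i => if i ∈ T then J ((v ∘ σ) i) else (v ∘ σ) i) =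
      (fun i => if i ∈ T.map σ.toEmbedding then J (v i) else v i) ∘ σ := by
    funext i
    simp only [Function.comp_apply, hmem]
  rw [h1, h2, Equiv.finsetCongr_apply]
  have h3 := η.toAlternatingMap.map_perm
    (fun i => if i ∈ T.map σ.toEmbedding then J (v i) else v i) σ
  have h4 : η ((fun i => if i ∈ T.map σ.toEmbedding then J (v i) else v i) ∘ σ) =
      ((Equiv.Perm.sign σ : ℤ) : ℂ) *
        η (fun i => if i ∈ T.map σ.toEmbedding then J (v i) else v i) := by
    refine Eq.trans h3 ?_
    rw [Units.smul_def, zsmul_eq_mul]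
    rfl
  rw [h4]; ring

/-- The projection `Λ^k → Λ^{p,q}` attached to a complex structure `J`:
`(π^{p,q} η)(v₁,…,vₖ)` is the sum, over all sets `S` of `p` slots whose complement has `q`
elements, of the value of (the complex multilinear extension of) `η` on the vectors
`π^{1,0} vᵢ`, `i ∈ S`, and `π^{0,1} vᵢ`, `i ∉ S`. It is zero unless `p, q ≥ 0` and
`p + q = k`. -/
def typeProj (J : V →L[ℝ] V) (p q : ℤ) {k : ℕ} (η : V [⋀^Fin k]→L[ℝ] ℂ) :
    V [⋀^Fin k]→L[ℝ] ℂ :=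
  { (∑ S : Finset (Fin k) with (S.card : ℤ) = p ∧ (Sᶜ.card : ℤ) = q, slotInsert J η S) with
    map_eq_zero_of_eq' := by
      intro v i j hv hij
      have hsw : v ∘ Equiv.swap i j = v := by
        funext a
        by_cases ha : a = i
        · subst ha; simp [hv]
        · by_cases hb : a = j
          · subst hb; simp [hv]
          · simp [Equiv.swap_apply_of_ne_of_ne ha hb]
      have key : (∑ S : Finset (Fin k) with (S.card : ℤ) = p ∧ (Sᶜ.card : ℤ) = q,
            slotInsert J η S v) =
          -(∑ S : Finset (Fin k) with (S.card : ℤ) = p ∧ (Sᶜ.card : ℤ) = q,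
            slotInsert J η S v) := by
        conv_lhs => rw [← hsw]
        rw [← Finset.sum_neg_distrib]
        refine Finset.sum_equiv (Equiv.swap i j).finsetCongr ?_ fun S _ => ?_
        · intro S
          simp [Finset.card_compl]
        · rw [slotInsert_comp_perm, Equiv.Perm.sign_swap hij]
          simp
      have h0 : (∑ S : Finset (Fin k) with (S.card : ℤ) = p ∧ (Sᶜ.card : ℤ) = q,
          slotInsert J η S v) = 0 := by
        exact self_eq_neg.mp key
      simpa using h0 }

/-- The form `(v₁,…,vₘ) ↦ ε(w₁,…,wₖ,v₁,…,vₘ)`, where `k + m = n`. -/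
def contract {k m n : ℕ} (h : k + m = n) (ε : V [⋀^Fin n]→L[ℝ] ℂ) (w : Fin k → V) :
    V [⋀^Fin m]→L[ℝ] ℂ where
  toMultilinearMap := MultilinearMap.mk'
    (fun v => ε (fun a => Fin.append w v (Fin.cast h.symm a)))
    (by
      intro v i x y
      rw [append_cast_update h, append_cast_update h, append_cast_update h,
        ContinuousAlternatingMap.map_update_add])
    (by
      intro v i c x
      rw [append_cast_update h, append_cast_update h,
        ContinuousAlternatingMap.map_update_smul])
  cont := by
    refine (ContinuousAlternatingMap.coe_continuous ε).comp (continuous_pi fun a => ?_)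
    subst h
    refine Fin.addCases (fun b => ?_) (fun b => ?_) a
    · simpa using continuous_const
    · simpa using continuous_apply b
  map_eq_zero_of_eq' := by
    intro v i j hv hij
    refine ε.map_eq_zero_of_eq _ (i := Fin.cast h (Fin.natAdd k i))
      (j := Fin.cast h (Fin.natAdd k j)) (by simpa using hv) ?_
    intro h; have := congrArg Fin.val h; simp at this; omega

/-- The Gram matrix `G i j = g(bᵢ, bⱼ)`. -/
def gram (g : V →L[ℝ] V →L[ℝ] ℝ) {n : ℕ} (b : Fin n → V) : Matrix (Fin n) (Fin n) ℝ :=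
  Matrix.of fun i j => g (b i) (b j)

/-- The conjugate-linear Hodge star `Λ^k → Λ^m`, `k + m = n`, of a metric `g` with volume form
`ε`, in index notation with respect to a basis `b`:
`(⋆β)(v₁,…,vₘ) = 1/k! ∑ G^{i₁j₁} ⋯ G^{iₖjₖ} conj β(b_{i₁},…,b_{iₖ}) ε(b_{j₁},…,b_{jₖ},v₁,…,vₘ)`,
where `(G^{ij})` is the inverse of the Gram matrix. It does not depend on the basis and is
characterized by `α ∧ ⋆β = ⟨α, β⟩ ε`, where `⟨ , ⟩` is the Hermitian extension of the metric. -/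
def hodgeStar (g : V →L[ℝ] V →L[ℝ] ℝ) {n : ℕ} (b : Fin n → V) (ε : V [⋀^Fin n]→L[ℝ] ℂ)
    {k m : ℕ} (h : k + m = n) (β : V [⋀^Fin k]→L[ℝ] ℂ) : V [⋀^Fin m]→L[ℝ] ℂ :=
  (k.factorial : ℂ)⁻¹ • ∑ i : Fin k → Fin n, ∑ j : Fin k → Fin n,
    (((∏ a, (gram g b)⁻¹ (i a) (j a) : ℝ) : ℂ) * starRingEnd ℂ (β fun a => b (i a))) •
      contract h ε fun a => b (j a)

/-- The real part of a complex-valued form, as a complex-valued form. -/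
def rePart {k : ℕ} (α : V [⋀^Fin k]→L[ℝ] ℂ) : V [⋀^Fin k]→L[ℝ] ℂ :=
  (Complex.ofRealCLM.comp Complex.reCLM).compContinuousAlternatingMap α

/-- The imaginary part of a complex-valued form, as a complex-valued form. -/
def imPart {k : ℕ} (α : V [⋀^Fin k]→L[ℝ] ℂ) : V [⋀^Fin k]→L[ℝ] ℂ :=
  (Complex.ofRealCLM.comp Complex.imCLM).compContinuousAlternatingMap α

end Pointwise

/-- The Hermitian form `ω(v, w) = g(Jv, w)`. -/
def hermitianForm {V : Type*} [NormedAddCommGroup V] [NormedSpace ℝ V]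
    (g : V →L[ℝ] V →L[ℝ] ℝ) (J : V →L[ℝ] V)
    (hsymm : ∀ v w, g v w = g w v) (hJ : ∀ v, J (J v) = -v)
    (hg : ∀ v w, g (J v) (J w) = g v w) : V [⋀^Fin 2]→L[ℝ] ℂ where
  toMultilinearMap := MultilinearMap.mk' (fun v => ((g (J (v 0)) (v 1) : ℝ) : ℂ))
    (by
      intro v i x y
      fin_cases i <;> simp)
    (by
      intro v i c x
      fin_cases i <;> simp)
  cont := by
    exact Complex.continuous_ofReal.comp
      (((g.comp J).continuous.comp (continuous_apply 0)).clm_apply (continuous_apply 1))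
  map_eq_zero_of_eq' := by
    have key : ∀ v, g (J v) v = 0 := by
      intro v
      have h1 := hg (J v) v
      rw [hJ, map_neg, neg_apply, hsymm] at h1
      linarith
    intro v i j hv hij
    have h01 : v 0 = v 1 := by
      fin_cases i <;> fin_cases j <;> simp_all
    simp [h01, key]

/-! ## Differential forms on a 6-manifold -/

/-- The model space `ℝ⁶`. -/
abbrev Model : Type := EuclideanSpace ℝ (Fin 6)

section Forms

variable {M : Type*} [TopologicalSpace M] [ChartedSpace Model M]

/-- Complex-valued differential `k`-forms (without regularity). -/
abbrev Form (M : Type*) [TopologicalSpace M] [ChartedSpace Model M] (k : ℕ) : Type _ :=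
  ∀ x : M, TangentSpace (𝓡 6) x [⋀^Fin k]→L[ℝ] ℂ

/-- The expression of a form in the preferred chart `φ` at `x₀`, that is, `(φ⁻¹)^* η`, a form on
the open set `φ.target` of `ℝ⁶`. -/
def inChart {k : ℕ} (x₀ : M) (η : Form M k) (y : Model) : Model [⋀^Fin k]→L[ℝ] ℂ :=
  (η ((extChartAt (𝓡 6) x₀).symm y)).compContinuousLinearMap
    (mfderiv 𝓘(ℝ, Model) (𝓡 6) (extChartAt (𝓡 6) x₀).symm y)

/-- A form is smooth if all its expressions in charts are. -/
def IsSmooth {k : ℕ} (η : Form M k) : Prop :=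
  ∀ x₀ : M, ContDiffOn ℝ ∞ (inChart x₀ η) (extChartAt (𝓡 6) x₀).target

/-- The de Rham differential, computed at the point `x` in the preferred chart at `x`. -/
def extD {k : ℕ} (η : Form M k) : Form M (k + 1) := fun x =>
  (extDeriv (inChart x η) (extChartAt (𝓡 6) x x)).compContinuousLinearMap
    (mfderiv (𝓡 6) 𝓘(ℝ, Model) (extChartAt (𝓡 6) x) x)

/-- Differential forms of mixed degree (forms of degree `> 6` vanish, so that these are the
elements of `⨁ₖ Λ^k(M)`). -/
abbrev MixedForm (M : Type*) [TopologicalSpace M] [ChartedSpace Model M] : Type _ :=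
  ∀ k : ℕ, Form M k

/-- Operators on the space of differential forms. -/
abbrev FormOp (M : Type*) [TopologicalSpace M] [ChartedSpace Model M] : Type _ :=
  MixedForm M → MixedForm M

/-- The de Rham differential on forms of mixed degree. -/
def deRham : FormOp M := fun η k =>
  match k with
  | 0 => 0
  | k + 1 => extD (η k)

/-- The (super)commutator `{A, B} = AB + BA` of two odd operators. -/
def anticomm (A B : FormOp M) : FormOp M := fun η => A (B η) + B (A η)

end Forms

/-! ## Almost Hermitian structures -/

/-- An almost Hermitian structure on a 6-manifold: a smooth Riemannian metric and a smooth
orthogonal almost complex structure. -/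
structure AlmostHermitian (M : Type*) [TopologicalSpace M] [ChartedSpace Model M]
    [IsManifold (𝓡 6) ∞ M] where
  /-- the Riemannian metric -/
  g : Bundle.ContMDiffRiemannianMetric (𝓡 6) ∞ Model (fun x : M => TangentSpace (𝓡 6) x)
  /-- the almost complex structure -/
  J : ∀ x : M, TangentSpace (𝓡 6) x →L[ℝ] TangentSpace (𝓡 6) x
  J_smooth : ContMDiff (𝓡 6) ((𝓡 6).prod 𝓘(ℝ, Model →L[ℝ] Model)) ∞
    (fun x : M => Bundle.TotalSpace.mk' (Model →L[ℝ] Model)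
      (E := fun x : M => TangentSpace (𝓡 6) x →L[ℝ] TangentSpace (𝓡 6) x) x (J x))
  J_sq : ∀ (x : M) (v : TangentSpace (𝓡 6) x), J x (J x v) = -v
  J_orthogonal : ∀ (x : M) (v w : TangentSpace (𝓡 6) x),
    g.inner x (J x v) (J x w) = g.inner x v w

namespace AlmostHermitian

variable {M : Type*} [TopologicalSpace M] [ChartedSpace Model M] [IsManifold (𝓡 6) ∞ M]
  (H : AlmostHermitian M)

/-- The Hermitian form `ω = g(J·,·)`. -/
def omega : Form M 2 := fun x =>
  hermitianForm (V := Model) (H.g.inner x) (H.J x) (H.g.symm x) (H.J_sq x) (H.J_orthogonal x)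

/-- The Riemannian volume form for the orientation given by `J`, `vol = ω³/3!`. -/
def vol : Form M 6 := fun x =>
  (6 : ℂ)⁻¹ • wedge (H.omega x) (wedge (H.omega x) (H.omega x))

/-- The coordinate frame of the preferred chart at `x`, as a basis of `T_x M`. -/
def frame (x : M) (i : Fin 6) : TangentSpace (𝓡 6) x :=
  (EuclideanSpace.single i (1 : ℝ) : Model)

/-- The conjugate-linear Hodge star operator. -/
def star : FormOp M := fun η m x =>
  if h : m ≤ 6 then
    hodgeStar (H.g.inner x) (frame x) (H.vol x) (Nat.sub_add_cancel h) (η (6 - m) x)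
  else 0

/-- The Hermitian adjoint `D^* = -⋆D⋆` of an operator `D` of degree `1`. -/
def adj (D : FormOp M) : FormOp M := fun η => -H.star (D (H.star η))

/-- The component `d^{a,b}` of bidegree `(a, b)`, `a + b = 1`, of the de Rham differential: on
`Λ^{p,q}(M)` it is the `(p+a, q+b)`-part of `d`. -/
def dComp (a b : ℤ) : FormOp M := fun η k =>
  match k with
  | 0 => 0
  | k + 1 => fun x => ∑ p ∈ Finset.range (k + 1),
      typeProj (H.J x) (p + a) ((k : ℤ) - p + b)
        (extD (fun y => typeProj (H.J y) p ((k : ℤ) - p) (η k y)) x)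

/-- `∂ = d^{1,0}`. -/
def del : FormOp M := H.dComp 1 0

/-- `∂̄ = d^{0,1}`. -/
def delBar : FormOp M := H.dComp 0 1

/-- `N = d^{2,-1}`. -/
def N : FormOp M := H.dComp 2 (-1)

/-- `N̄ = d^{-1,2}`. -/
def NBar : FormOp M := H.dComp (-1) 2

/-- The Laplacian `Δ_D = D D^* + D^* D`. -/
def laplacian (D : FormOp M) : FormOp M := anticomm D (H.adj D)

end AlmostHermitian

/-- An `SU(3)`-structure on a 6-manifold: an almost Hermitian structure together with a smooth
`(3,0)`-form `Ω` of unit length, that is, `|Ω(e₁,e₂,e₃)| = 1` for all unitary frames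
`e₁, e₂, e₃`. -/
structure SU3Structure (M : Type*) [TopologicalSpace M] [ChartedSpace Model M]
    [IsManifold (𝓡 6) ∞ M] extends AlmostHermitian M where
  /-- the complex volume form `Ω` -/
  Omega : Form M 3
  Omega_smooth : IsSmooth Omega
  Omega_type : ∀ x : M, typeProj (J x) 3 0 (Omega x) = Omega x
  Omega_unit : ∀ (x : M) (e : Fin 3 → TangentSpace (𝓡 6) x),
    (∀ i j, g.inner x (e i) (e j) = if i = j then 1 else 0) →
    (∀ i j, g.inner x (J x (e i)) (e j) = 0) → ‖Omega x e‖ = 1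

/-- An `SU(3)`-manifold is nearly Kähler if `dω = 3λ Re Ω` and `d Im Ω = -2λ ω²` for a non-zero
real constant `λ`. -/
def SU3Structure.IsNearlyKahler {M : Type*} [TopologicalSpace M] [ChartedSpace Model M]
    [IsManifold (𝓡 6) ∞ M] (S : SU3Structure M) : Prop :=
  ∃ c : ℝ, c ≠ 0 ∧
    (∀ x : M, extD S.omega x = (3 * c : ℂ) • rePart (S.Omega x)) ∧
    (∀ x : M, extD (fun y => imPart (S.Omega y)) x =
      (-2 * c : ℂ) • wedge (S.omega x) (S.omega x))

end NearlyKahler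

end

/-!
The operators `N`, `∂`, `∂̄`, `N̄` and the contraction `Λ` with the Hermitian form satisfy Kähler
identities on a nearly Kähler manifold, and the formula for `Δ_d` follows from these identities and
the components of `d² = 0` by algebra.

**The Kähler identities.** In a smooth local unitary frame, the flat connection of the frame can be
corrected to a Hermitian connection whose torsion has no part of mixed type
(`hermitianCorrection`). As `dω` is of type `(3,0) + (0,3)`, the torsion of this connection is
antilinear in both arguments (`torsion_antilinear`). Evaluating `dΩ`, which is a multiple of `ω²`,
one finds that the torsion is moreover totally antisymmetric (`CAR.torsion_of_structure_equation`).
Hence, with the operators `a_k = dz_k ∧`, `b_k = dz̄_k ∧` and the dual contractions `α_k`, `β_k`,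
  `∂ = ∑ a_k ∇_k`, `∂̄ = ∑ b_k ∇_k̄`, `N = κ̄ ∑ a_i a_j β_k`, `N̄ = κ ∑ b_i b_j α_k`,
where the sums for `N` and `N̄` run over the cyclic permutations `(i, j, k)` of the indices
(`IsUnitaryFrame.exists_connection`, `localOp`). The contraction `Λ` and the star operator are
invariant under `U(3)`, and so commute with the covariant derivatives. The anticommutation relations
of the exterior algebra then give
  `[Λ, ∂] = √-1 ∂̄*`, `[Λ, ∂̄] = -√-1 ∂*`, `[Λ, N] = 2√-1 N̄*`, `[Λ, N̄] = -2√-1 N*`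
(`contractionForm_comm_del` and the lemmas after it). The factor `2` arises because `N` contains two
creation operators where `∂` contains one. No parallel frame or normal coordinates are needed: the
identities hold at each point for the Hermitian connection as it is.

**The square of `d`.** The circle acts on forms by pullback along `z ↦ ζ z` in the tangent spaces,
with weight `p - q` on `(p,q)`-forms. The operators `N`, `∂`, `∂̄`, `N̄` have the weights `3`, `1`,
`-1`, `-3`, and comparing the coefficients of the powers of `ζ` in `d² = 0` gives
  `{N, ∂} = 0`, `∂² + {N, ∂̄} = 0`, `∂̄² + {N̄, ∂} = 0`, `{N̄, ∂̄} = 0`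
(`sum_dPart_dPart_eq_zero`).

**The algebra.** Commuting these relations with `Λ` yields, for example,
  `{∂, ∂̄*} = {N, ∂*} - 2{∂̄, N̄*}` and `2{∂, N̄*} + {N, ∂̄*} = 0`.
Together with the relations obtained by complex conjugation and by taking adjoints, the second kind
implies that `{∂, N̄*}`, `{N, ∂̄*}` and their conjugates vanish, and the first kind implies that
`2{∂, ∂̄*} + {N, ∂*} + {∂̄, N̄*} = 0` and its conjugate. Subtracting these from the expansion of
`Δ_d = {d, d*}` with `d = N + ∂ + ∂̄ + N̄` leaves the terms of the theorem (`laplacian_identity`).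
As the star operator is conjugate-linear, this computation takes place in the ring of real-linear
operators on smooth forms.
-/

noncomputable section

namespace NearlyKahler

open ContinuousAlternatingMap

/-! ### The algebra behind the Laplacian identity -/

section Algebra

variable {R : Type*} [Ring R]

/-- The relation `{∂, ∂̄*} = {N, ∂*} - 2{∂̄, N̄*}` (with `E' = ∂̄*`, `D' = ∂*`, `M' = N̄*`). It is
the commutator of the contraction `Λ` with `∂² + {N, ∂̄} = 0`, the part of `d² = 0` of bidegree `(2,
0)`. -/
theorem kahler_relation {Lam I D E N D' E' M' : R} (hID : I * D = D * I) (hIE : I * E = E * I)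
    (hIN : I * N = N * I) (hI : I * I = -1)
    (hD : Lam * D - D * Lam = I * E') (hE : Lam * E - E * Lam = -(I * D'))
    (hN : Lam * N - N * Lam = 2 * (I * M')) (h2 : D * D + (N * E + E * N) = 0) :
    D * E' + E' * D = (N * D' + D' * N) - 2 * (E * M' + M' * E) := by
  have e1 : I * (D * E' + E' * D) = Lam * (D * D) - D * D * Lam := by
    have : I * (D * E' + E' * D) = D * (I * E') + (I * E') * D := by
      rw [mul_add, ← mul_assoc, hID]; noncomm_ring
    rw [this, ← hD]; noncomm_ring
  have e2 : Lam * (D * D) - D * D * Lam = -(Lam * (N * E + E * N) - (N * E + E * N) * Lam) := by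
    rw [eq_neg_of_add_eq_zero_left h2]; noncomm_ring
  have e3 : Lam * (N * E + E * N) - (N * E + E * N) * Lam =
      ((Lam * N - N * Lam) * E + E * (Lam * N - N * Lam)) +
      (N * (Lam * E - E * Lam) + (Lam * E - E * Lam) * N) := by noncomm_ring
  have e4 : E * (2 * (I * M')) = I * (2 * (E * M')) := by
    have : E * (2 * (I * M')) = 2 * ((E * I) * M') := by noncomm_ring
    rw [this, ← hIE]; noncomm_ring
  have e5 : N * -(I * D') = -(I * (N * D')) := by
    have : N * -(I * D') = -((N * I) * D') := by noncomm_ring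
    rw [this, ← hIN]; noncomm_ring
  have e6 : I * (D * E' + E' * D) =
      I * ((N * D' + D' * N) - 2 * (E * M' + M' * E)) := by
    rw [e1, e2, e3, hN, hE, e4, e5]; noncomm_ring
  have e7 := congrArg (fun t => -(I * t)) e6
  simpa [← mul_assoc, hI] using e7

/-- The relation `2{∂, N̄*} + {N, ∂̄*} = 0`. It is the commutator of the contraction `Λ` with `{N,
∂} = 0`, the part of `d² = 0` of bidegree `(3, -1)`. -/
theorem kahler_relation_two {Lam I D N E' M' : R} (hID : I * D = D * I)
    (hIN : I * N = N * I) (hI : I * I = -1)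
    (hD : Lam * D - D * Lam = I * E')
    (hN : Lam * N - N * Lam = 2 * (I * M')) (h2 : N * D + D * N = 0) :
    2 * (D * M' + M' * D) + (N * E' + E' * N) = 0 := by
  have e3 : Lam * (N * D + D * N) - (N * D + D * N) * Lam =
      ((Lam * N - N * Lam) * D + D * (Lam * N - N * Lam)) +
      (N * (Lam * D - D * Lam) + (Lam * D - D * Lam) * N) := by noncomm_ring
  have e4 : D * (2 * (I * M')) = I * (2 * (D * M')) := by
    have : D * (2 * (I * M')) = 2 * ((D * I) * M') := by noncomm_ring
    rw [this, ← hID]; noncomm_ring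
  have e5 : N * (I * E') = (I * (N * E')) := by
    have : N * (I * E') = ((N * I) * E') := by noncomm_ring
    rw [this, ← hIN]; noncomm_ring
  have e6 : I * (2 * (D * M' + M' * D) + (N * E' + E' * N)) = 0 := by
    rw [h2, hN, hD, e4, e5] at e3
    rw [mul_zero, zero_mul, sub_zero] at e3
    rw [e3]; noncomm_ring
  have e7 := congrArg (fun t => -(I * t)) e6
  simpa [← mul_assoc, hI] using e7

/-- The Hermitian adjoint `X ↦ -⋆X⋆` attached to a star operator `s`. -/
def starAdj (s X : R) : R := -(s * X * s)

theorem starAdj_add (s X Y : R) : starAdj s (X + Y) = starAdj s X + starAdj s Y := by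
  simp only [starAdj]; noncomm_ring

theorem starAdj_starAdj {s P X : R} (hs : s * s = P) (hP : P * P = 1) (hX : P * X = -(X * P)) :
    starAdj s (starAdj s X) = -X := by
  have : starAdj s (starAdj s X) = (s * s) * X * (s * s) := by simp only [starAdj]; noncomm_ring
  rw [this, hs, hX, neg_mul, mul_assoc, hP, mul_one]

theorem star_mul_star {s P : R} (hs : s * s = P) (hP : P * P = 1) (X Y : R)
    (hX : P * X = -(X * P)) :
    s * (X * Y) * s = -(P * (starAdj s X * starAdj s Y)) := by
  have hsP : s * P = P * s := by rw [← hs, mul_assoc]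
  have e : P * (starAdj s X * starAdj s Y) = P * s * X * (s * s) * Y * s := by
    simp only [starAdj]; noncomm_ring
  have e2 : P * s * X * P = -(s * X) := by
    rw [← hsP, mul_assoc s, hX, mul_neg, neg_mul, mul_assoc, mul_assoc, hP, mul_one]
  rw [e, hs, e2]; noncomm_ring

theorem star_anticomm_star {s P : R} (hs : s * s = P) (hP : P * P = 1) {X Y : R}
    (hX : P * X = -(X * P)) (hY : P * Y = -(Y * P)) :
    s * (X * Y + Y * X) * s =
      -(P * (starAdj s X * starAdj s Y + starAdj s Y * starAdj s X)) := by
  rw [mul_add, add_mul, star_mul_star hs hP X Y hX, star_mul_star hs hP Y X hY]; noncomm_ring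

theorem parity_starAdj {s P X : R} (hs : s * s = P) (hX : P * X = -(X * P)) :
    P * starAdj s X = -(starAdj s X * P) := by
  have hsP : s * P = P * s := by rw [← hs, mul_assoc]
  have : P * starAdj s X = -((P * s) * X * s) := by simp only [starAdj]; noncomm_ring
  rw [this, ← hsP, mul_assoc s, hX]
  have : starAdj s X * P = -(s * X * (s * P)) := by simp only [starAdj]; noncomm_ring
  rw [this, hsP]; noncomm_ring

/-- The part of the Laplacian identity that is pure algebra. The operators `D, E, N, M` play the
roles of `∂, ∂̄, N, N̄`, and `s`, `P`, `I`, `Lam` those of the Hodge star, the parity of the degree,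
multiplication by `√-1`, and the contraction with the Hermitian form. -/
theorem laplacian_identity [Algebra ℝ R] {s P I Lam D E N M : R}
    (hs : s * s = P) (hP : P * P = 1) (hI : I * I = -1)
    (hPD : P * D = -(D * P)) (hPE : P * E = -(E * P))
    (hPN : P * N = -(N * P)) (hPM : P * M = -(M * P))
    (hID : I * D = D * I) (hIE : I * E = E * I) (hIN : I * N = N * I) (hIM : I * M = M * I)
    (kD : Lam * D - D * Lam = I * starAdj s E) (kE : Lam * E - E * Lam = -(I * starAdj s D))
    (kN : Lam * N - N * Lam = 2 * (I * starAdj s M))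
    (kM : Lam * M - M * Lam = -(2 * (I * starAdj s N)))
    (hND : N * D + D * N = 0) (hME : M * E + E * M = 0)
    (hDD : D * D + (N * E + E * N) = 0) (hEE : E * E + (M * D + D * M) = 0) :
    (N + D + E + M) * starAdj s (N + D + E + M) + starAdj s (N + D + E + M) * (N + D + E + M) =
      (D * starAdj s D + starAdj s D * D) + (E * starAdj s E + starAdj s E * E) +
      ((N + M) * starAdj s (N + M) + starAdj s (N + M) * (N + M)) -
      (D * starAdj s E + starAdj s E * D) - (E * starAdj s D + starAdj s D * E) := by
  -- The complex conjugate relations are instances of the same lemmas, with `I` replaced by `-I`.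
  have hI' : (-I) * (-I) = -1 := by rw [neg_mul_neg, hI]
  have r1 := kahler_relation hID hIE hIN hI kD kE kN hDD
  have r2 := kahler_relation (Lam := Lam) (I := -I) (D := E) (E := D) (N := M) (D' := starAdj s E)
    (E' := starAdj s D) (M' := starAdj s N) (by simp [hIE]) (by simp [hID]) (by simp [hIM])
    hI' (by simp [kE]) (by simp [kD]) (by simp [kM]) hEE
  have q1 := kahler_relation_two hID hIN hI kD kN hND
  have q2 := kahler_relation_two (Lam := Lam) (I := -I) (D := E) (N := M)
    (E' := starAdj s D) (M' := starAdj s N) (by simp [hIE]) (by simp [hIM])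
    hI' (by simp [kE]) (by simp [kM]) hME
  -- Conjugating a relation by the star operator interchanges operators and adjoints.
  have aD := parity_starAdj hs hPD
  have aE := parity_starAdj hs hPE
  have aN := parity_starAdj hs hPN
  have aM := parity_starAdj hs hPM
  have sD := starAdj_starAdj hs hP hPD
  have sE := starAdj_starAdj hs hP hPE
  have sN := starAdj_starAdj hs hP hPN
  have sM := starAdj_starAdj hs hP hPM
  have flip : ∀ X Y : R, P * X = -(X * P) → P * Y = -(Y * P) →
      P * (s * (X * starAdj s Y + starAdj s Y * X) * s) = Y * starAdj s X + starAdj s X * Y := by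
    intro X Y hX hY
    rw [star_anticomm_star hs hP hX (parity_starAdj hs hY), starAdj_starAdj hs hP hY, mul_neg,
      ← mul_assoc, hP]
    noncomm_ring
  have r1' : E * starAdj s D + starAdj s D * E =
      (D * starAdj s N + starAdj s N * D) - 2 * (M * starAdj s E + starAdj s E * M) := by
    have h := congrArg (fun t => P * (s * t * s)) r1
    rw [← flip D E hPD hPE, ← flip N D hPN hPD, ← flip E M hPE hPM]
    refine Eq.trans h ?_; noncomm_ring
  have r2' : D * starAdj s E + starAdj s E * D =
      (E * starAdj s M + starAdj s M * E) - 2 * (N * starAdj s D + starAdj s D * N) := by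
    have h := congrArg (fun t => P * (s * t * s)) r2
    rw [← flip E D hPE hPD, ← flip M E hPM hPE, ← flip D N hPD hPN]
    refine Eq.trans h ?_; noncomm_ring
  have q1' : 2 * (M * starAdj s D + starAdj s D * M) + (E * starAdj s N + starAdj s N * E) = 0 := by
    have h := congrArg (fun t => P * (s * t * s)) q1
    rw [← flip D M hPD hPM, ← flip N E hPN hPE]
    refine Eq.trans (Eq.trans ?_ h) ?_ <;> noncomm_ring
  have q2' : 2 * (N * starAdj s E + starAdj s E * N) + (D * starAdj s M + starAdj s M * D) = 0 := by
    have h := congrArg (fun t => P * (s * t * s)) q2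
    rw [← flip E N hPE hPN, ← flip M D hPM hPD]
    refine Eq.trans (Eq.trans ?_ h) ?_ <;> noncomm_ring
  have div3 : ∀ X : R, 3 * X = 0 → X = 0 := by
    intro X hX
    have h3 : (3 : ℝ) • X = 0 := by
      rw [Algebra.smul_def, map_ofNat, hX]
    simpa using h3
  have z1 : D * starAdj s M + starAdj s M * D = 0 := by
    refine div3 _ ?_
    generalize D * starAdj s M + starAdj s M * D = x at *
    generalize N * starAdj s E + starAdj s E * N = y at *
    calc 3 * x = 2 * (2 * x + y) - (2 * y + x) := by noncomm_ring
      _ = 0 := by rw [q1, q2']; simp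
  have z2 : N * starAdj s E + starAdj s E * N = 0 := by simpa [z1] using q1
  have z3 : E * starAdj s N + starAdj s N * E = 0 := by
    refine div3 _ ?_
    generalize E * starAdj s N + starAdj s N * E = x at *
    generalize M * starAdj s D + starAdj s D * M = y at *
    calc 3 * x = 2 * (2 * x + y) - (2 * y + x) := by noncomm_ring
      _ = 0 := by rw [q2, q1']; simp
  have z4 : M * starAdj s D + starAdj s D * M = 0 := by simpa [z3] using q2
  have w1 : 2 * (D * starAdj s E + starAdj s E * D) + (N * starAdj s D + starAdj s D * N) +
      (E * starAdj s M + starAdj s M * E) = 0 := by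
    generalize D * starAdj s E + starAdj s E * D = x at *
    generalize N * starAdj s D + starAdj s D * N = y at *
    generalize E * starAdj s M + starAdj s M * E = z at *
    rw [two_mul]; nth_rewrite 1 [r1]; rw [r2']; noncomm_ring
  have w2 : 2 * (E * starAdj s D + starAdj s D * E) + (M * starAdj s E + starAdj s E * M) +
      (D * starAdj s N + starAdj s N * D) = 0 := by
    generalize E * starAdj s D + starAdj s D * E = x at *
    generalize M * starAdj s E + starAdj s E * M = y at *
    generalize D * starAdj s N + starAdj s N * D = z at *
    rw [two_mul]; nth_rewrite 1 [r2]; rw [r1']; noncomm_ring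
  have key : ∀ X Y : R, X - Y = 0 → X = Y := fun X Y => sub_eq_zero.mp
  refine key _ _ ?_
  simp only [starAdj_add]
  refine Eq.trans (b := (2 * (D * starAdj s E + starAdj s E * D) +
      (N * starAdj s D + starAdj s D * N) + (E * starAdj s M + starAdj s M * E)) +
      (2 * (E * starAdj s D + starAdj s D * E) + (M * starAdj s E + starAdj s E * M) +
      (D * starAdj s N + starAdj s N * D)) + (D * starAdj s M + starAdj s M * D) +
      (N * starAdj s E + starAdj s E * N) + (E * starAdj s N + starAdj s N * E) +
      (M * starAdj s D + starAdj s D * M)) ?_ ?_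
  · noncomm_ring
  · rw [w1, w2, z1, z2, z3, z4]; simp

end Algebra

/-! ### Creation and annihilation operators -/

/-- The graded exterior algebra `⨁ₖ Λ^k(ℝ⁶, ℂ)`, the fibre of the bundle of forms of mixed
degree. -/
abbrev Fiber : Type := ∀ k : ℕ, Model [⋀^Fin k]→L[ℝ] ℂ

open ContinuousAlternatingMap

/-- The exterior product `η ↦ θ ∧ η` with a complex-valued covector `θ`. -/
def wedgeOne (θ : Model →L[ℝ] ℂ) : Module.End ℂ Fiber where
  toFun η k := match k with
    | 0 => 0
    | k + 1 => alternatizeUncurryFin (θ.smulRight (η k))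
  map_add' η ξ := by
    funext k
    cases k with
    | zero => simp
    | succ k =>
      ext v
      simp [alternatizeUncurryFin_apply, Finset.sum_add_distrib, smul_add]
  map_smul' c η := by
    funext k
    cases k with
    | zero => exact (smul_zero (M := ℂ) (A := Model [⋀^Fin 0]→L[ℝ] ℂ) c).symm
    | succ k =>
      ext v
      simp [alternatizeUncurryFin_apply, Finset.mul_sum, mul_left_comm]

@[simp] theorem wedgeOne_zero_deg (θ : Model →L[ℝ] ℂ) (η : Fiber) : wedgeOne θ η 0 = 0 := rfl

theorem wedgeOne_succ (θ : Model →L[ℝ] ℂ) (η : Fiber) (k : ℕ) :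
    wedgeOne θ η (k + 1) = alternatizeUncurryFin (θ.smulRight (η k)) := rfl

theorem wedgeOne_apply (θ : Model →L[ℝ] ℂ) (η : Fiber) (k : ℕ) (v : Fin (k + 1) → Model) :
    wedgeOne θ η (k + 1) v =
      ∑ i : Fin (k + 1), (-1) ^ (i : ℕ) * (θ (v i) * η k (i.removeNth v)) := by
  rw [wedgeOne_succ, alternatizeUncurryFin_apply]
  simp

/-- The interior product `η ↦ η(v, ·)` with a vector `v`. -/
def interior (v : Model) : Module.End ℂ Fiber where
  toFun η k := (η (k + 1)).curryLeft v
  map_add' η ξ := by funext k; ext w; simp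
  map_smul' c η := by funext k; ext w; simp

@[simp] theorem interior_apply (v : Model) (η : Fiber) (k : ℕ) (w : Fin k → Model) :
    interior v η k w = η (k + 1) (Matrix.vecCons v w) := rfl

/-- The sign `(-1)^k` in degree `k`. -/
def parity : Module.End ℂ Fiber where
  toFun η k := (-1 : ℂ) ^ k • η k
  map_add' η ξ := by funext k; simp
  map_smul' c η := by funext k; simp [smul_comm c]

@[simp] theorem parity_apply (η : Fiber) (k : ℕ) : parity η k = (-1 : ℂ) ^ k • η k := rfl

theorem parity_mul_parity : parity * parity = 1 := by
  ext η k v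
  simp [← mul_assoc, ← mul_pow]

theorem parity_mul_wedgeOne (θ : Model →L[ℝ] ℂ) : parity * wedgeOne θ = -(wedgeOne θ * parity) := by
  ext η k v
  cases k with
  | zero => simp
  | succ k => simp [wedgeOne_apply, Finset.mul_sum, pow_succ, mul_left_comm]

theorem parity_mul_interior (v : Model) : parity * interior v = -(interior v * parity) := by
  ext η k w
  simp [pow_succ]

theorem interior_mul_wedgeOne (v : Model) (θ : Model →L[ℝ] ℂ) :
    interior v * wedgeOne θ = θ v • 1 - wedgeOne θ * interior v := by
  ext η k w
  cases k with
  | zero => simp [wedgeOne_apply]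
  | succ k =>
    have h : ∀ i : Fin (k + 1), (Fin.succ i).removeNth (Matrix.vecCons v w) =
        (Matrix.vecCons v (i.removeNth w)) := by
      intro i
      funext j
      refine Fin.cases ?_ (fun j => ?_) j
      · simp [Fin.removeNth]
      · simp [Fin.removeNth, Fin.succ_succAbove_succ]
    have h0 : (0 : Fin (k + 2)).removeNth (Matrix.vecCons v w) = w := by
      funext j; simp [Fin.removeNth]
    simp only [Module.End.mul_apply, interior_apply, wedgeOne_apply]
    rw [Fin.sum_univ_succ]
    simp [wedgeOne_apply, pow_succ, h, h0, sub_eq_add_neg, Finset.sum_neg_distrib]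

theorem interior_mul_self (v : Model) : interior v * interior v = 0 := by
  ext η k w
  exact (η (k + 2)).map_eq_zero_of_eq (i := 0) (j := 1) _ (by simp) (by simp)

theorem wedgeOne_mul_self (θ : Model →L[ℝ] ℂ) : wedgeOne θ * wedgeOne θ = 0 := by
  ext η k w
  rcases k with _ | _ | k
  · simp
  · simp [wedgeOne_apply]
  · let f : Model →L[ℝ] Model →L[ℝ] Model [⋀^Fin k]→L[ℝ] ℂ := LinearMap.toContinuousLinearMap
      { toFun := fun x => θ.smulRight (θ x • η k)
        map_add' := by intro x y; ext; simp; ring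
        map_smul' := by intro c x; ext; simp; ring }
    have := alternatizeUncurryFin_alternatizeUncurryFinCLM_comp_of_symmetric (𝕜 := ℝ) (E := Model)
      (F := ℂ) (n := k) (f := f)
      (by intro x y; ext; simp [f, mul_left_comm])
    simp only [Module.End.mul_apply, wedgeOne_succ]
    refine Eq.trans ?_ (congrArg (fun t => t w) this)
    congr 2
    ext x v
    simp [f, alternatizeUncurryFin_apply, Finset.mul_sum, mul_left_comm]

theorem wedgeOne_add (θ φ : Model →L[ℝ] ℂ) : wedgeOne (θ + φ) = wedgeOne θ + wedgeOne φ := by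
  ext η k w
  cases k with
  | zero => simp
  | succ k => simp [wedgeOne_apply, add_mul, mul_add, Finset.sum_add_distrib]

theorem wedgeOne_smul (c : ℂ) (θ : Model →L[ℝ] ℂ) : wedgeOne (c • θ) = c • wedgeOne θ := by
  ext η k w
  cases k with
  | zero => simp
  | succ k => simp [wedgeOne_apply, Finset.mul_sum, mul_left_comm, mul_assoc]

theorem interior_add (v w : Model) : interior (v + w) = interior v + interior w := by
  ext η k u
  simpa using (η (k + 1)).vecCons_add u v w

theorem interior_smul (c : ℝ) (v : Model) : interior (c • v) = (c : ℂ) • interior v := by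
  ext η k u
  simpa using (η (k + 1)).vecCons_smul u c v

/-- The interior product as a linear map in the vector. -/
def interiorLM : Model →ₗ[ℝ] Module.End ℂ Fiber where
  toFun := interior
  map_add' := interior_add
  map_smul' c v := by rw [interior_smul]; rfl

/-- The exterior product as a linear map in the covector. -/
def wedgeOneLM : (Model →L[ℝ] ℂ) →ₗ[ℂ] Module.End ℂ Fiber where
  toFun := wedgeOne
  map_add' := wedgeOne_add
  map_smul' := wedgeOne_smul

theorem interior_anticomm (v w : Model) : interior v * interior w = -(interior w * interior v) := by
  have h := interior_mul_self (v + w)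
  rw [interior_add] at h
  have := interior_mul_self v
  have := interior_mul_self w
  refine eq_neg_of_add_eq_zero_left (G := Module.End ℂ Fiber) ?_
  rw [← h, mul_add, add_mul, add_mul]
  simp [*, add_comm]

theorem wedgeOne_anticomm (θ φ : Model →L[ℝ] ℂ) :
    wedgeOne θ * wedgeOne φ = -(wedgeOne φ * wedgeOne θ) := by
  have h := wedgeOne_mul_self (θ + φ)
  rw [wedgeOne_add] at h
  have := wedgeOne_mul_self θ
  have := wedgeOne_mul_self φ
  refine eq_neg_of_add_eq_zero_left (G := Module.End ℂ Fiber) ?_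
  rw [← h, mul_add, add_mul, add_mul]
  simp [*, add_comm]

/-- Only the degrees up to six contribute to the infinite product `Fiber`. -/
theorem form_eq_zero_of_six_lt {k : ℕ} (hk : 6 < k) (η : Model [⋀^Fin k]→L[ℝ] ℂ) : η = 0 := by
  have : η.toAlternatingMap = 0 := by
    refine Module.Basis.ext_alternating (EuclideanSpace.basisFun (Fin 6) ℝ).toBasis ?_
    intro v hv
    have := Fintype.card_le_of_injective v hv
    simp at this
    omega
  exact ContinuousAlternatingMap.toAlternatingMap_injective this

section Clifford

variable {R : Type*} [Ring R] [Algebra ℂ R]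

/-- The canonical anticommutation relations for complex creation operators `a k = dz_k ∧`,
`b k = dz̄_k ∧` and the annihilation operators `α k`, `β k` dual to them. -/
structure CAR (a b α β : Fin 3 → R) : Prop where
  aa : ∀ i j, a i * a j = -(a j * a i)
  bb : ∀ i j, b i * b j = -(b j * b i)
  ab : ∀ i j, a i * b j = -(b j * a i)
  αα : ∀ i j, α i * α j = -(α j * α i)
  ββ : ∀ i j, β i * β j = -(β j * β i)
  αβ : ∀ i j, α i * β j = -(β j * α i)
  αa : ∀ i j, α i * a j = (if i = j then 1 else 0) - a j * α i
  βb : ∀ i j, β i * b j = (if i = j then 1 else 0) - b j * β i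
  αb : ∀ i j, α i * b j = -(b j * α i)
  βa : ∀ i j, β i * a j = -(a j * β i)

/-- The sum of `x i * y j * z k` over the cyclic permutations `(i, j, k)` of `(0, 1, 2)`. -/
def cyclic (x y z : Fin 3 → R) : R := x 0 * y 1 * z 2 + x 1 * y 2 * z 0 + x 2 * y 0 * z 1

/-- The contraction with the Hermitian form, `Λ = 2√-1 ∑ α k β k`. -/
def lefschetzDual (α β : Fin 3 → R) : R := (2 * Complex.I) • ∑ k, α k * β k

namespace CAR

variable {a b α β : Fin 3 → R} (h : CAR a b α β)
include h

omit [Algebra ℂ R] in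
theorem symm : CAR b a β α where
  aa := h.bb
  bb := h.aa
  ab i j := by rw [h.ab, neg_neg]
  αα := h.ββ
  ββ := h.αα
  αβ i j := by rw [h.αβ, neg_neg]
  αa := h.βb
  βb := h.αa
  αb := h.βa
  βa := h.αb

theorem lefschetzDual_comm_a (l : Fin 3) :
    lefschetzDual α β * a l - a l * lefschetzDual α β = -(2 * Complex.I) • β l := by
  have e : ∀ k, α k * β k * a l - a l * (α k * β k) = if k = l then -β k else 0 := by
    intro k
    rw [mul_assoc, h.βa, mul_neg, ← mul_assoc, h.αa]
    split_ifs <;> noncomm_ring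
  have e2 : (∑ k, α k * β k) * a l - a l * ∑ k, α k * β k = - β l := by
    rw [Finset.sum_mul, Finset.mul_sum, ← Finset.sum_sub_distrib,
      Finset.sum_congr rfl fun k _ => e k]
    simp
  rw [lefschetzDual, smul_mul_assoc, mul_smul_comm, ← smul_sub, e2, smul_neg, neg_smul]

theorem lefschetzDual_comm_b (l : Fin 3) :
    lefschetzDual α β * b l - b l * lefschetzDual α β = (2 * Complex.I) • α l := by
  have e : lefschetzDual α β = -lefschetzDual β α := by
    simp only [lefschetzDual, h.αβ, Finset.sum_neg_distrib, smul_neg]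
  have := h.symm.lefschetzDual_comm_a l
  rw [e]
  rw [neg_mul, mul_neg, sub_neg_eq_add, neg_add_eq_sub, ← neg_sub, this, neg_smul, neg_neg]

theorem lefschetzDual_comm_β (l : Fin 3) :
    lefschetzDual α β * β l = β l * lefschetzDual α β := by
  rw [lefschetzDual, smul_mul_assoc, mul_smul_comm, Finset.sum_mul, Finset.mul_sum]
  congr 1
  refine Finset.sum_congr rfl fun k _ => ?_
  rw [mul_assoc, h.ββ k l, mul_neg, ← mul_assoc, h.αβ k l, neg_mul, neg_neg, mul_assoc]

/-- The two holomorphic creation operators in `N` each contribute one commutator with `Λ`, and both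
contributions are equal; this is the source of the factor `2` in `[Λ, N] = 2√-1 N̄*`. -/
theorem lefschetzDual_comm_cyclic :
    lefschetzDual α β * cyclic a a β - cyclic a a β * lefschetzDual α β =
      -(4 * Complex.I) • cyclic β β a := by
  have e : ∀ i j k, lefschetzDual α β * (a i * a j * β k) - (a i * a j * β k) * lefschetzDual α β =
      (2 * Complex.I) • (a j * (β i * β k) - a i * (β j * β k)) := by
    intro i j k
    have h1 : lefschetzDual α β * (a i * a j * β k) - (a i * a j * β k) * lefschetzDual α β =
        (lefschetzDual α β * a i - a i * lefschetzDual α β) * (a j * β k) +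
        a i * (lefschetzDual α β * a j - a j * lefschetzDual α β) * β k +
        a i * a j * (lefschetzDual α β * β k - β k * lefschetzDual α β) := by noncomm_ring
    rw [h1, h.lefschetzDual_comm_a, h.lefschetzDual_comm_a, h.lefschetzDual_comm_β, sub_self,
      mul_zero, add_zero, smul_mul_assoc, mul_smul_comm, smul_mul_assoc, ← smul_add, neg_smul,
      ← smul_neg, ← mul_assoc, h.βa]
    congr 1
    noncomm_ring
  have mv : ∀ i j k, β i * β j * a k = a k * (β i * β j) := by
    intro i j k
    rw [mul_assoc, h.βa, mul_neg, ← mul_assoc, h.βa, neg_mul, neg_neg, mul_assoc]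
  have s : lefschetzDual α β * cyclic a a β - cyclic a a β * lefschetzDual α β =
      (lefschetzDual α β * (a 0 * a 1 * β 2) - (a 0 * a 1 * β 2) * lefschetzDual α β) +
      (lefschetzDual α β * (a 1 * a 2 * β 0) - (a 1 * a 2 * β 0) * lefschetzDual α β) +
      (lefschetzDual α β * (a 2 * a 0 * β 1) - (a 2 * a 0 * β 1) * lefschetzDual α β) := by
    simp only [cyclic]; noncomm_ring
  rw [s, e, e, e, cyclic, mv, mv, mv, h.ββ 1 0, h.ββ 2 1, h.ββ 0 2, mul_neg, mul_neg,
    mul_neg]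
  module

end CAR

/-- What conjugation `X ↦ ⋆X⋆` by the star operator does to operators on forms; `P` is the parity
of the degree. -/
structure StarConj (P : R) (a b α β : Fin 3 → R) (τ : R → R) : Prop where
  add : ∀ X Y, τ (X + Y) = τ X + τ Y
  smul : ∀ (c : ℂ) X, τ (c • X) = starRingEnd ℂ c • τ X
  mul : ∀ X Y, τ (X * Y) = τ X * P * τ Y
  PP : P * P = 1
  Pα : ∀ i, P * α i = -(α i * P)
  Pβ : ∀ i, P * β i = -(β i * P)
  star_a : ∀ i, τ (a i) = (2 : ℂ) • α i
  star_b : ∀ i, τ (b i) = (2 : ℂ) • β i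
  star_α : ∀ i, τ (α i) = -(2⁻¹ : ℂ) • a i
  star_β : ∀ i, τ (β i) = -(2⁻¹ : ℂ) • b i

theorem StarConj.symm {P : R} {a b α β : Fin 3 → R} {τ : R → R} (h : StarConj P a b α β τ) :
    StarConj P b a β α τ :=
  ⟨h.add, h.smul, h.mul, h.PP, h.Pβ, h.Pα, h.star_b, h.star_a, h.star_β,
    h.star_α⟩

theorem StarConj.cyclic {P : R} {a b α β : Fin 3 → R} {τ : R → R} (h : StarConj P a b α β τ) :
    τ (cyclic b b α) = (2 : ℂ) • NearlyKahler.cyclic β β a := by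
  have e : ∀ i j k, τ (b i * b j * α k) = (2 : ℂ) • (β i * β j * a k) := by
    intro i j k
    rw [h.mul, h.mul, h.star_b, h.star_b, h.star_α]
    simp only [smul_mul_assoc, mul_smul_comm, smul_smul]
    rw [mul_assoc (β i) P, h.Pβ j, mul_neg, neg_mul, neg_mul, mul_assoc (β i), mul_assoc (β j) P P,
      h.PP, mul_one, ← neg_one_smul ℂ (_ : R), smul_mul_assoc, smul_smul]
    norm_num
  rw [NearlyKahler.cyclic, h.add, h.add, e, e, e, NearlyKahler.cyclic, smul_add, smul_add]

/-- The commutator of `Λ` with the algebraic operator `N` is twice the adjoint of `N̄`. The factor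
two arises because each of the two factors `a` in `N` contributes once. -/
theorem lefschetzDual_comm_N {P : R} {a b α β : Fin 3 → R} {τ : R → R} (h : CAR a b α β)
    (hτ : StarConj P a b α β τ) (κ : ℂ) :
    lefschetzDual α β * (starRingEnd ℂ κ • cyclic a a β) -
      (starRingEnd ℂ κ • cyclic a a β) * lefschetzDual α β =
      (2 * Complex.I) • -τ (κ • cyclic b b α) := by
  rw [hτ.smul, hτ.cyclic, mul_smul_comm, smul_mul_assoc, ← smul_sub, h.lefschetzDual_comm_cyclic]
  module

theorem lefschetzDual_comm_NBar {P : R} {a b α β : Fin 3 → R} {τ : R → R} (h : CAR a b α β)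
    (hτ : StarConj P a b α β τ) (κ : ℂ) :
    lefschetzDual α β * (κ • cyclic b b α) - (κ • cyclic b b α) * lefschetzDual α β =
      -(2 * Complex.I) • -τ (starRingEnd ℂ κ • cyclic a a β) := by
  have e : lefschetzDual α β = -lefschetzDual β α := by
    simp only [lefschetzDual, h.αβ, Finset.sum_neg_distrib, smul_neg]
  have h2 := lefschetzDual_comm_N h.symm hτ.symm (starRingEnd ℂ κ)
  rw [Complex.conj_conj] at h2
  rw [e, neg_mul, mul_neg, sub_neg_eq_add, neg_add_eq_sub, ← neg_sub, h2, neg_smul]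

end Clifford

/-! ### Wedge products with two-forms -/

/-- Laplace expansion of a sum over permutations along the first slot. -/
theorem sum_perm_succ {X : Type*} {n : ℕ} (f : (Fin (n + 1) → X) → ℂ) (v : Fin (n + 1) → X) :
    ∑ σ : Equiv.Perm (Fin (n + 1)), ((Equiv.Perm.sign σ : ℤ) : ℂ) * f (v ∘ σ) =
      ∑ p : Fin (n + 1), (-1) ^ (p : ℕ) * ∑ τ : Equiv.Perm (Fin n),
        ((Equiv.Perm.sign τ : ℤ) : ℂ) * f (Fin.cons (v p) (p.removeNth v ∘ τ)) := by
  let F : Fin (n + 1) × Equiv.Perm (Fin n) → Equiv.Perm (Fin (n + 1)) := fun x =>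
    (Fin.cycleRange x.1).symm * Equiv.Perm.decomposeFin.symm (0, x.2)
  have F0 : ∀ x, F x 0 = x.1 := by intro x; simp [F]
  have Fs : ∀ x i, F x (Fin.succ i) = x.1.succAbove (x.2 i) := by
    intro x i
    simp [F, Equiv.Perm.decomposeFin_symm_apply_succ]
  have hF : Function.Bijective F := by
    rw [Fintype.bijective_iff_injective_and_card]
    constructor
    · rintro ⟨p, τ⟩ ⟨q, τ'⟩ h
      have h0 : p = q := by have := F0 (p, τ); rw [h, F0] at this; exact this.symm
      subst h0
      congr 1
      ext i
      have := Fs (p, τ) i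
      rw [h, Fs] at this
      exact congrArg Fin.val (Fin.succAbove_right_injective this).symm
    · simp [Fintype.card_perm, Nat.factorial_succ]
  rw [← Equiv.sum_comp (Equiv.ofBijective F hF), Fintype.sum_prod_type]
  refine Finset.sum_congr rfl fun p _ => ?_
  rw [Finset.mul_sum]
  refine Finset.sum_congr rfl fun τ _ => ?_
  have hs : ((Equiv.Perm.sign (F (p, τ)) : ℤ) : ℂ) = (-1) ^ (p : ℕ) * (Equiv.Perm.sign τ : ℤ) := by
    simp [F, Equiv.Perm.decomposeFin.symm_sign]
  have hv : v ∘ F (p, τ) = Fin.cons (v p) (p.removeNth v ∘ τ) := by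
    funext i
    refine Fin.cases ?_ (fun i => ?_) i
    · simp [F0]
    · simp [Fs, Fin.removeNth]
  rw [Equiv.ofBijective_apply, hs, hv, mul_assoc]

/-- The sum over all permutations of an alternating function. -/
theorem sum_perm_form {n : ℕ} (β : Model [⋀^Fin n]→L[ℝ] ℂ) (v : Fin n → Model) :
    ∑ σ : Equiv.Perm (Fin n), ((Equiv.Perm.sign σ : ℤ) : ℂ) * β (v ∘ σ) = n.factorial * β v := by
  have : ∀ σ : Equiv.Perm (Fin n), ((Equiv.Perm.sign σ : ℤ) : ℂ) * β (v ∘ σ) = β v := by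
    intro σ
    have h := β.toAlternatingMap.map_perm v σ
    have h4 : β (v ∘ σ) = ((Equiv.Perm.sign σ : ℤ) : ℂ) * β v := by
      refine Eq.trans h ?_
      rw [Units.smul_def, zsmul_eq_mul]
      rfl
    rw [h4, ← mul_assoc]
    norm_cast
    simp
  rw [Finset.sum_congr rfl fun σ _ => this σ]
  simp [Fintype.card_perm]

theorem wedge_apply {V : Type*} [AddCommGroup V] [Module ℝ V] [TopologicalSpace V] {k l : ℕ}
    (α : V [⋀^Fin k]→L[ℝ] ℂ) (β : V [⋀^Fin l]→L[ℝ] ℂ) (v : Fin (k + l) → V) :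
    wedge α β v = ((k.factorial : ℂ) * (l.factorial : ℂ))⁻¹ *
      ∑ σ : Equiv.Perm (Fin (k + l)), ((Equiv.Perm.sign σ : ℤ) : ℂ) *
        (α (fun i => v (σ (Fin.castAdd l i))) * β (fun j => v (σ (Fin.natAdd k j)))) := by
  rw [wedge, ContinuousAlternatingMap.smul_apply, smul_eq_mul,
    ContinuousMultilinearMap.alternatization_apply_apply]
  congr 1
  refine Finset.sum_congr rfl fun σ _ => ?_
  rw [Units.smul_def, zsmul_eq_mul]
  rfl

/-- The wedge product with a two-form, expanded over the two slots of that form. -/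
theorem wedge_two_apply {l : ℕ} (α : Model [⋀^Fin 2]→L[ℝ] ℂ) (β : Model [⋀^Fin l]→L[ℝ] ℂ)
    (v : Fin (l + 1 + 1) → Model) :
    wedge α β (v ∘ Fin.cast (Nat.add_comm 2 l)) = 2⁻¹ *
      ∑ p : Fin (l + 1 + 1), (-1) ^ (p : ℕ) * ∑ q : Fin (l + 1), (-1) ^ (q : ℕ) *
        (α ![v p, p.removeNth v q] * β (q.removeNth (p.removeNth v))) := by
  rw [wedge_apply]
  let e : Fin (2 + l) ≃ Fin (l + 1 + 1) := finCongr (Nat.add_comm 2 l)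
  have h1 : ∑ σ : Equiv.Perm (Fin (2 + l)), ((Equiv.Perm.sign σ : ℤ) : ℂ) *
        (α (fun i => (v ∘ Fin.cast (Nat.add_comm 2 l)) (σ (Fin.castAdd l i))) *
          β (fun j => (v ∘ Fin.cast (Nat.add_comm 2 l)) (σ (Fin.natAdd 2 j)))) =
      ∑ σ : Equiv.Perm (Fin (l + 1 + 1)), ((Equiv.Perm.sign σ : ℤ) : ℂ) *
        (fun w : Fin (l + 1 + 1) → Model => α ![w 0, w 1] * β (fun j => w j.succ.succ))
          (v ∘ σ) := by
    refine Fintype.sum_equiv e.permCongr _ _ fun σ => ?_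
    rw [Equiv.Perm.sign_permCongr]
    congr 2
    · congr 1
      funext i
      fin_cases i
      · simp [e, Equiv.permCongr_apply]; rfl
      · simp [e, Equiv.permCongr_apply]; rfl
    · congr 1
      funext j
      simp only [Function.comp_apply, Equiv.permCongr_apply, e, finCongr_apply, finCongr_symm]
      congr 3
      ext; simp [Nat.add_comm]; omega
  rw [h1, sum_perm_succ (fun w : Fin (l + 1 + 1) → Model => α ![w 0, w 1] *
    β (fun j => w j.succ.succ)) v]
  have h2 : ∀ p : Fin (l + 1 + 1), (∑ τ : Equiv.Perm (Fin (l + 1)), ((Equiv.Perm.sign τ : ℤ) : ℂ) *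
      (fun w : Fin (l + 1 + 1) → Model => α ![w 0, w 1] * β (fun j => w j.succ.succ))
        (Fin.cons (v p) (p.removeNth v ∘ τ))) =
      ∑ q : Fin (l + 1), (-1) ^ (q : ℕ) * (l.factorial *
        (α ![v p, p.removeNth v q] * β (q.removeNth (p.removeNth v)))) := by
    intro p
    have := sum_perm_succ (fun w : Fin (l + 1) → Model => α ![v p, w 0] * β (fun j => w j.succ))
      (p.removeNth v)
    refine Eq.trans (Finset.sum_congr rfl fun τ _ => ?_) (this.trans ?_)
    · rfl
    · refine Finset.sum_congr rfl fun q _ => ?_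
      congr 1
      have h3 := sum_perm_form β (q.removeNth (p.removeNth v))
      rw [mul_left_comm, ← h3, Finset.mul_sum]
      refine Finset.sum_congr rfl fun τ _ => ?_
      rw [mul_left_comm]
      rfl
  rw [Finset.sum_congr rfl fun p _ => congrArg _ (h2 p)]
  have hl : (l.factorial : ℂ) ≠ 0 := by exact_mod_cast l.factorial_ne_zero
  simp only [Finset.mul_sum]
  refine Finset.sum_congr rfl fun p _ => Finset.sum_congr rfl fun q _ => ?_
  simp [Nat.factorial]
  field_simp

/-! ### The standard Hermitian space -/

/-- The standard basis of `ℝ⁶`. -/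
def stdVec (i : Fin 6) : Model := EuclideanSpace.single i (1 : ℝ)

/-- The standard coordinates of `ℝ⁶`, as complex-valued covectors. -/
def coord (i : Fin 6) : Model →L[ℝ] ℂ := Complex.ofRealCLM.comp (EuclideanSpace.proj i)

/-- The index of `∂/∂x_k`, where `z_k = x_k + √-1 y_k`. -/
def reIdx (k : Fin 3) : Fin 6 := Fin.castAdd 3 k

/-- The index of `∂/∂y_k`, where `z_k = x_k + √-1 y_k`. -/
def imIdx (k : Fin 3) : Fin 6 := Fin.natAdd 3 k

@[simp] theorem coord_apply (i : Fin 6) (v : Model) : coord i v = (v i : ℂ) := rfl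

theorem coord_stdVec (i j : Fin 6) : coord i (stdVec j) = if i = j then 1 else 0 := by
  simp only [coord_apply, stdVec, PiLp.single_apply]
  split_ifs <;> simp

theorem sum_six {A : Type*} [AddCommMonoid A] (f : Fin 6 → A) :
    ∑ i, f i = ∑ k : Fin 3, (f (reIdx k) + f (imIdx k)) := by
  rw [Finset.sum_add_distrib]
  exact Fin.sum_univ_add (a := 3) (b := 3) f

theorem sum_coord_smul_stdVec (v : Model) : ∑ i, v i • stdVec i = v := by
  ext j
  simp [stdVec, Pi.single_apply]

/-- The standard complex structure of `ℝ⁶ = ℂ³`. -/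
def stdJ : Model →L[ℝ] Model := LinearMap.toContinuousLinearMap
  { toFun := fun v => WithLp.toLp 2 ![-v 3, -v 4, -v 5, v 0, v 1, v 2]
    map_add' := by
      intro v w; ext i; fin_cases i <;> simp <;> ring
    map_smul' := by
      intro c v; ext i; fin_cases i <;> simp }

theorem stdJ_apply (v : Model) : stdJ v = WithLp.toLp 2 ![-v 3, -v 4, -v 5, v 0, v 1, v 2] := rfl

theorem stdJ_re (k : Fin 3) : stdJ (stdVec (reIdx k)) = stdVec (imIdx k) := by
  ext i
  fin_cases k <;> fin_cases i <;>
    simp [stdJ_apply, stdVec, reIdx, imIdx, Fin.ext_iff]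

theorem stdJ_reIdx (v : Model) (l : Fin 3) : stdJ v (reIdx l) = -v (imIdx l) := by
  fin_cases l <;> simp [stdJ_apply, reIdx, imIdx]

theorem stdJ_imIdx (v : Model) (l : Fin 3) : stdJ v (imIdx l) = v (reIdx l) := by
  fin_cases l <;> simp [stdJ_apply, reIdx, imIdx]

theorem stdJ_stdJ (v : Model) : stdJ (stdJ v) = -v := by
  ext i; fin_cases i <;> simp [stdJ_apply]

theorem stdJ_im (k : Fin 3) : stdJ (stdVec (imIdx k)) = -stdVec (reIdx k) := by
  rw [← stdJ_re, stdJ_stdJ]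

/-- The standard metric of `ℝ⁶`. -/
def stdG : Model →L[ℝ] Model →L[ℝ] ℝ := innerSL ℝ

theorem stdG_apply (v w : Model) : stdG v w = ∑ i, v i * w i := by
  change inner ℝ v w = _
  simp [PiLp.inner_apply, mul_comm]

theorem stdG_symm (v w : Model) : stdG v w = stdG w v := by
  simp [stdG_apply, mul_comm]

theorem stdG_stdJ (v w : Model) : stdG (stdJ v) (stdJ w) = stdG v w := by
  simp [stdG_apply, stdJ_apply, Fin.sum_univ_six]; ring

/-- The standard Hermitian form of `ℂ³`. -/
def stdOmega : Model [⋀^Fin 2]→L[ℝ] ℂ := hermitianForm stdG stdJ stdG_symm stdJ_stdJ stdG_stdJ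

theorem stdOmega_apply (v : Fin 2 → Model) : stdOmega v =
    ∑ k, (coord (reIdx k) (v 0) * coord (imIdx k) (v 1) -
      coord (imIdx k) (v 0) * coord (reIdx k) (v 1)) := by
  change ((stdG (stdJ (v 0)) (v 1) : ℝ) : ℂ) = _
  simp [stdG_apply, stdJ_apply, Fin.sum_univ_six, Fin.sum_univ_three, reIdx, imIdx]
  ring

/-- Exterior multiplication by the standard Hermitian form. -/
def lefschetz : Module.End ℂ Fiber :=
  ∑ k, wedgeOne (coord (reIdx k)) * wedgeOne (coord (imIdx k))

theorem wedgeOne_wedgeOne_apply (θ φ : Model →L[ℝ] ℂ) (β : Fiber) (l : ℕ)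
    (v : Fin (l + 1 + 1) → Model) :
    (wedgeOne θ * wedgeOne φ) β (l + 2) v = ∑ p : Fin (l + 1 + 1), ∑ q : Fin (l + 1),
      (-1) ^ (p : ℕ) * ((-1) ^ (q : ℕ) *
        (θ (v p) * φ (p.removeNth v q) * β l (q.removeNth (p.removeNth v)))) := by
  rw [Module.End.mul_apply, wedgeOne_apply]
  refine Finset.sum_congr rfl fun p _ => ?_
  rw [wedgeOne_apply, Finset.mul_sum, Finset.mul_sum]
  refine Finset.sum_congr rfl fun q _ => ?_
  ring

theorem wedge_stdOmega (β : Fiber) (l : ℕ) (v : Fin (l + 1 + 1) → Model) :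
    wedge stdOmega (β l) (v ∘ Fin.cast (Nat.add_comm 2 l)) = lefschetz β (l + 2) v := by
  have h : lefschetz = (2⁻¹ : ℂ) • ∑ k, (wedgeOne (coord (reIdx k)) * wedgeOne (coord (imIdx k)) -
      wedgeOne (coord (imIdx k)) * wedgeOne (coord (reIdx k))) := by
    rw [lefschetz, Finset.smul_sum]
    refine Finset.sum_congr rfl fun k _ => ?_
    rw [wedgeOne_anticomm (coord (imIdx k))]
    module
  have h2 : lefschetz β (l + 2) v = 2⁻¹ * ∑ k,
      ((wedgeOne (coord (reIdx k)) * wedgeOne (coord (imIdx k))) β (l + 2) v -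
      (wedgeOne (coord (imIdx k)) * wedgeOne (coord (reIdx k))) β (l + 2) v) := by
    rw [h, Finset.sum_sub_distrib]
    simp [Finset.sum_apply]
  rw [wedge_two_apply, h2]
  congr 1
  simp only [wedgeOne_wedgeOne_apply, ← Finset.sum_sub_distrib]
  rw [Finset.sum_comm]
  refine Finset.sum_congr rfl fun p _ => ?_
  rw [Finset.sum_comm, Finset.mul_sum]
  refine Finset.sum_congr rfl fun q _ => ?_
  rw [stdOmega_apply, Finset.sum_mul, Finset.mul_sum, Finset.mul_sum]
  refine Finset.sum_congr rfl fun k _ => ?_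
  simp only [Matrix.cons_val_zero, Matrix.cons_val_one]
  ring

theorem reIdx_inj {i j : Fin 3} : reIdx i = reIdx j ↔ i = j := by simp [reIdx, Fin.ext_iff]
theorem imIdx_inj {i j : Fin 3} : imIdx i = imIdx j ↔ i = j := by simp [imIdx, Fin.ext_iff]
theorem reIdx_ne_imIdx (i j : Fin 3) : reIdx i ≠ imIdx j := by
  simp [reIdx, imIdx, Fin.ext_iff]; omega

section Clifford

variable {R : Type*} [Ring R] [Algebra ℂ R]

/-- The operators `dz_k ∧`, given the operators `w i = e^i ∧`. -/
def creA (w : Fin 6 → R) (k : Fin 3) : R := w (reIdx k) + Complex.I • w (imIdx k)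

/-- The operators `dz̄_k ∧`, given the operators `w i = e^i ∧`. -/
def creB (w : Fin 6 → R) (k : Fin 3) : R := w (reIdx k) - Complex.I • w (imIdx k)

/-- The interior products with `∂/∂z_k`, given those with the standard basis. -/
def annA (c : Fin 6 → R) (k : Fin 3) : R :=
  (2⁻¹ : ℂ) • (c (reIdx k) - Complex.I • c (imIdx k))

/-- The interior products with `∂/∂z̄_k`, given those with the standard basis. -/
def annB (c : Fin 6 → R) (k : Fin 3) : R :=
  (2⁻¹ : ℂ) • (c (reIdx k) + Complex.I • c (imIdx k))

theorem cre_re (w : Fin 6 → R) (k : Fin 3) : w (reIdx k) = (2⁻¹ : ℂ) • (creA w k + creB w k) := by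
  simp only [creA, creB]; module

theorem cre_im (w : Fin 6 → R) (k : Fin 3) :
    w (imIdx k) = (-(2⁻¹ * Complex.I) : ℂ) • (creA w k - creB w k) := by
  have : creA w k - creB w k = (2 * Complex.I) • w (imIdx k) := by
    simp only [creA, creB]; module
  rw [this, smul_smul]
  have : -(2⁻¹ * Complex.I) * (2 * Complex.I) = 1 := by
    linear_combination -Complex.I_mul_I
  rw [this, one_smul]

theorem ann_re (c : Fin 6 → R) (k : Fin 3) : c (reIdx k) = annA c k + annB c k := by
  simp only [annA, annB]; module

/-- The canonical anticommutation relations in a real orthonormal basis. -/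
structure RealCAR (w c : Fin 6 → R) : Prop where
  ww : ∀ i j, w i * w j = -(w j * w i)
  cc : ∀ i j, c i * c j = -(c j * c i)
  cw : ∀ i j, c i * w j = (if j = i then 1 else 0) - w j * c i

theorem RealCAR.car {w c : Fin 6 → R} (h : RealCAR w c) :
    CAR (creA w) (creB w) (annA c) (annB c) := by
  have I2 : ∀ x : R, Complex.I • Complex.I • x = -x := by
    intro x; rw [smul_smul, Complex.I_mul_I, neg_one_smul]
  constructor <;> intro i j <;>
    simp only [creA, creB, annA, annB, smul_mul_assoc, mul_smul_comm, add_mul, mul_add, sub_mul,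
      mul_sub]
  · rw [h.ww (reIdx j) (reIdx i), h.ww (reIdx j) (imIdx i), h.ww (imIdx j) (reIdx i),
      h.ww (imIdx j) (imIdx i)]
    module
  · rw [h.ww (reIdx j) (reIdx i), h.ww (reIdx j) (imIdx i), h.ww (imIdx j) (reIdx i),
      h.ww (imIdx j) (imIdx i)]
    module
  · rw [h.ww (reIdx j) (reIdx i), h.ww (reIdx j) (imIdx i), h.ww (imIdx j) (reIdx i),
      h.ww (imIdx j) (imIdx i)]
    module
  · rw [h.cc (reIdx j) (reIdx i), h.cc (reIdx j) (imIdx i), h.cc (imIdx j) (reIdx i),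
      h.cc (imIdx j) (imIdx i)]
    module
  · rw [h.cc (reIdx j) (reIdx i), h.cc (reIdx j) (imIdx i), h.cc (imIdx j) (reIdx i),
      h.cc (imIdx j) (imIdx i)]
    module
  · rw [h.cc (reIdx j) (reIdx i), h.cc (reIdx j) (imIdx i), h.cc (imIdx j) (reIdx i),
      h.cc (imIdx j) (imIdx i)]
    module
  all_goals
    simp only [h.cw, reIdx_inj, imIdx_inj, if_neg (reIdx_ne_imIdx _ _),
      if_neg (reIdx_ne_imIdx _ _).symm, eq_comm (a := j)]
    split_ifs <;> match_scalars <;> ring_nf <;> (simp only [Complex.I_sq]; norm_num)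

theorem RealCAR.sum_re_im {w c : Fin 6 → R} (h : RealCAR w c) :
    ∑ k, w (reIdx k) * w (imIdx k) = (2⁻¹ * Complex.I) • ∑ k, creA w k * creB w k := by
  rw [Finset.smul_sum]
  refine Finset.sum_congr rfl fun k _ => ?_
  have h0 : ∀ i, w i * w i = 0 := by
    intro i
    have := h.ww i i
    have h2 : (2 : ℂ) • (w i * w i) = 0 := by
      rw [two_smul]; nth_rewrite 1 [this]; simp
    simpa using h2
  simp only [creA, creB, smul_mul_assoc, mul_smul_comm, add_mul, mul_sub, h0,
    h.ww (imIdx k) (reIdx k)]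
  match_scalars
  ring_nf
  simp only [Complex.I_sq]
  norm_num

end Clifford

/-- The operators `e^i ∧` of the standard basis. -/
def cre (i : Fin 6) : Module.End ℂ Fiber := wedgeOne (coord i)

/-- The interior products with the standard basis. -/
def ann (i : Fin 6) : Module.End ℂ Fiber := interior (stdVec i)

theorem realCAR : RealCAR cre ann where
  ww i j := wedgeOne_anticomm _ _
  cc i j := interior_anticomm _ _
  cw i j := by
    rw [ann, cre, interior_mul_wedgeOne, coord_stdVec]
    split_ifs <;> simp

theorem car : CAR (creA cre) (creB cre) (annA ann) (annB ann) := realCAR.car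

theorem lefschetz_eq : lefschetz = (2⁻¹ * Complex.I) • ∑ k, creA cre k * creB cre k :=
  realCAR.sum_re_im

/-! ### The Hodge star operator on the standard space -/

/-- The constant function `c` as a form of mixed degree. -/
def scalar (c : ℂ) : Fiber := fun k => match k with
  | 0 => constOfIsEmpty ℝ Model (Fin 0) c
  | _ + 1 => 0

theorem smul_scalar (c d : ℂ) : c • scalar d = scalar (c * d) := by
  funext k
  cases k with
  | zero => ext v; simp [scalar]
  | succ k => ext v; simp [scalar]

theorem interior_scalar (v : Model) (c : ℂ) : interior v (scalar c) = 0 := by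
  funext k
  ext w
  simp [scalar]

theorem parity_scalar (c : ℂ) : parity (scalar c) = scalar c := by
  funext k
  cases k with
  | zero => simp
  | succ k => ext v; simp [scalar]

/-- The number operator: `∑ e^i ∧ ι_{e_i}` multiplies forms of degree `k` by `k`. -/
theorem sum_cre_mul_ann (η : Fiber) (k : ℕ) :
    (∑ i, cre i * ann i) η k = (k : ℂ) • η k := by
  ext v
  cases k with
  | zero => simp [cre, Finset.sum_apply]
  | succ k =>
    have h : ∀ p : Fin (k + 1), ∑ i, (v p i : ℂ) *
        η (k + 1) (Matrix.vecCons (stdVec i) (p.removeNth v))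
        = η (k + 1) (Matrix.vecCons (v p) (p.removeNth v)) := by
      intro p
      conv_rhs => rw [← sum_coord_smul_stdVec (v p)]
      have := map_sum ((η (k + 1)).curryLeft) (fun i => v p i • stdVec i) Finset.univ
      have := congrArg (fun t => t (p.removeNth v)) this
      refine Eq.trans ?_ this.symm
      simp
    simp only [Finset.sum_apply, LinearMap.sum_apply, ContinuousAlternatingMap.sum_apply,
      Module.End.mul_apply, cre, wedgeOne_apply, ann, interior_apply, coord_apply]
    rw [Finset.sum_comm]
    simp only [← Finset.mul_sum, h]
    have h2 : ∀ p : Fin (k + 1), (-1 : ℂ) ^ (p : ℕ) *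
        η (k + 1) (Matrix.vecCons (v p) (p.removeNth v)) = η (k + 1) v := by
      intro p
      have := (η (k + 1)).map_insertNth p (v p) (p.removeNth v)
      rw [Fin.insertNth_self_removeNth] at this
      rw [this]
      simp
    simp [h2]

/-- Every form is obtained from constants by exterior products with covectors and sums. -/
theorem fiber_induction {p : Fiber → Prop} (h0 : ∀ c, p (scalar c))
    (hadd : ∀ η ξ, p η → p ξ → p (η + ξ)) (hw : ∀ i η, p η → p (cre i η)) (η : Fiber) : p η := by
  have hz : p 0 := by
    have : scalar 0 = 0 := by
      funext k; cases k <;> ext <;> simp [scalar]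
    rw [← this]; exact h0 0
  have hsum : ∀ {ι : Type} (s : Finset ι) (f : ι → Fiber), (∀ i, p (f i)) → p (∑ i ∈ s, f i) := by
    intro ι s f hf
    classical
    induction s using Finset.induction_on with
    | empty => simpa using hz
    | insert a s ha ih => rw [Finset.sum_insert ha]; exact hadd _ _ (hf a) ih
  have hsing : ∀ k (ξ : Model [⋀^Fin k]→L[ℝ] ℂ), p (Pi.single k ξ) := by
    intro k
    induction k with
    | zero =>
      intro ξ
      have : Pi.single 0 ξ = scalar (ξ 0) := by
        funext k
        cases k with
        | zero =>
          ext v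
          simp [scalar, Subsingleton.elim v 0]
        | succ k => simp [scalar]
      rw [this]; exact h0 _
    | succ k ih =>
      intro ξ
      have h1 : ∀ i, ann i (Pi.single (k + 1) (((k : ℂ) + 1)⁻¹ • ξ)) =
          Pi.single k ((((k : ℂ) + 1)⁻¹ • ξ).curryLeft (stdVec i)) := by
        intro i
        funext m
        by_cases hm : m = k
        · subst hm; ext w; simp [ann]
        · ext w; simp [ann, hm]
      have : Pi.single (k + 1) ξ =
          ∑ i, cre i (ann i (Pi.single (k + 1) (((k : ℂ) + 1)⁻¹ • ξ))) := by
        funext m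
        have := sum_cre_mul_ann (Pi.single (k + 1) (((k : ℂ) + 1)⁻¹ • ξ)) m
        rw [LinearMap.sum_apply] at this
        refine Eq.trans ?_ this.symm
        by_cases hm : m = k + 1
        · subst hm
          have : (k : ℂ) + 1 ≠ 0 := by exact_mod_cast k.succ_ne_zero
          simp [smul_smul, this]
        · ext v; simp [hm]
      rw [this]
      refine hsum _ _ fun i => hw _ _ ?_
      rw [h1]
      exact ih _
  have : η = ∑ k ∈ Finset.range 7, Pi.single k (η k) := by
    funext m
    rw [Finset.sum_apply]
    by_cases hm : m < 7
    · rw [Finset.sum_eq_single m]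
      · simp
      · intro k _ hk; simp [hk.symm]
      · simp [hm]
    · rw [form_eq_zero_of_six_lt (by omega) (η m)]
      exact (form_eq_zero_of_six_lt (by omega) _).symm
  rw [this]
  exact hsum _ _ fun k => hsing _ _

theorem append_update_left {X : Type*} {k m : ℕ} (w : Fin k → X) (v : Fin m → X) (i : Fin k)
    (z : X) : Fin.append (Function.update w i z) v =
      Function.update (Fin.append w v) (Fin.castAdd m i) z := by
  funext a
  refine Fin.addCases (fun b => ?_) (fun b => ?_) a
  · simp [Function.update_apply]
  · rw [Function.update_of_ne]
    · simp
    · intro h; have := congrArg Fin.val h; simp at this; omega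

/-- The contraction `ε(w, v)` as an alternating map in its first group of arguments `w`. -/
def contractLeft {k m n : ℕ} (h : k + m = n) (ε : Model [⋀^Fin n]→L[ℝ] ℂ) (v : Fin m → Model) :
    Model [⋀^Fin k]→ₗ[ℝ] ℂ where
  toMultilinearMap := MultilinearMap.mk' (fun w => ε (fun a => Fin.append w v (Fin.cast h.symm a)))
    (by
      subst h
      intro w i x y
      simpa only [append_update_left, Fin.cast_eq_self] using ε.map_update_add (Fin.append w v)
        (Fin.castAdd m i) x y)
    (by
      subst h
      intro w i c x
      simpa only [append_update_left, Fin.cast_eq_self] using ε.map_update_smul (Fin.append w v)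
        (Fin.castAdd m i) c x)
  map_eq_zero_of_eq' := by
    intro w i j hw hij
    refine ε.map_eq_zero_of_eq _ (i := Fin.cast h (Fin.castAdd m i))
      (j := Fin.cast h (Fin.castAdd m j)) (by simpa using hw) ?_
    intro h; have := congrArg Fin.val h; simp at this; omega

theorem contractLeft_apply {k m n : ℕ} (h : k + m = n) (ε : Model [⋀^Fin n]→L[ℝ] ℂ)
    (v : Fin m → Model) (w : Fin k → Model) : contractLeft h ε v w = contract h ε w v := rfl

/-- Moving a vector through `k` slots of a form, from position `p` to the end. -/
theorem contract_insertNth {k m n : ℕ} (h : k + 1 + m = n) (h' : k + (m + 1) = n)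
    (ε : Model [⋀^Fin n]→L[ℝ] ℂ) (p : Fin (k + 1)) (x : Model) (w : Fin k → Model)
    (v : Fin m → Model) :
    (-1 : ℂ) ^ (p : ℕ) * contract h ε (p.insertNth x w) v =
      (-1) ^ k * contract h' ε w (Matrix.vecCons x v) := by
  have h1 := (contractLeft h ε v).neg_one_pow_smul_map_insertNth p x w
  have h2 := (contractLeft h ε v).neg_one_pow_smul_map_insertNth (Fin.last k) x w
  have h3 := h1.trans h2.symm
  simp only [contractLeft_apply, Fin.val_last] at h3
  have h4 : contract h ε ((Fin.last k).insertNth x w) v =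
      contract h' ε w (Matrix.vecCons x v) := by
    subst h'
    change ε _ = ε _
    congr 1
    funext a
    rw [Fin.insertNth_last', Fin.append_left_snoc]
    simp
    rfl
  rw [h4] at h3
  simpa using h3

/-- The coefficients of the star operator in an orthonormal basis. -/
theorem hodgeStar_apply_of_gram_eq_one {g : Model →L[ℝ] Model →L[ℝ] ℝ} {n : ℕ} {b : Fin n → Model}
    (hb : gram g b = 1) (ε : Model [⋀^Fin n]→L[ℝ] ℂ) {k m : ℕ} (h : k + m = n)
    (β : Model [⋀^Fin k]→L[ℝ] ℂ) (v : Fin m → Model) :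
    hodgeStar g b ε h β v = (k.factorial : ℂ)⁻¹ *
      ∑ i : Fin k → Fin n, starRingEnd ℂ (β (b ∘ i)) * contract h ε (b ∘ i) v := by
  rw [hodgeStar, hb, inv_one, ContinuousAlternatingMap.smul_apply, smul_eq_mul]
  congr 1
  rw [ContinuousAlternatingMap.sum_apply]
  refine Finset.sum_congr rfl fun i _ => ?_
  rw [ContinuousAlternatingMap.sum_apply, Finset.sum_eq_single i]
  · simp [Function.comp_def]
  · intro j _ hj
    have : ∃ a, i a ≠ j a := by
      by_contra hc; push Not at hc; exact hj (funext fun a => (hc a).symm)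
    obtain ⟨a, ha⟩ := this
    have : (∏ a, (1 : Matrix (Fin n) (Fin n) ℝ) (i a) (j a)) = 0 :=
      Finset.prod_eq_zero (Finset.mem_univ a) (Matrix.one_apply_ne ha)
    rw [this]
    simp
  · simp

/-- The star operator on forms of mixed degree. -/
def starFiber (g : Model →L[ℝ] Model →L[ℝ] ℝ) (b : Fin 6 → Model) (ε : Model [⋀^Fin 6]→L[ℝ] ℂ) :
    Fiber →ₛₗ[starRingEnd ℂ] Fiber where
  toFun η m := if h : m ≤ 6 then hodgeStar g b ε (Nat.sub_add_cancel h) (η (6 - m)) else 0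
  map_add' η ξ := by
    funext m
    by_cases h : m ≤ 6
    · ext v
      simp [h, hodgeStar, mul_add, add_mul, Finset.sum_add_distrib]
    · simp [h]
  map_smul' c η := by
    funext m
    by_cases h : m ≤ 6
    · ext v
      simp [h, hodgeStar, Finset.mul_sum]
      refine Finset.sum_congr rfl fun i _ => Finset.sum_congr rfl fun j _ => ?_
      ring
    · ext v; simp [h]

theorem starFiber_apply (g : Model →L[ℝ] Model →L[ℝ] ℝ) (b : Fin 6 → Model)
    (ε : Model [⋀^Fin 6]→L[ℝ] ℂ) (η : Fiber) {k m : ℕ} (h : k + m = 6) :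
    starFiber g b ε η m = hodgeStar g b ε h (η k) := by
  have hm : m ≤ 6 := by omega
  obtain rfl : k = 6 - m := by omega
  change dite _ _ _ = _
  rw [dif_pos hm]

theorem starFiber_of_six_lt (g : Model →L[ℝ] Model →L[ℝ] ℝ) (b : Fin 6 → Model)
    (ε : Model [⋀^Fin 6]→L[ℝ] ℂ) (η : Fiber) {m : ℕ} (h : 6 < m) :
    starFiber g b ε η m = 0 := form_eq_zero_of_six_lt h _

/-- The star operator exchanges exterior and interior products. -/
theorem starFiber_wedgeOne {g : Model →L[ℝ] Model →L[ℝ] ℝ} {b : Fin 6 → Model}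
    (hb : gram g b = 1) (ε : Model [⋀^Fin 6]→L[ℝ] ℂ) (θ : Model →L[ℝ] ℂ) (η : Fiber) :
    starFiber g b ε (wedgeOne θ η) =
      ∑ c, starRingEnd ℂ (θ (b c)) • interior (b c) (starFiber g b ε (parity η)) := by
  funext m
  rcases lt_trichotomy m 6 with hm | rfl | hm
  · obtain ⟨k, hk⟩ : ∃ k, k + 1 + m = 6 := ⟨5 - m, by omega⟩
    have hk' : k + (m + 1) = 6 := by omega
    rw [starFiber_apply g b ε _ hk]
    ext v
    rw [hodgeStar_apply_of_gram_eq_one hb, Finset.sum_apply, ContinuousAlternatingMap.sum_apply]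
    simp only [Pi.smul_apply, ContinuousAlternatingMap.smul_apply, interior_apply]
    rw [starFiber_apply g b ε _ hk']
    simp only [hodgeStar_apply_of_gram_eq_one hb, wedgeOne_apply, parity_apply,
      ContinuousAlternatingMap.smul_apply, smul_eq_mul, map_mul, map_pow, map_neg, map_one,
      _root_.map_sum, Finset.sum_mul]
    rw [Finset.sum_comm]
    have h1 : ∀ p : Fin (k + 1), ∑ i : Fin (k + 1) → Fin 6, (-1 : ℂ) ^ (p : ℕ) *
        (starRingEnd ℂ (θ ((b ∘ i) p)) * starRingEnd ℂ (η k (p.removeNth (b ∘ i)))) *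
          contract hk ε (b ∘ i) v =
        ∑ c, ∑ j : Fin k → Fin 6, starRingEnd ℂ (θ (b c)) * ((-1) ^ k *
          starRingEnd ℂ (η k (b ∘ j)) * contract hk' ε (b ∘ j) (Matrix.vecCons (b c) v)) := by
      intro p
      rw [← Fintype.sum_prod_type', ← Equiv.sum_comp (Fin.insertNthEquiv (fun _ => Fin 6) p)]
      refine Finset.sum_congr rfl fun x _ => ?_
      have e1 : b ∘ (Fin.insertNthEquiv (fun _ => Fin 6) p x) = p.insertNth (b x.1) (b ∘ x.2) := by
        funext a
        refine Fin.succAboveCases p ?_ (fun a => ?_) a <;> simp [Fin.insertNthEquiv]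
      rw [e1, Fin.insertNth_apply_same, Fin.removeNth_insertNth]
      have := contract_insertNth hk hk' ε p (b x.1) (b ∘ x.2) v
      linear_combination (starRingEnd ℂ (θ (b x.1)) * starRingEnd ℂ (η k (b ∘ x.2))) * this
    simp only [h1]
    simp only [Finset.sum_const, Finset.card_univ, Fintype.card_fin, nsmul_eq_mul, Nat.factorial]
    have : (k.factorial : ℂ) ≠ 0 := by exact_mod_cast k.factorial_ne_zero
    have : (k : ℂ) + 1 ≠ 0 := by exact_mod_cast k.succ_ne_zero
    push_cast
    rw [← mul_assoc, Finset.mul_sum]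
    refine Finset.sum_congr rfl fun c _ => ?_
    rw [← Finset.mul_sum]
    field_simp
  · rw [starFiber_apply g b ε _ (zero_add 6), wedgeOne_zero_deg]
    ext v
    rw [hodgeStar_apply_of_gram_eq_one hb, Finset.sum_apply, ContinuousAlternatingMap.sum_apply]
    simp only [Pi.smul_apply, ContinuousAlternatingMap.smul_apply, interior_apply,
      starFiber_of_six_lt g b ε _ (show 6 < 6 + 1 by norm_num)]
    simp
  · exact (form_eq_zero_of_six_lt hm _).trans (form_eq_zero_of_six_lt hm _).symm

theorem gram_stdG_stdVec : gram stdG stdVec = 1 := by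
  ext i j
  simp [gram, stdG_apply, stdVec, PiLp.single_apply, Matrix.one_apply, eq_comm]

/-- The standard volume form `ω³/3!`. -/
def stdVol : Model [⋀^Fin 6]→L[ℝ] ℂ := (6 : ℂ)⁻¹ • wedge stdOmega (wedge stdOmega stdOmega)

/-- The star operator of the standard Hermitian space. -/
def stdStar : Fiber →ₛₗ[starRingEnd ℂ] Fiber := starFiber stdG stdVec stdVol

theorem stdStar_cre (i : Fin 6) (η : Fiber) :
    stdStar (cre i η) = ann i (stdStar (parity η)) := by
  rw [cre, stdStar, starFiber_wedgeOne gram_stdG_stdVec, Finset.sum_eq_single i]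
  · rw [coord_stdVec, if_pos rfl, map_one, one_smul]
    rfl
  · intro c _ hc
    rw [coord_stdVec, if_neg hc.symm, _root_.map_zero]
    exact zero_smul ℂ (_ : Fiber)
  · simp

theorem parity_parity (η : Fiber) : parity (parity η) = η :=
  congrArg (fun T : Module.End ℂ Fiber => T η) parity_mul_parity

theorem parity_cre (i : Fin 6) (η : Fiber) : parity (cre i η) = -cre i (parity η) :=
  congrArg (fun T : Module.End ℂ Fiber => T η) (parity_mul_wedgeOne (coord i))

theorem parity_ann (i : Fin 6) (η : Fiber) : parity (ann i η) = -ann i (parity η) :=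
  congrArg (fun T : Module.End ℂ Fiber => T η) (parity_mul_interior (stdVec i))

theorem ann_cre (i j : Fin 6) (η : Fiber) :
    ann i (cre j η) = (if j = i then η else 0) - cre j (ann i η) := by
  have := congrArg (fun T : Module.End ℂ Fiber => T η) (realCAR.cw i j)
  refine this.trans ?_
  split_ifs <;> rfl

theorem stdStar_parity (η : Fiber) : stdStar (parity η) = parity (stdStar η) := by
  funext m
  by_cases h : m ≤ 6
  · have h2 : (6 - m) + m = 6 := Nat.sub_add_cancel h
    have h3 : (-1 : ℂ) ^ (6 - m) = (-1) ^ m := by interval_cases m <;> norm_num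
    have h4 := congrFun (stdStar.map_smulₛₗ ((-1 : ℂ) ^ m) η) m
    refine Eq.trans ?_ (h4.trans ?_)
    · rw [stdStar, starFiber_apply _ _ _ _ h2, starFiber_apply _ _ _ _ h2, parity_apply, h3]
      rfl
    · simp
  · exact (form_eq_zero_of_six_lt (by omega) _).trans (form_eq_zero_of_six_lt (by omega) _).symm

theorem stdStar_scalar (c : ℂ) (m : ℕ) (hm : m ≠ 6) : stdStar (scalar c) m = 0 := by
  by_cases h : m ≤ 6
  · obtain ⟨k, hk⟩ : ∃ k, k + 1 + m = 6 := ⟨5 - m, by omega⟩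
    rw [stdStar, starFiber_apply _ _ _ _ hk]
    ext v
    simp [hodgeStar, scalar]
  · exact form_eq_zero_of_six_lt (by omega) _

theorem stdStar_ann (η : Fiber) : ∀ i, stdStar (ann i η) = -cre i (stdStar (parity η)) := by
  induction η using fiber_induction with
  | h0 c =>
    intro i
    rw [ann, interior_scalar, _root_.map_zero, parity_scalar]
    refine (neg_eq_zero.mpr ?_).symm
    funext m
    rcases m with _ | m
    · rfl
    · by_cases hm : m = 6
      · exact form_eq_zero_of_six_lt (by omega) _
      · rw [cre, wedgeOne_succ, stdStar_scalar c m hm]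
        ext v
        simp [alternatizeUncurryFin_apply]
  | hadd η ξ h1 h2 => intro i; simp only [map_add, h1, h2]; abel
  | hw j η h =>
    intro i
    rw [ann_cre, _root_.map_sub, stdStar_cre, stdStar_parity, h, _root_.map_neg, parity_cre,
      neg_neg, ← stdStar_parity, parity_parity, parity_cre, _root_.map_neg, _root_.map_neg,
      stdStar_cre, parity_parity, neg_neg]
    have := ann_cre j i (stdStar η)
    rw [this]
    by_cases hij : i = j
    · subst hij; simp
    · simp [hij, Ne.symm hij]

/-- Three commuting elements of square zero. -/
theorem cube_of_sq_zero {R : Type*} [Ring R] (x y z : R) (hx : x * x = 0) (hy : y * y = 0)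
    (hz : z * z = 0) (hyx : y * x = x * y) (hzx : z * x = x * z) (hzy : z * y = y * z) :
    (x + y + z) * ((x + y + z) * (x + y + z)) = 6 • (x * (y * z)) := by
  have e1 : ∀ t, y * (x * t) = x * (y * t) := by intro t; rw [← mul_assoc, hyx, mul_assoc]
  have e2 : ∀ t, z * (x * t) = x * (z * t) := by intro t; rw [← mul_assoc, hzx, mul_assoc]
  have e3 : ∀ t, z * (y * t) = y * (z * t) := by intro t; rw [← mul_assoc, hzy, mul_assoc]
  have f1 : ∀ t, x * (x * t) = 0 := by intro t; rw [← mul_assoc, hx, zero_mul]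
  have f2 : ∀ t, y * (y * t) = 0 := by intro t; rw [← mul_assoc, hy, zero_mul]
  simp only [mul_add, add_mul, hyx, hzx, hzy, e1, e2, e3, f1, f2, hx, hy, hz, mul_zero]
  abel

theorem pair_sq_zero {R : Type*} [Ring R] [Algebra ℂ R] {w : Fin 6 → R}
    (hw : ∀ i j, w i * w j = -(w j * w i)) (i j : Fin 6) : w i * w j * (w i * w j) = 0 := by
  have h0 : w i * w i = 0 := by
    have h2 : (2 : ℂ) • (w i * w i) = 0 := by
      rw [two_smul]; nth_rewrite 1 [hw i i]; simp
    simpa using h2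
  rw [hw i j, neg_mul, mul_assoc, mul_neg, ← mul_assoc (w i), hw i j]
  rw [neg_mul, mul_assoc, h0]
  simp

theorem pair_comm {R : Type*} [Ring R] {w : Fin 6 → R}
    (hw : ∀ i j, w i * w j = -(w j * w i)) (i j k l : Fin 6) :
    w i * w j * (w k * w l) = w k * w l * (w i * w j) := by
  rw [mul_assoc, ← mul_assoc (w j), hw j k, neg_mul, mul_neg, mul_assoc (w k), hw j l,
    mul_neg, mul_neg, neg_neg, ← mul_assoc, hw i k, neg_mul, mul_assoc, ← mul_assoc (w i),
    hw i l, neg_mul, mul_neg, neg_neg]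
  simp only [mul_assoc]

theorem stdOmega_eq (v : Fin 2 → Model) : stdOmega v = lefschetz (scalar 1) 2 v := by
  rw [stdOmega_apply, lefschetz, LinearMap.sum_apply, Finset.sum_apply,
    ContinuousAlternatingMap.sum_apply]
  refine Finset.sum_congr rfl fun k _ => ?_
  have := wedgeOne_wedgeOne_apply (coord (reIdx k)) (coord (imIdx k)) (scalar 1) 0 v
  refine Eq.trans ?_ this.symm
  simp [Fin.sum_univ_two, scalar, Fin.removeNth]
  ring

theorem wedge_stdOmega_eq {β : Fiber} {l : ℕ} {φ : Model [⋀^Fin l]→L[ℝ] ℂ} (h : β l = φ) :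
    wedge stdOmega φ = lefschetz β (2 + l) := by
  subst h
  have hc : ∀ n (e : n = l + 2) (v : Fin n → Model),
      lefschetz β n v = lefschetz β (l + 2) (v ∘ Fin.cast e.symm) := by
    intro n e v; subst e; rfl
  ext v
  rw [hc _ (Nat.add_comm 2 l), ← wedge_stdOmega]
  rfl

theorem stdVol_eq : stdVol = (cre (reIdx 0) * cre (imIdx 0) * (cre (reIdx 1) * cre (imIdx 1) *
    (cre (reIdx 2) * cre (imIdx 2)))) (scalar 1) 6 := by
  have h2 : stdOmega = lefschetz (scalar 1) 2 := by ext v; exact stdOmega_eq v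
  have h4 : wedge stdOmega stdOmega = lefschetz (lefschetz (scalar 1)) (2 + 2) :=
    wedge_stdOmega_eq h2.symm
  have h6 : wedge stdOmega (wedge stdOmega stdOmega) =
      lefschetz (lefschetz (lefschetz (scalar 1))) (2 + (2 + 2)) :=
    wedge_stdOmega_eq h4.symm
  have hc := cube_of_sq_zero (cre (reIdx 0) * cre (imIdx 0)) (cre (reIdx 1) * cre (imIdx 1))
    (cre (reIdx 2) * cre (imIdx 2)) (pair_sq_zero realCAR.ww _ _)
    (pair_sq_zero realCAR.ww _ _) (pair_sq_zero realCAR.ww _ _) (pair_comm realCAR.ww _ _ _ _)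
    (pair_comm realCAR.ww _ _ _ _) (pair_comm realCAR.ww _ _ _ _)
  have hl : lefschetz = cre (reIdx 0) * cre (imIdx 0) + cre (reIdx 1) * cre (imIdx 1) +
    cre (reIdx 2) * cre (imIdx 2) := by rw [lefschetz, Fin.sum_univ_three]; rfl
  rw [← hl] at hc
  have h7 := congrArg (fun T : Module.End ℂ Fiber => T (scalar 1) 6) hc
  refine (congrArg (fun t : Model [⋀^Fin 6]→L[ℝ] ℂ => (6 : ℂ)⁻¹ • t) h6).trans ?_
  refine (congrArg (fun t : Model [⋀^Fin 6]→L[ℝ] ℂ => (6 : ℂ)⁻¹ • t) h7).trans ?_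
  rw [← Nat.cast_smul_eq_nsmul ℂ]
  refine (smul_smul _ _ _).trans ?_
  norm_num

theorem contract_zero_left {n : ℕ} (h : 0 + n = n) (ε : Model [⋀^Fin n]→L[ℝ] ℂ)
    (w : Fin 0 → Model) (v : Fin n → Model) : contract h ε w v = ε v := by
  change ε _ = ε v
  congr 1
  funext a
  rw [Fin.append_left_nil w v rfl]
  rfl

theorem stdStar_one_six : stdStar (scalar 1) 6 = stdVol := by
  rw [stdStar, starFiber_apply _ _ _ _ (zero_add 6)]
  ext v
  rw [hodgeStar_apply_of_gram_eq_one gram_stdG_stdVec]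
  simp only [contract_zero_left, scalar, Finset.univ_unique, Finset.sum_singleton]
  simp

theorem cre_six_degree (f : Fin 6 → Fin 6) {m : ℕ} (hm : m ≠ 6) :
    (cre (f 0) * cre (f 1) * (cre (f 2) * cre (f 3) * (cre (f 4) * cre (f 5)))) (scalar 1) m =
      0 := by
  by_cases h : m ≤ 6
  · have h' : ∀ i k (η : Fiber), η k = 0 → cre i η (k + 1) = 0 := by
      intro i k η h
      rw [cre, wedgeOne_succ, h]
      ext v
      simp [alternatizeUncurryFin_apply]
    have h0 : ∀ i (η : Fiber), cre i η 0 = 0 := fun _ _ => rfl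
    simp only [Module.End.mul_apply]
    rcases m with _ | _ | _ | _ | _ | _ | m
    · exact h0 _ _
    · exact h' _ _ _ (h0 _ _)
    · exact h' _ _ _ (h' _ _ _ (h0 _ _))
    · exact h' _ _ _ (h' _ _ _ (h' _ _ _ (h0 _ _)))
    · exact h' _ _ _ (h' _ _ _ (h' _ _ _ (h' _ _ _ (h0 _ _))))
    · exact h' _ _ _ (h' _ _ _ (h' _ _ _ (h' _ _ _ (h' _ _ _ (h0 _ _)))))
    · omega
  · exact form_eq_zero_of_six_lt (by omega) _

theorem stdStar_one : stdStar (scalar 1) = (cre (reIdx 0) * cre (imIdx 0) *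
    (cre (reIdx 1) * cre (imIdx 1) * (cre (reIdx 2) * cre (imIdx 2)))) (scalar 1) := by
  funext m
  by_cases hm : m = 6
  · subst hm
    rw [stdStar_one_six, stdVol_eq]
  · rw [stdStar_scalar _ _ hm]
    exact (cre_six_degree ![reIdx 0, imIdx 0, reIdx 1, imIdx 1, reIdx 2, imIdx 2] hm).symm

theorem stdStar_stdStar_one : stdStar (stdStar (scalar 1)) = scalar 1 := by
  have e : stdStar (stdStar (scalar 1)) = stdStar ((cre (reIdx 0) * cre (imIdx 0) *
    (cre (reIdx 1) * cre (imIdx 1) * (cre (reIdx 2) * cre (imIdx 2)))) (scalar 1)) := by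
    rw [← stdStar_one]
  rw [e]
  simp only [Module.End.mul_apply, stdStar_cre, parity_cre, parity_scalar, map_neg, neg_neg,
    stdStar_one]
  have h0 : ∀ i, ann i (scalar 1) = 0 := fun i => interior_scalar _ _
  have hne : ∀ k l, imIdx k ≠ reIdx l := fun k l => (reIdx_ne_imIdx l k).symm
  simp only [ann_cre, h0, reIdx_inj, imIdx_inj, reIdx_ne_imIdx, hne, if_true, if_false,
    Fin.reduceEq, _root_.map_zero, sub_zero, zero_sub, _root_.map_neg, neg_neg]

/-- Since the star operator is conjugate-linear and the dimension is even, `⋆⋆ = (-1)^k` on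
`k`-forms. Both sides exchange creation with annihilation operators in the same way, so that it
suffices to evaluate them on the constant `1`. -/
theorem stdStar_stdStar (η : Fiber) : stdStar (stdStar η) = parity η := by
  induction η using fiber_induction with
  | h0 c =>
    have : scalar c = c • scalar 1 := by rw [smul_scalar, mul_one]
    rw [parity_scalar, this, map_smulₛₗ, map_smulₛₗ, stdStar_stdStar_one, Complex.conj_conj]
  | hadd η ξ h1 h2 => rw [map_add, map_add, h1, h2, map_add]
  | hw i η h =>
    rw [stdStar_cre, stdStar_ann, ← stdStar_parity, parity_parity, h, parity_cre]

/-- Conjugation `X ↦ ⋆X⋆` by the star operator. -/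
def starConj (X : Module.End ℂ Fiber) : Module.End ℂ Fiber where
  toFun η := stdStar (X (stdStar η))
  map_add' η ξ := by simp
  map_smul' c η := by simp [map_smulₛₗ]

@[simp] theorem starConj_apply (X : Module.End ℂ Fiber) (η : Fiber) :
    starConj X η = stdStar (X (stdStar η)) := rfl

theorem starConj_cre (i : Fin 6) : starConj (cre i) = ann i := by
  refine LinearMap.ext fun η => ?_
  rw [starConj_apply, stdStar_cre, ← stdStar_parity, stdStar_stdStar, parity_parity]

theorem starConj_ann (i : Fin 6) : starConj (ann i) = -cre i := by
  refine LinearMap.ext fun η => ?_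
  rw [starConj_apply, stdStar_ann, ← stdStar_parity, stdStar_stdStar, parity_parity]
  rfl

theorem starConj_add (X Y : Module.End ℂ Fiber) : starConj (X + Y) = starConj X + starConj Y :=
  LinearMap.ext fun η => by simp

theorem starConj_smul (c : ℂ) (X : Module.End ℂ Fiber) :
    starConj (c • X) = starRingEnd ℂ c • starConj X :=
  LinearMap.ext fun η => by simp [map_smulₛₗ]

theorem starConj_sub (X Y : Module.End ℂ Fiber) : starConj (X - Y) = starConj X - starConj Y :=
  LinearMap.ext fun η => by simp

theorem starConj_stdStar : StarConj parity (creA cre) (creB cre) (annA ann)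
    (annB ann) starConj where
  add := starConj_add
  smul := starConj_smul
  mul X Y := by
    refine LinearMap.ext fun η => ?_
    simp only [Module.End.mul_apply, starConj_apply]
    rw [← stdStar_parity, stdStar_stdStar, parity_parity]
  PP := parity_mul_parity
  Pα i := by
    refine LinearMap.ext fun η => ?_
    simp [annA, parity_ann]
    module
  Pβ i := by
    refine LinearMap.ext fun η => ?_
    simp [annB, parity_ann]
    module
  star_a i := by
    rw [creA, starConj_add, starConj_smul, starConj_cre, starConj_cre, annA, Complex.conj_I]
    module
  star_b i := by
    rw [creB, starConj_sub, starConj_smul, starConj_cre, starConj_cre, annB, Complex.conj_I]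
    module
  star_α i := by
    rw [creA, annA, starConj_smul, starConj_sub, starConj_smul, starConj_ann, starConj_ann,
      Complex.conj_I, map_inv₀, map_ofNat]
    module
  star_β i := by
    rw [creB, annB, starConj_smul, starConj_add, starConj_smul, starConj_ann, starConj_ann,
      Complex.conj_I, map_inv₀, map_ofNat]
    module

/-! ### Rotations and the type decomposition -/

/-- Uniqueness of the coefficients of a Laurent polynomial that vanishes on the unit circle. -/
theorem laurent_coeff_eq_zero {ι : Type*} (s : Finset ι) (n : ι → ℤ) (c : ι → ℂ)
    (h : ∀ ζ : Circle, ∑ i ∈ s, (ζ : ℂ) ^ n i * c i = 0) (m : ℤ) :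
    ∑ i ∈ s with n i = m, c i = 0 := by
  let χ : ℤ → (Circle →* ℂ) := fun w => Circle.coeHom.comp (zpowGroupHom w)
  have χa : ∀ w (ζ : Circle), χ w ζ = (ζ : ℂ) ^ w := by
    intro w ζ
    simp only [χ, MonoidHom.comp_apply, zpowGroupHom_apply]
    exact Circle.coe_zpow ζ w
  have hχ : Function.Injective χ := by
    intro w w' hw
    by_contra hne
    have hd : ((w - w' : ℤ) : ℝ) ≠ 0 := by exact_mod_cast sub_ne_zero.mpr hne
    have h1 := DFunLike.congr_fun hw (Circle.exp (Real.pi / (w - w' : ℤ)))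
    rw [χa, χa, ← div_eq_one_iff_eq (zpow_ne_zero _ (Circle.coe_ne_zero _)),
      ← zpow_sub₀ (Circle.coe_ne_zero _), Circle.coe_exp, ← Complex.exp_int_mul] at h1
    have h2 : ((w - w' : ℤ) : ℂ) * (((Real.pi / (w - w' : ℤ) : ℝ) : ℂ) * Complex.I) =
        Real.pi * Complex.I := by
      have : ((w - w' : ℤ) : ℂ) ≠ 0 := by exact_mod_cast sub_ne_zero.mpr hne
      push_cast at this ⊢
      field_simp
    rw [h2, Complex.exp_pi_mul_I] at h1
    norm_num at h1
  have li := (linearIndependent_monoidHom Circle ℂ).comp χ hχ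
  rw [linearIndependent_iff'] at li
  have key := li (s.image n) (fun w => ∑ i ∈ s with n i = w, c i) (by
    funext ζ
    rw [Finset.sum_apply]
    refine Eq.trans ?_ (h ζ)
    rw [← Finset.sum_fiberwise_of_maps_to (t := s.image n) (g := n)
      (fun i hi => Finset.mem_image_of_mem n hi)]
    refine Finset.sum_congr rfl fun w _ => ?_
    simp only [Pi.smul_apply, Function.comp_apply, χa, smul_eq_mul, Finset.sum_mul]
    refine Finset.sum_congr rfl fun i hi => ?_
    rw [(Finset.mem_filter.mp hi).2, mul_comm])
  by_cases hm : m ∈ s.image n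
  · exact key m hm
  · refine Finset.sum_eq_zero fun i hi => ?_
    rw [Finset.mem_filter] at hi
    exact absurd (hi.2 ▸ Finset.mem_image_of_mem n hi.1) hm

section General

variable {V : Type*} [AddCommGroup V] [Module ℝ V] [TopologicalSpace V]

theorem typeProj_apply (J : V →L[ℝ] V) (p q : ℤ) {k : ℕ} (η : V [⋀^Fin k]→L[ℝ] ℂ)
    (v : Fin k → V) : typeProj J p q η v =
      ∑ S : Finset (Fin k) with (S.card : ℤ) = p ∧ (Sᶜ.card : ℤ) = q, slotInsert J η S v := by
  change (∑ S : Finset (Fin k) with _, slotInsert J η S : ContinuousMultilinearMap ℝ _ ℂ) v = _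
  rw [_root_.sum_apply]

theorem typeProj_comp {W : Type*} [AddCommGroup W] [Module ℝ W] [TopologicalSpace W]
    (J : V →L[ℝ] V) (J' : W →L[ℝ] W) (A : V →L[ℝ] W) (hA : ∀ v, A (J v) = J' (A v)) (p q : ℤ)
    {k : ℕ} (η : W [⋀^Fin k]→L[ℝ] ℂ) :
    (typeProj J' p q η).compContinuousLinearMap A =
      typeProj J p q (η.compContinuousLinearMap A) := by
  ext v
  rw [ContinuousAlternatingMap.compContinuousLinearMap_apply, typeProj_apply, typeProj_apply]
  refine Finset.sum_congr rfl fun S _ => ?_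
  rw [slotInsert_apply, slotInsert_apply]
  refine Finset.sum_congr rfl fun T _ => ?_
  rw [ContinuousAlternatingMap.compContinuousLinearMap_apply]
  congr 2
  funext i
  simp only [Function.comp_apply]
  split_ifs
  · exact (hA _).symm
  · rfl

theorem typeProj_of_add_ne (J : V →L[ℝ] V) (p q : ℤ) {k : ℕ} (η : V [⋀^Fin k]→L[ℝ] ℂ)
    (h : ¬ (0 ≤ p ∧ 0 ≤ q)) : typeProj J p q η = 0 := by
  ext v
  rw [typeProj_apply, Finset.sum_eq_zero]
  · rfl
  · intro S hS
    rw [Finset.mem_filter] at hS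
    exact absurd ⟨by omega, by omega⟩ h

/-- The expansion of the pullback by `x + yJ` into forms of pure type. -/
theorem sum_typeProj (J : V →L[ℝ] V) (x y : ℝ) {k : ℕ} (η : V [⋀^Fin k]→L[ℝ] ℂ)
    (v : Fin k → V) : η (fun i => x • v i + y • J (v i)) =
      ∑ p ∈ Finset.range (k + 1), (x + y * Complex.I) ^ p * (x - y * Complex.I) ^ (k - p) *
        typeProj J p ((k : ℤ) - p) η v := by
  have h1 : η (fun i => x • v i + y • J (v i)) =
      ∑ T : Finset (Fin k), (∏ i, (if i ∈ T then (y : ℂ) else x)) *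
        η (fun i => if i ∈ T then J (v i) else v i) := by
    have := η.toAlternatingMap.toMultilinearMap.map_add_univ (fun i => y • J (v i))
      (fun i => x • v i)
    refine Eq.trans (congrArg η (funext fun i => add_comm _ _)) (this.trans ?_)
    refine Finset.sum_congr rfl fun T _ => ?_
    have h2 := η.toAlternatingMap.toMultilinearMap.map_smul_univ
      (fun i => if i ∈ T then y else x) (fun i => if i ∈ T then J (v i) else v i)
    refine Eq.trans ?_ (h2.trans ?_)
    · refine congrArg η (funext fun i => ?_)
      by_cases hi : i ∈ T <;> simp [Finset.piecewise, hi]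
    · rw [Complex.real_smul, Complex.ofReal_prod]
      congr 1
      refine Finset.prod_congr rfl fun i _ => ?_
      split_ifs <;> rfl
  have h3 : ∀ T : Finset (Fin k), (∏ i, (if i ∈ T then (y : ℂ) else x)) =
      ∑ S : Finset (Fin k), (x + y * Complex.I) ^ S.card * (x - y * Complex.I) ^ Sᶜ.card *
        ∏ i, (if i ∈ T then (if i ∈ S then -Complex.I / 2 else Complex.I / 2) else 1 / 2 : ℂ) := by
    intro T
    have h4 : ∀ i, (if i ∈ T then (y : ℂ) else x) =
        (x + y * Complex.I) * (if i ∈ T then -Complex.I / 2 else 1 / 2) +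
        (x - y * Complex.I) * (if i ∈ T then Complex.I / 2 else 1 / 2) := by
      intro i
      split_ifs
      · linear_combination (y : ℂ) * Complex.I_mul_I
      · ring
    rw [Finset.prod_congr rfl fun i _ => h4 i, Finset.prod_add, Finset.powerset_univ]
    refine Finset.sum_congr rfl fun S _ => ?_
    rw [← Finset.compl_eq_univ_sdiff, Finset.prod_mul_distrib, Finset.prod_mul_distrib,
      Finset.prod_const, Finset.prod_const,
      ← Finset.prod_mul_prod_compl S (fun i => (if i ∈ T then (if i ∈ S then -Complex.I / 2 else
        Complex.I / 2) else 1 / 2 : ℂ))]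
    have e1 : ∏ i ∈ S, (if i ∈ T then (if i ∈ S then -Complex.I / 2 else Complex.I / 2)
        else 1 / 2 : ℂ) = ∏ i ∈ S, (if i ∈ T then -Complex.I / 2 else 1 / 2 : ℂ) :=
      Finset.prod_congr rfl fun i hi => by simp [hi]
    have e2 : ∏ i ∈ Sᶜ, (if i ∈ T then (if i ∈ S then -Complex.I / 2 else Complex.I / 2)
        else 1 / 2 : ℂ) = ∏ i ∈ Sᶜ, (if i ∈ T then Complex.I / 2 else 1 / 2 : ℂ) :=
      Finset.prod_congr rfl fun i hi => by simp [Finset.mem_compl.mp hi]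
    rw [e1, e2]
    ring
  have h5 : η (fun i => x • v i + y • J (v i)) = ∑ S : Finset (Fin k),
      (x + y * Complex.I) ^ S.card * (x - y * Complex.I) ^ Sᶜ.card * slotInsert J η S v := by
    rw [h1]
    simp only [h3, Finset.sum_mul, slotInsert_apply, Finset.mul_sum]
    rw [Finset.sum_comm]
    refine Finset.sum_congr rfl fun S _ => Finset.sum_congr rfl fun T _ => ?_
    ring
  rw [h5, ← Finset.sum_fiberwise_of_maps_to (t := Finset.range (k + 1)) (g := Finset.card)
    (fun S _ => Finset.mem_range.mpr (Nat.lt_succ_of_le (by simpa using S.card_le_univ)))]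
  refine Finset.sum_congr rfl fun p hp => ?_
  rw [typeProj_apply, Finset.mul_sum]
  have hp' : p ≤ k := Nat.lt_succ_iff.mp (Finset.mem_range.mp hp)
  have hS : ∀ S : Finset (Fin k), S.card = p → Sᶜ.card = k - p := by
    intro S hS
    rw [Finset.card_compl, hS, Fintype.card_fin]
  refine Finset.sum_congr ?_ fun S hS' => ?_
  · ext S
    simp only [Finset.mem_filter, Finset.mem_univ, true_and, Nat.cast_inj]
    constructor
    · intro h
      refine ⟨h, ?_⟩
      rw [hS S h]
      omega
    · exact fun h => h.1
  · have h6 : S.card = p := by exact_mod_cast (Finset.mem_filter.mp hS').2.1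
    have h7 : Sᶜ.card = k - p := hS S h6
    rw [h6, h7]

end General

/-- The pullback of forms by a linear map. -/
def pull (A : Model →L[ℝ] Model) : Module.End ℂ Fiber where
  toFun η k := (η k).compContinuousLinearMap A
  map_add' η ξ := by funext k; ext v; simp
  map_smul' c η := by funext k; ext v; simp

@[simp] theorem pull_apply (A : Model →L[ℝ] Model) (η : Fiber) (k : ℕ) (v : Fin k → Model) :
    pull A η k v = η k (fun i => A (v i)) := rfl

theorem pull_mul_wedgeOne (A : Model →L[ℝ] Model) (θ : Model →L[ℝ] ℂ) :
    pull A * wedgeOne θ = wedgeOne (θ.comp A) * pull A := by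
  ext η k v
  cases k with
  | zero => simp
  | succ k => simp [wedgeOne_apply]; rfl

theorem interior_mul_pull (A : Model →L[ℝ] Model) (u : Model) :
    interior u * pull A = pull A * interior (A u) := by
  ext η k v
  simp only [Module.End.mul_apply, interior_apply, pull_apply]
  congr 1
  funext i
  refine Fin.cases ?_ (fun i => ?_) i <;> simp

/-- The linear map `z ↦ ζ z` of `ℝ⁶ = ℂ³`. -/
def rotMap (ζ : ℂ) : Model →L[ℝ] Model := ζ.re • ContinuousLinearMap.id ℝ Model + ζ.im • stdJ

theorem rotMap_apply (ζ : ℂ) (v : Model) : rotMap ζ v = ζ.re • v + ζ.im • stdJ v := rfl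

/-- The pullback by `z ↦ ζ z`, for `ζ` in the unit circle. It acts on `(p,q)`-forms as
`ζ ^ (p - q)`. -/
def rot (ζ : Circle) : Module.End ℂ Fiber := pull (rotMap ζ)

theorem rot_apply (ζ : Circle) (η : Fiber) (k : ℕ) (v : Fin k → Model) : rot ζ η k v =
    ∑ p ∈ Finset.range (k + 1), (ζ : ℂ) ^ (2 * (p : ℤ) - k) *
      typeProj stdJ p ((k : ℤ) - p) (η k) v := by
  have := sum_typeProj stdJ (ζ : ℂ).re (ζ : ℂ).im (η k) v
  refine Eq.trans this (Finset.sum_congr rfl fun p hp => ?_)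
  have hp' : p ≤ k := Nat.lt_succ_iff.mp (Finset.mem_range.mp hp)
  rw [Complex.re_add_im]
  have h2 : ((ζ : ℂ).re : ℂ) - (ζ : ℂ).im * Complex.I = (ζ : ℂ)⁻¹ := by
    rw [← Circle.coe_inv, Circle.coe_inv_eq_conj]
    apply Complex.ext <;> simp
  rw [h2, inv_pow, ← zpow_natCast, ← zpow_natCast, ← zpow_neg,
    ← zpow_add₀ (Circle.coe_ne_zero ζ)]
  congr 2
  omega

/-- A form on which the rotation by `ζ` acts as `ζ ^ w`. -/
def HasWeight (w : ℤ) (η : Fiber) : Prop := ∀ ζ : Circle, rot ζ η = ((ζ : ℂ) ^ w) • η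

theorem typeProj_of_hasWeight {w : ℤ} {η : Fiber} (h : HasWeight w η) {k : ℕ} {p q : ℤ}
    (hpq : p + q = k) : typeProj stdJ p q (η k) = if w = p - q then η k else 0 := by
  ext v
  have key0 := laurent_coeff_eq_zero (Finset.univ : Finset (Option (Fin (k + 1))))
    (fun o => o.elim w fun p => 2 * (p : ℤ) - k)
    (fun o => o.elim (-(η k v)) fun p => typeProj stdJ p ((k : ℤ) - p) (η k) v) (by
      intro ζ
      rw [Fintype.sum_option]
      have := congrArg (fun t : Fiber => t k v) (h ζ)
      simp only [rot_apply] at this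
      simp only [Option.elim]
      rw [Fin.sum_univ_eq_sum_range (fun p => (ζ : ℂ) ^ (2 * (p : ℤ) - k) *
        typeProj stdJ p ((k : ℤ) - p) (η k) v), this]
      simp) (p - q)
  rw [Finset.sum_filter, Fintype.sum_option] at key0
  have key : (if w = p - q then -(η k v) else 0) + ∑ i : Fin (k + 1),
      (if 2 * (i : ℤ) - k = p - q then typeProj stdJ i ((k : ℤ) - i) (η k) v else 0) = 0 := key0
  by_cases hp : 0 ≤ p ∧ 0 ≤ q
  · obtain ⟨n, rfl⟩ : ∃ n : ℕ, p = n := ⟨p.toNat, by omega⟩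
    obtain rfl : q = (k : ℤ) - n := by omega
    rw [Finset.sum_eq_single (⟨n, by omega⟩ : Fin (k + 1))] at key
    · have hn : 2 * (n : ℤ) - k = n - (k - n) := by ring
      rw [if_pos hn] at key
      split_ifs at key ⊢
      · linear_combination key
      · simpa using key
    · intro b _ hb
      rw [if_neg]
      intro h
      exact hb (Fin.ext (by simp only; omega))
    · simp
  · rw [typeProj_of_add_ne _ _ _ _ hp]
    rw [Finset.sum_eq_zero (s := Finset.univ)] at key
    · split_ifs at key ⊢
      · exact Eq.symm (by simpa using key)
      · rfl
    · intro b _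
      rw [if_neg]
      have := b.2
      omega

theorem rotMap_mul (ζ ξ : ℂ) (v : Model) : rotMap ζ (rotMap ξ v) = rotMap (ζ * ξ) v := by
  simp only [rotMap_apply, _root_.map_add, _root_.map_smul, stdJ_stdJ, Complex.mul_re,
    Complex.mul_im]
  module

theorem rot_rot (ζ ξ : Circle) (η : Fiber) : rot ζ (rot ξ η) = rot (ξ * ζ) η := by
  funext k
  ext v
  simp only [rot, pull_apply, rotMap_mul, Circle.coe_mul]

/-- The projection of a form of degree `k` to type `(p, k - p)` has weight `2p - k`. -/
theorem hasWeight_typeProj {k : ℕ} (p : ℕ) (hp : p ≤ k) (η : Model [⋀^Fin k]→L[ℝ] ℂ) :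
    HasWeight (2 * (p : ℤ) - k) (Pi.single k (typeProj stdJ p ((k : ℤ) - p) η)) := by
  intro ζ
  funext m
  by_cases hm : m = k
  · subst hm
    ext v
    have hA : ∀ v, rotMap (ζ : ℂ) (stdJ v) = stdJ (rotMap (ζ : ℂ) v) := by
      intro v; simp [rotMap_apply]
    have key := laurent_coeff_eq_zero (Finset.univ : Finset (Fin (m + 1)))
      (fun p => 2 * (p : ℤ) - m)
      (fun p => typeProj stdJ p ((m : ℤ) - p) η (fun i => rotMap (ζ : ℂ) (v i)) -
        (ζ : ℂ) ^ (2 * (p : ℤ) - m) * typeProj stdJ p ((m : ℤ) - p) η v) (by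
        intro ξ
        have h1 := rot_apply ξ (Pi.single m η) m (fun i => rotMap (ζ : ℂ) (v i))
        have h2 := rot_apply (ξ * ζ) (Pi.single m η) m v
        have h3 : rot ξ (Pi.single m η) m (fun i => rotMap (ζ : ℂ) (v i)) =
            rot (ξ * ζ) (Pi.single m η) m v := by
          rw [← rot_rot ζ ξ]; rfl
        rw [h1, h2] at h3
        simp only [Pi.single_eq_same] at h3
        simp only [mul_sub, Finset.sum_sub_distrib]
        rw [Fin.sum_univ_eq_sum_range (fun p => (ξ : ℂ) ^ (2 * (p : ℤ) - m) *
          typeProj stdJ p ((m : ℤ) - p) η (fun i => rotMap (ζ : ℂ) (v i))), h3,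
          Fin.sum_univ_eq_sum_range (fun p => (ξ : ℂ) ^ (2 * (p : ℤ) - m) *
            ((ζ : ℂ) ^ (2 * (p : ℤ) - m) * typeProj stdJ p ((m : ℤ) - p) η v)),
          ← Finset.sum_sub_distrib]
        refine Finset.sum_eq_zero fun p _ => ?_
        rw [Circle.coe_mul, mul_zpow]
        ring) (2 * (p : ℤ) - m)
    rw [Finset.sum_filter, Finset.sum_eq_single (⟨p, by omega⟩ : Fin (m + 1)),
      if_pos rfl, sub_eq_zero] at key
    · simpa [rot] using key
    · intro b _ hb
      rw [if_neg]
      intro h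
      exact hb (Fin.ext (by simp at h; omega))
    · simp
  · ext v
    simp [rot, hm]

theorem sum_typeProj_eq {k : ℕ} (η : Model [⋀^Fin k]→L[ℝ] ℂ) :
    ∑ p ∈ Finset.range (k + 1), typeProj stdJ p ((k : ℤ) - p) η = η := by
  ext v
  have := rot_apply 1 (Pi.single k η) k v
  simpa [rot, rotMap_apply] using this.symm

theorem rot_mul_wedgeOne {w : ℤ} {θ : Model →L[ℝ] ℂ}
    (h : ∀ (ζ : Circle) v, θ (rotMap ζ v) = (ζ : ℂ) ^ w * θ v) (ζ : Circle) :
    rot ζ * wedgeOne θ = ((ζ : ℂ) ^ w) • (wedgeOne θ * rot ζ) := by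
  rw [rot, pull_mul_wedgeOne, ← smul_mul_assoc, ← wedgeOne_smul]
  congr 2
  ext v
  simp [h ζ v]

/-! ### Smooth families of forms on open subsets of `ℝ⁶` -/

/-- The coefficients of a form in the standard basis. -/
def formCoeff (k : ℕ) : (Model [⋀^Fin k]→L[ℝ] ℂ) →ₗ[ℝ] ((Fin k → Fin 6) → ℂ) where
  toFun η i := η (fun a => stdVec (i a))
  map_add' _ _ := rfl
  map_smul' _ _ := rfl

theorem formCoeff_injective (k : ℕ) : Function.Injective (formCoeff k) := by
  intro η ξ h
  have : η.toAlternatingMap = ξ.toAlternatingMap := by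
    refine Module.Basis.ext_alternating (EuclideanSpace.basisFun (Fin 6) ℝ).toBasis ?_
    intro v _
    have := congrFun h v
    simpa [formCoeff, stdVec] using this
  exact ContinuousAlternatingMap.toAlternatingMap_injective this

instance finiteDimensional_form (k : ℕ) : FiniteDimensional ℝ (Model [⋀^Fin k]→L[ℝ] ℂ) :=
  FiniteDimensional.of_injective (formCoeff k) (formCoeff_injective k)

/-- A family of forms is smooth if its values on constant vectors are. -/
theorem contDiffOn_form {k : ℕ} {f : Model → Model [⋀^Fin k]→L[ℝ] ℂ} {W : Set Model}
    (h : ∀ v, ContDiffOn ℝ ∞ (fun y => f y v) W) : ContDiffOn ℝ ∞ f W := by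
  obtain ⟨L, hL⟩ := (formCoeff k).exists_leftInverse_of_injective
    (LinearMap.ker_eq_bot.mpr (formCoeff_injective k))
  have : f = fun y => LinearMap.toContinuousLinearMap L (formCoeff k (f y)) := by
    funext y
    exact (LinearMap.congr_fun hL (f y)).symm
  rw [this]
  refine (LinearMap.toContinuousLinearMap L).contDiff.comp_contDiffOn ?_
  exact contDiffOn_pi.mpr fun i => h _

theorem contDiffOn_form_apply {k : ℕ} {f : Model → Model [⋀^Fin k]→L[ℝ] ℂ} {W : Set Model}
    (hf : ContDiffOn ℝ ∞ f W) {v : Model → Fin k → Model}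
    (hv : ∀ i, ContDiffOn ℝ ∞ (fun y => v y i) W) :
    ContDiffOn ℝ ∞ (fun y => f y (v y)) W := by
  have h1 : ∀ y, f y (v y) = ∑ i : Fin k → Fin 6, (∏ a, v y a (i a)) •
      f y (fun a => stdVec (i a)) := by
    intro y
    have : v y = fun a => ∑ j, v y a j • stdVec j := by
      funext a; rw [sum_coord_smul_stdVec]
    conv_lhs => rw [this]
    rw [ContinuousAlternatingMap.map_sum]
    refine Finset.sum_congr rfl fun i _ => ?_
    exact (f y).toAlternatingMap.toMultilinearMap.map_smul_univ _ _
  rw [show (fun y => f y (v y)) = _ from funext h1]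
  refine ContDiffOn.sum fun i _ => ContDiffOn.fun_smul ?_ ?_
  · refine contDiffOn_prod fun a _ => ?_
    exact ((EuclideanSpace.proj (i a) : Model →L[ℝ] ℝ).contDiff).comp_contDiffOn (hv a)
  · have : (fun y => f y (fun a => stdVec (i a))) =
        fun y => (LinearMap.toContinuousLinearMap
          ((LinearMap.proj i).comp (formCoeff k)) : _ →L[ℝ] ℂ) (f y) := rfl
    rw [this]
    exact (ContinuousLinearMap.contDiff _).comp_contDiffOn hf

theorem contDiffOn_compContinuousLinearMap {k : ℕ} {f : Model → Model [⋀^Fin k]→L[ℝ] ℂ}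
    {A : Model → Model →L[ℝ] Model} {W : Set Model} (hf : ContDiffOn ℝ ∞ f W)
    (hA : ContDiffOn ℝ ∞ A W) :
    ContDiffOn ℝ ∞ (fun y => (f y).compContinuousLinearMap (A y)) W := by
  refine contDiffOn_form fun v => ?_
  exact contDiffOn_form_apply hf fun i => hA.clm_apply contDiffOn_const

/-- Smoothness of a family of forms of mixed degree. -/
def SmoothOn (f : Model → Fiber) (W : Set Model) : Prop :=
  ∀ k, ContDiffOn ℝ ∞ (fun y => f y k) W

/-- The directional derivative of a family of forms of mixed degree. -/
def dirDeriv (f : Model → Fiber) (y v : Model) : Fiber := fun k => fderiv ℝ (fun z => f z k) y v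

/-- As forms of degree greater than six vanish, every linear operator is determined by finitely
many continuous linear maps between spaces of forms of fixed degree. -/
theorem fiber_linear_apply (O : Fiber →ₗ[ℝ] Fiber) (ξ : Fiber) (k : ℕ) :
    O ξ k = ∑ j ∈ Finset.range 7, LinearMap.toContinuousLinearMap
      ((LinearMap.proj k).comp (O.comp (LinearMap.single ℝ _ j)) :
        (Model [⋀^Fin j]→L[ℝ] ℂ) →ₗ[ℝ] (Model [⋀^Fin k]→L[ℝ] ℂ)) (ξ j) := by
  have : ξ = ∑ j ∈ Finset.range 7, Pi.single j (ξ j) := by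
    funext m
    rw [Finset.sum_apply]
    by_cases hm : m < 7
    · rw [Finset.sum_eq_single m]
      · simp
      · intro k _ hk; simp [hk.symm]
      · simp [hm]
    · rw [form_eq_zero_of_six_lt (by omega) (ξ m)]
      exact (form_eq_zero_of_six_lt (by omega) _).symm
  conv_lhs => rw [this, _root_.map_sum, Finset.sum_apply]
  rfl

theorem SmoothOn.map {f : Model → Fiber} {W : Set Model} (hf : SmoothOn f W)
    (O : Fiber →ₗ[ℝ] Fiber) : SmoothOn (fun y => O (f y)) W := by
  intro k
  simp only [fiber_linear_apply O _ k]
  exact ContDiffOn.sum fun j _ => (ContinuousLinearMap.contDiff _).comp_contDiffOn (hf j)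

theorem SmoothOn.differentiableAt {f : Model → Fiber} {W : Set Model} (hf : SmoothOn f W)
    (hW : IsOpen W) {y : Model} (hy : y ∈ W) (k : ℕ) : DifferentiableAt ℝ (fun z => f z k) y :=
  ((hf k).contDiffAt (hW.mem_nhds hy)).differentiableAt (by simp)

theorem dirDeriv_map {f : Model → Fiber} {y : Model}
    (hf : ∀ k, DifferentiableAt ℝ (fun z => f z k) y) (O : Fiber →ₗ[ℝ] Fiber) (v : Model) :
    dirDeriv (fun z => O (f z)) y v = O (dirDeriv f y v) := by
  funext k
  let L : ∀ j, (Model [⋀^Fin j]→L[ℝ] ℂ) →L[ℝ] (Model [⋀^Fin k]→L[ℝ] ℂ) := fun j =>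
    LinearMap.toContinuousLinearMap ((LinearMap.proj k).comp (O.comp (LinearMap.single ℝ _ j)))
  have h1 : ∀ ξ, O ξ k = ∑ j ∈ Finset.range 7, L j (ξ j) := fun ξ => fiber_linear_apply O ξ k
  have h2 : HasFDerivAt (fun z => ∑ j ∈ Finset.range 7, L j (f z j))
      (∑ j ∈ Finset.range 7, (L j).comp (fderiv ℝ (fun z => f z j) y)) y :=
    HasFDerivAt.fun_sum fun j _ => (L j).hasFDerivAt.comp y (hf j).hasFDerivAt
  rw [h1]
  simp only [dirDeriv, h1]
  rw [h2.fderiv, _root_.sum_apply]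
  rfl

/-! ### The exterior derivative in a moving frame -/

/-- The action of an endomorphism as a derivation, `(Bη)(v₁,…,vₖ) = ∑ⱼ η(v₁,…,B vⱼ,…,vₖ)`. -/
def derivation (B : Model →L[ℝ] Model) : Module.End ℂ Fiber :=
  ∑ i, wedgeOne ((coord i).comp B) * interior (stdVec i)

theorem sum_coord_mul (η : Fiber) (k : ℕ) (u : Model) (w : Fin k → Model) :
    ∑ i, (u i : ℂ) * η (k + 1) (Matrix.vecCons (stdVec i) w) = η (k + 1) (Matrix.vecCons u w) := by
  conv_rhs => rw [← sum_coord_smul_stdVec u]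
  have := _root_.map_sum ((η (k + 1)).curryLeft) (fun i => u i • stdVec i) Finset.univ
  have := congrArg (fun t => t w) this
  refine Eq.trans ?_ this.symm
  simp

theorem derivation_apply (B : Model →L[ℝ] Model) (η : Fiber) (k : ℕ) (v : Fin k → Model) :
    derivation B η k v = ∑ p, η k (Function.update v p (B (v p))) := by
  cases k with
  | zero => simp [derivation, Finset.sum_apply]
  | succ k =>
    simp only [derivation, Finset.sum_apply, LinearMap.sum_apply,
      ContinuousAlternatingMap.sum_apply, Module.End.mul_apply, wedgeOne_apply, interior_apply,
      ContinuousLinearMap.comp_apply, coord_apply]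
    rw [Finset.sum_comm]
    simp only [← Finset.mul_sum, sum_coord_mul]
    refine Finset.sum_congr rfl fun p _ => ?_
    have := (η (k + 1)).neg_one_pow_smul_map_insertNth p (B (v p)) (p.removeNth v)
    rw [Fin.insertNth_removeNth] at this
    rw [this.symm]
    simp [← mul_assoc, ← mul_pow]

/-- The exterior derivative in a moving frame `P` with inverse `Q`: besides the derivatives of the
components, the derivative of the inverse frame contributes as an endomorphism acting by
derivations. -/
theorem extDeriv_frame {f : Model → Fiber} {P Q : Model → Model →L[ℝ] Model} {y : Model}
    (hf : ∀ k, DifferentiableAt ℝ (fun z => f z k) y) (hQ : DifferentiableAt ℝ Q y)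
    (hQP : ∀ v, Q y (P y v) = v) (k : ℕ) :
    (extDeriv (fun z => (f z k).compContinuousLinearMap (Q z)) y).compContinuousLinearMap (P y) =
      (∑ i, cre i (dirDeriv f y (P y (stdVec i)) +
        derivation ((fderiv ℝ Q y (P y (stdVec i))).comp (P y)) (f y))) (k + 1) := by
  have hd := (hf k).hasFDerivAt.continuousAlternatingMapCompContinuousLinearMap hQ.hasFDerivAt
  let T : Model →ₗ[ℝ] (Model [⋀^Fin k]→L[ℝ] ℂ) :=
    { toFun := fun v => (fderiv ℝ (fun z => (f z k).compContinuousLinearMap (Q z)) y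
        (P y v)).compContinuousLinearMap (P y)
      map_add' := by intro v w; ext u; simp
      map_smul' := by intro c v; ext u; simp }
  have hT : ∀ v, T v = (dirDeriv f y (P y v) +
      derivation ((fderiv ℝ Q y (P y v)).comp (P y)) (f y)) k := by
    intro v
    ext w
    simp only [T, LinearMap.coe_mk, AddHom.coe_mk, hd.fderiv, Pi.add_apply,
      ContinuousAlternatingMap.add_apply, derivation_apply,
      ContinuousAlternatingMap.compContinuousLinearMap_apply, _root_.add_apply,
      ContinuousLinearMap.comp_apply, compContinuousLinearMapCLM_apply,
      ContinuousAlternatingMap.fderivCompContinuousLinearMap_apply]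
    congr 1
    · simp only [dirDeriv]
      congr 1
      funext i
      simp [hQP]
    · refine Finset.sum_congr rfl fun p _ => ?_
      congr 1
      funext i
      by_cases hi : i = p
      · subst hi; simp
      · simp [hi, hQP]
  ext v
  have h1 : ∀ p : Fin (k + 1), T (v p) = ∑ i, v p i • T (stdVec i) := by
    intro p
    conv_lhs => rw [← sum_coord_smul_stdVec (v p), _root_.map_sum]
    simp
  rw [ContinuousAlternatingMap.compContinuousLinearMap_apply, extDeriv,
    alternatizeUncurryFin_apply, Finset.sum_apply, ContinuousAlternatingMap.sum_apply]
  have h2 : ∀ p : Fin (k + 1), (-1 : ℤ) ^ (p : ℕ) •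
      (fderiv ℝ (fun z => (f z k).compContinuousLinearMap (Q z)) y ((⇑(P y) ∘ v) p))
        (p.removeNth (⇑(P y) ∘ v)) = (-1 : ℂ) ^ (p : ℕ) * T (v p) (p.removeNth v) := by
    intro p
    simp [T]
    rfl
  refine (Finset.sum_congr rfl fun p _ => h2 p).trans ?_
  simp only [cre, wedgeOne_apply, ← hT, h1, coord_apply]
  rw [Finset.sum_comm]
  refine Finset.sum_congr rfl fun p _ => ?_
  rw [← Finset.mul_sum, ContinuousAlternatingMap.sum_apply]
  simp

/-! ### Charts -/

section Charts

variable {M : Type*} [TopologicalSpace M] [ChartedSpace Model M]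

/-- The derivative of the inverse of the preferred chart at `x₀`. -/
def chartInv (x₀ : M) (y : Model) : Model →L[ℝ] Model :=
  mfderiv 𝓘(ℝ, Model) (𝓡 6) (extChartAt (𝓡 6) x₀).symm y

/-- The derivative of the preferred chart at `x₀`. -/
def chartDer (x₀ z : M) : Model →L[ℝ] Model :=
  mfderiv (𝓡 6) 𝓘(ℝ, Model) (extChartAt (𝓡 6) x₀) z

variable [IsManifold (𝓡 6) ∞ M]

theorem chartDer_chartInv {x₀ : M} {y : Model} (hy : y ∈ (extChartAt (𝓡 6) x₀).target) (v : Model) :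
    chartDer x₀ ((extChartAt (𝓡 6) x₀).symm y) (chartInv x₀ y v) = v := by
  have : IsManifold (𝓡 6) 1 M := IsManifold.of_le (n := ∞) (by norm_cast)
  have := mfderiv_extChartAt_comp_mfderivWithin_extChartAt_symm hy
  rw [ModelWithCorners.range_eq_univ, mfderivWithin_univ] at this
  exact congrArg (fun T : Model →L[ℝ] Model => T v) this

theorem chartInv_chartDer {x₀ : M} {y : Model} (hy : y ∈ (extChartAt (𝓡 6) x₀).target) (v : Model) :
    chartInv x₀ y (chartDer x₀ ((extChartAt (𝓡 6) x₀).symm y) v) = v := by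
  have : IsManifold (𝓡 6) 1 M := IsManifold.of_le (n := ∞) (by norm_cast)
  have := mfderivWithin_extChartAt_symm_comp_mfderiv_extChartAt hy
  rw [ModelWithCorners.range_eq_univ, mfderivWithin_univ] at this
  exact congrArg (fun T : Model →L[ℝ] Model => T v) this

theorem contMDiffOn_chartInv {x₀ : M} {W : Set Model} (hW : W ⊆ (extChartAt (𝓡 6) x₀).target)
    {v : Model → Model} (hv : ContDiffOn ℝ ∞ v W) :
    ContMDiffOn 𝓘(ℝ, Model) ((𝓡 6).prod 𝓘(ℝ, Model)) ∞
      (fun y => Bundle.TotalSpace.mk' Model (E := fun x : M => TangentSpace (𝓡 6) x)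
        ((extChartAt (𝓡 6) x₀).symm y) (chartInv x₀ y (v y))) W := by
  have : IsManifold (𝓡 6) 1 M := IsManifold.of_le (n := ∞) (by norm_cast)
  have ho : IsOpen (extChartAt (𝓡 6) x₀).target := isOpen_extChartAt_target x₀
  have h1 := (contMDiffOn_extChartAt_symm (I := 𝓡 6) (n := ∞) x₀).contMDiffOn_tangentMapWithin
    (m := ∞) (by norm_cast) ho.uniqueMDiffOn
  have h2 : ContMDiffOn 𝓘(ℝ, Model) (𝓘(ℝ, Model).prod 𝓘(ℝ, Model)) ∞
      (fun y => Bundle.TotalSpace.mk' Model (E := fun x : Model => TangentSpace 𝓘(ℝ, Model) x) y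
        (v y)) W := contMDiffOn_vectorSpace_iff_contDiffOn.mpr hv
  refine (h1.comp h2 (fun y hy => hW hy)).congr fun y hy => ?_
  simp only [Function.comp_apply, tangentMapWithin]
  rw [mfderivWithin_of_isOpen ho (hW hy)]
  rfl

theorem contDiffOn_chartDer {x₀ : M} {W : Set Model} (hW : W ⊆ (extChartAt (𝓡 6) x₀).target)
    {v : Model → Model} (hv : ContMDiffOn 𝓘(ℝ, Model) ((𝓡 6).prod 𝓘(ℝ, Model)) ∞
      (fun y => Bundle.TotalSpace.mk' Model (E := fun x : M => TangentSpace (𝓡 6) x)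
        ((extChartAt (𝓡 6) x₀).symm y) (v y)) W) :
    ContDiffOn ℝ ∞ (fun y => chartDer x₀ ((extChartAt (𝓡 6) x₀).symm y) (v y)) W := by
  have : IsManifold (𝓡 6) 1 M := IsManifold.of_le (n := ∞) (by norm_cast)
  have ho : IsOpen (chartAt Model x₀).source := (chartAt Model x₀).open_source
  have h1 := (contMDiffOn_extChartAt (I := 𝓡 6) (n := ∞) (x := x₀)).contMDiffOn_tangentMapWithin
    (m := ∞) (by norm_cast) ho.uniqueMDiffOn
  have hs : ∀ y ∈ W, (extChartAt (𝓡 6) x₀).symm y ∈ (chartAt Model x₀).source := by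
    intro y hy
    have := (extChartAt (𝓡 6) x₀).map_target (hW hy)
    rwa [extChartAt_source] at this
  have h2 := (contMDiff_snd_tangentBundle_modelSpace Model 𝓘(ℝ, Model) (n := ∞)).comp_contMDiffOn
    (h1.comp hv (fun y hy => hs y hy))
  refine (contMDiffOn_iff_contDiffOn.mp h2).congr fun y hy => ?_
  have h3 := mfderivWithin_of_isOpen (I := 𝓡 6) (I' := 𝓘(ℝ, Model)) (f := extChartAt (𝓡 6) x₀)
    ho (hs y hy)
  exact congrArg (fun T : Model →L[ℝ] Model => T (v y)) h3.symm

variable (H : AlmostHermitian M)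

/-- The metric in the preferred chart at `x₀`. -/
def chartMetric (x₀ : M) (y v w : Model) : ℝ :=
  H.g.inner ((extChartAt (𝓡 6) x₀).symm y) (chartInv x₀ y v) (chartInv x₀ y w)

/-- The almost complex structure in the preferred chart at `x₀`. -/
def chartJ (x₀ : M) (y v : Model) : Model :=
  chartDer x₀ ((extChartAt (𝓡 6) x₀).symm y)
    (H.J ((extChartAt (𝓡 6) x₀).symm y) (chartInv x₀ y v))

theorem contDiffOn_chartMetric {x₀ : M} {W : Set Model} (hW : W ⊆ (extChartAt (𝓡 6) x₀).target)
    {v w : Model → Model} (hv : ContDiffOn ℝ ∞ v W) (hw : ContDiffOn ℝ ∞ w W) :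
    ContDiffOn ℝ ∞ (fun y => chartMetric H x₀ y (v y) (w y)) W := by
  have h1 : ContMDiffOn 𝓘(ℝ, Model) (𝓡 6) ∞ (extChartAt (𝓡 6) x₀).symm W :=
    (contMDiffOn_extChartAt_symm (I := 𝓡 6) (n := ∞) x₀).mono hW
  have : ContMDiffOn 𝓘(ℝ, Model) ((𝓡 6).prod 𝓘(ℝ)) ∞
      (fun y ↦ Bundle.TotalSpace.mk' ℝ (E := Bundle.Trivial M ℝ) ((extChartAt (𝓡 6) x₀).symm y)
        (chartMetric H x₀ y (v y) (w y))) W := by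
    apply ContMDiffOn.clm_bundle_apply₂ (F₁ := Model) (F₂ := Model)
      (E₁ := fun x : M => TangentSpace (𝓡 6) x) (E₂ := fun x : M => TangentSpace (𝓡 6) x)
      (E₃ := Bundle.Trivial M ℝ)
      (ψ := fun y => H.g.inner ((extChartAt (𝓡 6) x₀).symm y))
    · exact H.g.contMDiff.comp_contMDiffOn h1
    · exact contMDiffOn_chartInv hW hv
    · exact contMDiffOn_chartInv hW hw
  intro y hy
  have h2 := this y hy
  rw [Bundle.contMDiffWithinAt_totalSpace] at h2
  exact h2.2.contDiffWithinAt

theorem contDiffOn_chartJ {x₀ : M} {W : Set Model} (hW : W ⊆ (extChartAt (𝓡 6) x₀).target)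
    {v : Model → Model} (hv : ContDiffOn ℝ ∞ v W) :
    ContDiffOn ℝ ∞ (fun y => chartJ H x₀ y (v y)) W := by
  have h1 : ContMDiffOn 𝓘(ℝ, Model) (𝓡 6) ∞ (extChartAt (𝓡 6) x₀).symm W :=
    (contMDiffOn_extChartAt_symm (I := 𝓡 6) (n := ∞) x₀).mono hW
  refine contDiffOn_chartDer hW ?_
  apply ContMDiffOn.clm_bundle_apply (F₁ := Model) (F₂ := Model)
    (E₁ := fun x : M => TangentSpace (𝓡 6) x) (E₂ := fun x : M => TangentSpace (𝓡 6) x)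
    (ϕ := fun y => H.J ((extChartAt (𝓡 6) x₀).symm y))
  · exact H.J_smooth.comp_contMDiffOn h1
  · exact contMDiffOn_chartInv hW hv

end Charts

/-! ### Local unitary frames -/

section Frames

variable {M : Type*} [TopologicalSpace M] [ChartedSpace Model M] [IsManifold (𝓡 6) ∞ M]
  (H : AlmostHermitian M)

/-- A unitary isomorphism between `ℂ³` and the tangent space of `M` at `z`. -/
structure IsUnitary (z : M) (F : Model →L[ℝ] Model) : Prop where
  metric : ∀ v w, H.g.inner z (F v) (F w) = stdG v w
  complex : ∀ v, H.J z (F v) = F (stdJ v)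

/-- A smooth unitary frame `P`, with inverse `Q`, on an open subset `W` of the domain of a chart. -/
structure IsUnitaryFrame (x₀ : M) (W : Set Model) (P Q : Model → Model →L[ℝ] Model) : Prop where
  isOpen : IsOpen W
  subset : W ⊆ (extChartAt (𝓡 6) x₀).target
  smooth : ContDiffOn ℝ ∞ P W
  smooth_inv : ContDiffOn ℝ ∞ Q W
  right_inv : ∀ y ∈ W, ∀ v, P y (Q y v) = v
  left_inv : ∀ y ∈ W, ∀ v, Q y (P y v) = v
  unitary : ∀ y ∈ W, IsUnitary H ((extChartAt (𝓡 6) x₀).symm y) ((chartInv x₀ y).comp (P y))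

variable {x₀ : M} {y : Model}

theorem chartInv_chartJ (hy : y ∈ (extChartAt (𝓡 6) x₀).target) (v : Model) :
    chartInv x₀ y (chartJ H x₀ y v) = H.J ((extChartAt (𝓡 6) x₀).symm y) (chartInv x₀ y v) :=
  chartInv_chartDer hy _

theorem chartMetric_symm (v w : Model) : chartMetric H x₀ y v w = chartMetric H x₀ y w v :=
  H.g.symm _ _ _

/-- The pullback of a bilinear form. -/
def pullForm (G : Model →L[ℝ] Model →L[ℝ] ℝ) (E : Model →L[ℝ] Model) : Model →ₗ[ℝ] Model →ₗ[ℝ] ℝ :=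
  LinearMap.mk₂ ℝ (fun v w => G (E v) (E w)) (by intros; simp) (by intros; simp) (by intros; simp)
    (by intros; simp)

/-- The metric in a chart, as a bilinear form. -/
def chartForm (x₀ : M) (y : Model) : Model →ₗ[ℝ] Model →ₗ[ℝ] ℝ :=
  pullForm (H.g.inner ((extChartAt (𝓡 6) x₀).symm y)) (chartInv x₀ y)

/-- The almost complex structure in a chart, as a linear map. -/
def chartJLM (x₀ : M) (y : Model) : Model →ₗ[ℝ] Model where
  toFun := chartJ H x₀ y
  map_add' v w := by
    simp only [chartJ, _root_.map_add]
    exact (congrArg _ (ContinuousLinearMap.map_add (H.J _) _ _)).trans (_root_.map_add _ _ _)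
  map_smul' c v := by
    simp only [chartJ, _root_.map_smul]
    exact (congrArg _ (ContinuousLinearMap.map_smul (H.J _) _ _)).trans (_root_.map_smul _ _ _)

theorem chartForm_apply (v w : Model) : chartForm H x₀ y v w = chartMetric H x₀ y v w := rfl
theorem chartJLM_apply (v : Model) : chartJLM H x₀ y v = chartJ H x₀ y v := rfl

theorem chartForm_pos (hy : y ∈ (extChartAt (𝓡 6) x₀).target) (v : Model) (hv : v ≠ 0) :
    0 < chartForm H x₀ y v v := by
  refine H.g.pos _ _ fun h => hv ?_
  rw [← chartDer_chartInv hy v]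
  exact (congrArg _ h).trans (_root_.map_zero _)

theorem chartForm_J (hy : y ∈ (extChartAt (𝓡 6) x₀).target) (v w : Model) :
    chartForm H x₀ y (chartJLM H x₀ y v) (chartJLM H x₀ y w) = chartForm H x₀ y v w := by
  simp only [chartForm_apply, chartJLM_apply, chartMetric, chartInv_chartJ H hy]
  exact H.J_orthogonal _ _ _

theorem chartJLM_sq (hy : y ∈ (extChartAt (𝓡 6) x₀).target) (v : Model) :
    chartJLM H x₀ y (chartJLM H x₀ y v) = -v := by
  simp only [chartJLM_apply]
  rw [chartJ, chartInv_chartJ H hy]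
  refine (congrArg _ (H.J_sq _ _)).trans ?_
  refine (_root_.map_neg (chartDer x₀ ((extChartAt (𝓡 6) x₀).symm y)) _).trans ?_
  rw [chartDer_chartInv hy]

theorem chartForm_J_left (hy : y ∈ (extChartAt (𝓡 6) x₀).target) (v w : Model) :
    chartForm H x₀ y (chartJLM H x₀ y v) w = -chartForm H x₀ y v (chartJLM H x₀ y w) := by
  rw [← chartForm_J H hy, chartJLM_sq H hy, _root_.map_neg]
  rfl

/-- Gram–Schmidt orthogonalization: a partial unitary frame can be extended. -/
theorem exists_partial_frame {y₁ : Model} (hy₁ : y₁ ∈ (extChartAt (𝓡 6) x₀).target) (m : ℕ)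
    (hm : m ≤ 3) : ∃ (W : Set Model) (u : Fin m → Model → Model), IsOpen W ∧ y₁ ∈ W ∧
      W ⊆ (extChartAt (𝓡 6) x₀).target ∧ (∀ i, ContDiffOn ℝ ∞ (u i) W) ∧
      ∀ y ∈ W, ∀ i j, chartForm H x₀ y (u i y) (u j y) = (if i = j then 1 else 0) ∧
        chartForm H x₀ y (chartJLM H x₀ y (u i y)) (u j y) = 0 := by
  induction m with
  | zero =>
    exact ⟨_, fun i => i.elim0, isOpen_extChartAt_target x₀, hy₁, subset_rfl,
      fun i => i.elim0, fun y _ i => i.elim0⟩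
  | succ m ih =>
    obtain ⟨W, u, hW, hyW, hWt, hu, ho⟩ := ih (by omega)
    let L : Model →ₗ[ℝ] (Fin m → ℝ) × (Fin m → ℝ) :=
      (LinearMap.pi fun i => chartForm H x₀ y₁ (u i y₁)).prod
        (LinearMap.pi fun i => chartForm H x₀ y₁ (chartJLM H x₀ y₁ (u i y₁)))
    have hL : LinearMap.ker L ≠ ⊥ := by
      apply LinearMap.ker_ne_bot_of_finrank_lt
      simp
      omega
    obtain ⟨w, hwL, hw0⟩ := Submodule.exists_mem_ne_zero_of_ne_bot hL
    rw [LinearMap.mem_ker] at hwL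
    have hw1 : ∀ i, chartForm H x₀ y₁ (u i y₁) w = 0 := fun i => congrFun (congrArg Prod.fst hwL) i
    have hw2 : ∀ i, chartForm H x₀ y₁ (chartJLM H x₀ y₁ (u i y₁)) w = 0 :=
      fun i => congrFun (congrArg Prod.snd hwL) i
    let p : Model → Model := fun y => w - ∑ i, (chartForm H x₀ y (u i y) w • u i y +
      chartForm H x₀ y (chartJLM H x₀ y (u i y)) w • chartJLM H x₀ y (u i y))
    have hJu : ∀ i, ContDiffOn ℝ ∞ (fun y => chartJLM H x₀ y (u i y)) W :=
      fun i => contDiffOn_chartJ H hWt (hu i)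
    have hp : ContDiffOn ℝ ∞ p W := by
      refine contDiffOn_const.sub (ContDiffOn.sum fun i _ => ContDiffOn.add ?_ ?_)
      · exact (contDiffOn_chartMetric H hWt (hu i) contDiffOn_const).smul (hu i)
      · exact (contDiffOn_chartMetric H hWt (hJu i) contDiffOn_const).smul (hJu i)
    have hp1 : p y₁ = w := by
      simp only [p, hw1, hw2, zero_smul, add_zero, Finset.sum_const_zero, sub_zero]
    let n : Model → ℝ := fun y => chartForm H x₀ y (p y) (p y)
    have hn : ContDiffOn ℝ ∞ n W := contDiffOn_chartMetric H hWt hp hp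
    have horth : ∀ y ∈ W, ∀ j, chartForm H x₀ y (u j y) (p y) = 0 ∧
        chartForm H x₀ y (chartJLM H x₀ y (u j y)) (p y) = 0 := by
      intro y hy j
      have e1 : ∀ i, chartForm H x₀ y (u j y) (chartJLM H x₀ y (u i y)) = 0 := by
        intro i
        have := chartForm_J_left H (hWt hy) (u j y) (u i y)
        rw [(ho y hy j i).2] at this
        linarith
      constructor
      · simp only [p, _root_.map_sub, _root_.map_sum, _root_.map_add, _root_.map_smul, e1,
          (ho y hy j _).1]
        simp
      · simp only [p, _root_.map_sub, _root_.map_sum, _root_.map_add, _root_.map_smul,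
          chartForm_J H (hWt hy), (ho y hy j _).1, (ho y hy j _).2]
        simp
    have hnpos : ∀ y ∈ W ∩ n ⁻¹' Set.Ioi 0, 0 < n y := fun y hy => hy.2
    refine ⟨W ∩ n ⁻¹' Set.Ioi 0, Fin.snoc u fun y => (Real.sqrt (n y))⁻¹ • p y,
      hn.continuousOn.isOpen_inter_preimage hW isOpen_Ioi, ⟨hyW, ?_⟩,
      Set.inter_subset_left.trans hWt, ?_, ?_⟩
    · change 0 < chartForm H x₀ y₁ (p y₁) (p y₁)
      rw [hp1]
      exact chartForm_pos H hy₁ w hw0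
    · intro i
      refine Fin.lastCases ?_ (fun i => ?_) i
      · simp only [Fin.snoc_last]
        have hn' := hn.mono (Set.inter_subset_left (s := W) (t := n ⁻¹' Set.Ioi 0))
        refine ContDiffOn.fun_smul ?_ (hp.mono Set.inter_subset_left)
        refine ContDiffOn.inv (hn'.sqrt fun y hy => (hnpos y hy).ne') fun y hy => ?_
        exact (Real.sqrt_pos.mpr (hnpos y hy)).ne'
      · simp only [Fin.snoc_castSucc]
        exact (hu i).mono Set.inter_subset_left
    · intro y hy i j
      have hn0 := hnpos y hy
      have hs : Real.sqrt (n y) ≠ 0 := (Real.sqrt_pos.mpr hn0).ne'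
      have hs2 : (Real.sqrt (n y))⁻¹ * ((Real.sqrt (n y))⁻¹ * n y) = 1 := by
        have := Real.mul_self_sqrt hn0.le
        field_simp
        rw [Real.sq_sqrt hn0.le]
      have hsymm : ∀ v w, chartForm H x₀ y v w = chartForm H x₀ y w v := fun v w =>
        chartMetric_symm H v w
      refine Fin.lastCases ?_ (fun i => ?_) i <;> refine Fin.lastCases ?_ (fun j => ?_) j <;>
        simp only [Fin.snoc_last, Fin.snoc_castSucc, _root_.map_smul, LinearMap.smul_apply,
          smul_eq_mul]
      · refine ⟨by simpa using hs2, ?_⟩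
        have h3 := chartForm_J_left H (hWt hy.1) (p y) (p y)
        rw [hsymm _ (chartJLM H x₀ y (p y))] at h3
        have h4 : chartForm H x₀ y (chartJLM H x₀ y (p y)) (p y) = 0 := by linarith
        rw [h4]; simp
      · have h1 := (horth y hy.1 j).1
        have h2 := (horth y hy.1 j).2
        rw [chartForm_J_left H (hWt hy.1), hsymm (p y), hsymm (p y), h1, h2]
        simp [(Fin.castSucc_lt_last j).ne']
      · have h1 := (horth y hy.1 i).1
        have h2 := (horth y hy.1 i).2
        rw [h1, h2]
        simp [(Fin.castSucc_lt_last i).ne]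
      · have := ho y hy.1 i j
        simpa using this

/-- Smooth unitary frames exist near every point. -/
theorem exists_unitaryFrame {y₁ : Model} (hy₁ : y₁ ∈ (extChartAt (𝓡 6) x₀).target) :
    ∃ W P Q, y₁ ∈ W ∧ IsUnitaryFrame H x₀ W P Q := by
  obtain ⟨W, u, hW, hyW, hWt, hu, ho⟩ := exists_partial_frame H hy₁ 3 le_rfl
  have hJu : ∀ i, ContDiffOn ℝ ∞ (fun y => chartJLM H x₀ y (u i y)) W :=
    fun i => contDiffOn_chartJ H hWt (hu i)
  let P : Model → Model →L[ℝ] Model := fun y => LinearMap.toContinuousLinearMap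
    { toFun := fun v => ∑ k, (v (reIdx k) • u k y + v (imIdx k) • chartJLM H x₀ y (u k y))
      map_add' := by
        intro v w
        simp only [PiLp.add_apply, add_smul, ← Finset.sum_add_distrib]
        exact Finset.sum_congr rfl fun k _ => by abel
      map_smul' := by
        intro c v
        simp only [PiLp.smul_apply, smul_eq_mul, mul_smul, Finset.smul_sum, smul_add,
          RingHom.id_apply] }
  have hPa : ∀ y v, P y v = ∑ k, (v (reIdx k) • u k y + v (imIdx k) • chartJLM H x₀ y (u k y)) :=
    fun _ _ => rfl
  let Q : Model → Model →L[ℝ] Model := fun y => LinearMap.toContinuousLinearMap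
    { toFun := fun v => ∑ k, (chartForm H x₀ y (u k y) v • stdVec (reIdx k) +
        chartForm H x₀ y (chartJLM H x₀ y (u k y)) v • stdVec (imIdx k))
      map_add' := by
        intro v w
        simp only [_root_.map_add, add_smul, ← Finset.sum_add_distrib]
        exact Finset.sum_congr rfl fun k _ => by abel
      map_smul' := by
        intro c v
        simp only [_root_.map_smul, smul_eq_mul, mul_smul, Finset.smul_sum, smul_add,
          RingHom.id_apply] }
  have hQa : ∀ y v, Q y v = ∑ k, (chartForm H x₀ y (u k y) v • stdVec (reIdx k) +
        chartForm H x₀ y (chartJLM H x₀ y (u k y)) v • stdVec (imIdx k)) := fun _ _ => rfl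
  have e1 : ∀ y ∈ W, ∀ i j, chartForm H x₀ y (u j y) (chartJLM H x₀ y (u i y)) = 0 := by
    intro y hy i j
    have := chartForm_J_left H (hWt hy) (u j y) (u i y)
    rw [(ho y hy j i).2] at this
    linarith
  have hQP : ∀ y ∈ W, ∀ v, Q y (P y v) = v := by
    intro y hy v
    rw [hQa]
    simp only [hPa, _root_.map_sum, _root_.map_add, _root_.map_smul, e1 y hy, (ho y hy _ _).1,
      (ho y hy _ _).2, chartForm_J H (hWt hy)]
    conv_rhs => rw [← sum_coord_smul_stdVec v, sum_six]
    simp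
  have hPQ : ∀ y ∈ W, ∀ v, P y (Q y v) = v := by
    intro y hy v
    have h1 : Function.Injective (P y : Model →ₗ[ℝ] Model) := fun a b h => by
      rw [← hQP y hy a, ← hQP y hy b]
      exact congrArg _ h
    obtain ⟨w, rfl⟩ := LinearMap.injective_iff_surjective.mp h1 v
    exact congrArg _ (hQP y hy w)
  refine ⟨W, P, Q, hyW, hW, hWt, ?_, ?_, hPQ, hQP, fun y hy => ⟨fun v w => ?_, fun v => ?_⟩⟩
  · rw [contDiffOn_clm_apply]
    intro v
    change ContDiffOn ℝ ∞ (fun y => ∑ k, (v (reIdx k) • u k y +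
      v (imIdx k) • chartJLM H x₀ y (u k y))) W
    refine ContDiffOn.sum fun k _ => ContDiffOn.add ?_ ?_
    · exact contDiffOn_const.fun_smul (hu k)
    · exact contDiffOn_const.fun_smul (hJu k)
  · rw [contDiffOn_clm_apply]
    intro v
    change ContDiffOn ℝ ∞ (fun y => ∑ k, (chartForm H x₀ y (u k y) v • stdVec (reIdx k) +
        chartForm H x₀ y (chartJLM H x₀ y (u k y)) v • stdVec (imIdx k))) W
    refine ContDiffOn.sum fun k _ => ContDiffOn.add ?_ ?_
    · exact (contDiffOn_chartMetric H hWt (hu k) contDiffOn_const).fun_smul contDiffOn_const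
    · exact (contDiffOn_chartMetric H hWt (hJu k) contDiffOn_const).fun_smul contDiffOn_const
  · change chartForm H x₀ y (P y v) (P y w) = _
    simp only [hPa, _root_.map_sum, _root_.map_add, _root_.map_smul, LinearMap.sum_apply,
      LinearMap.add_apply, LinearMap.smul_apply, e1 y hy, (ho y hy _ _).1,
      (ho y hy _ _).2, chartForm_J H (hWt hy), stdG_apply, sum_six (fun i => v i * w i)]
    simp [mul_comm]
  · have hJP : chartJLM H x₀ y (P y v) = P y (stdJ v) := by
      simp only [hPa, _root_.map_sum, _root_.map_add, _root_.map_smul, chartJLM_sq H (hWt hy)]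
      refine Finset.sum_congr rfl fun k _ => ?_
      have h1 : stdJ v (reIdx k) = - v (imIdx k) := by
        fin_cases k <;> simp [stdJ_apply, reIdx, imIdx]
      have h2 : stdJ v (imIdx k) = v (reIdx k) := by
        fin_cases k <;> simp [stdJ_apply, reIdx, imIdx]
      rw [h1, h2]
      module
    change _ = chartInv x₀ y (P y (stdJ v))
    rw [← hJP]
    exact (chartInv_chartJ H (hWt hy) _).symm

end Frames

/-! ### Naturality under unitary maps -/

theorem map_expand {k : ℕ} (β : Model [⋀^Fin k]→ₗ[ℝ] ℂ) (w : Fin k → Model) :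
    β w = ∑ i : Fin k → Fin 6, ((∏ a, w a (i a) : ℝ) : ℂ) * β (fun a => stdVec (i a)) := by
  have : w = fun a => ∑ j, w a j • stdVec j := by
    funext a; rw [sum_coord_smul_stdVec]
  conv_lhs => rw [this]
  refine (β.toMultilinearMap.map_sum (fun a j => w a j • stdVec j)).trans ?_
  refine Finset.sum_congr rfl fun i _ => ?_
  refine (β.toMultilinearMap.map_smul_univ _ _).trans ?_
  rw [Complex.real_smul]
  rfl

/-- The star operator does not depend on the basis, and is natural. -/
theorem hodgeStar_comp {G : Model →L[ℝ] Model →L[ℝ] ℝ} {F : Model →L[ℝ] Model}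
    (hF : ∀ v w, G (F v) (F w) = stdG v w) (ε : Model [⋀^Fin 6]→L[ℝ] ℂ) {k m : ℕ} (h : k + m = 6)
    (β : Model [⋀^Fin k]→L[ℝ] ℂ) :
    (hodgeStar G stdVec ε h β).compContinuousLinearMap F =
      hodgeStar stdG stdVec (ε.compContinuousLinearMap F) h (β.compContinuousLinearMap F) := by
  let C : Matrix (Fin 6) (Fin 6) ℝ := Matrix.of fun c i => F (stdVec c) i
  have hC : C * (gram G stdVec * C.transpose) = 1 := by
    ext c d
    have h1 := hF (stdVec c) (stdVec d)
    rw [← sum_coord_smul_stdVec (F (stdVec c)), ← sum_coord_smul_stdVec (F (stdVec d))] at h1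
    have h2 : stdG (stdVec c) (stdVec d) = (1 : Matrix (Fin 6) (Fin 6) ℝ) c d := by
      rw [← gram_stdG_stdVec]; rfl
    rw [← h2, ← h1]
    simp only [_root_.map_sum, _root_.map_smul, _root_.sum_apply, _root_.smul_apply, smul_eq_mul,
      Matrix.mul_apply, Matrix.transpose_apply, C, Matrix.of_apply, gram, Finset.mul_sum]
    rw [Finset.sum_comm]
    refine Finset.sum_congr rfl fun i _ => Finset.sum_congr rfl fun j _ => ?_
    ring
  have hinv : (gram G stdVec)⁻¹ = C.transpose * C := by
    have h1 := mul_eq_one_comm.mp hC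
    rw [Matrix.mul_assoc] at h1
    exact Matrix.inv_eq_right_inv h1
  ext v
  rw [hodgeStar_apply_of_gram_eq_one gram_stdG_stdVec,
    ContinuousAlternatingMap.compContinuousLinearMap_apply, hodgeStar, hinv,
    ContinuousAlternatingMap.smul_apply, smul_eq_mul]
  congr 1
  have hS : ∀ c : Fin k → Fin 6, contract h (ε.compContinuousLinearMap F) (stdVec ∘ c) v =
      contractLeft h ε (F ∘ v) (F ∘ stdVec ∘ c) := by
    intro c
    change ε _ = ε _
    congr 1
    funext a
    have : ∀ b : Fin (k + m), F (Fin.append (stdVec ∘ c) v b) =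
        Fin.append (F ∘ stdVec ∘ c) (F ∘ v) b := by
      intro b
      refine Fin.addCases (fun b => ?_) (fun b => ?_) b <;> simp
    exact this _
  have hR : ∀ c : Fin k → Fin 6, starRingEnd ℂ (β.compContinuousLinearMap F (stdVec ∘ c)) *
      contract h (ε.compContinuousLinearMap F) (stdVec ∘ c) v =
      ∑ i : Fin k → Fin 6, ∑ j : Fin k → Fin 6, ((∏ a, (C (c a) (i a) * C (c a) (j a)) : ℝ) : ℂ) *
        (starRingEnd ℂ (β (fun a => stdVec (i a))) * contractLeft h ε (F ∘ v)
          (fun a => stdVec (j a))) := by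
    intro c
    have e1 : β.compContinuousLinearMap F (stdVec ∘ c) =
        β.toAlternatingMap (F ∘ stdVec ∘ c) := rfl
    rw [hS, e1, map_expand, map_expand (contractLeft h ε (F ∘ v)), _root_.map_sum,
      Finset.sum_mul_sum]
    refine Finset.sum_congr rfl fun i _ => Finset.sum_congr rfl fun j _ => ?_
    rw [map_mul, Complex.conj_ofReal, Finset.prod_mul_distrib]
    push_cast
    simp only [Function.comp_apply, C, Matrix.of_apply]
    change _ = _ * (starRingEnd ℂ (β.toAlternatingMap fun a => stdVec (i a)) * _)
    ring
  rw [Finset.sum_congr rfl fun c _ => hR c, ContinuousAlternatingMap.sum_apply]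
  conv_rhs => rw [Finset.sum_comm]
  refine Finset.sum_congr rfl fun i _ => ?_
  rw [ContinuousAlternatingMap.sum_apply, Finset.sum_comm]
  refine Finset.sum_congr rfl fun j _ => ?_
  rw [← Finset.sum_mul, ContinuousAlternatingMap.smul_apply, smul_eq_mul, mul_assoc]
  congr 1
  rw [← Complex.ofReal_sum]
  congr 1
  simp only [Matrix.mul_apply, Matrix.transpose_apply]
  rw [Finset.prod_univ_sum, Fintype.piFinset_univ]

theorem wedge_comp {V W : Type*} [AddCommGroup V] [Module ℝ V] [TopologicalSpace V]
    [AddCommGroup W] [Module ℝ W] [TopologicalSpace W] {k l : ℕ}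
    (α : V [⋀^Fin k]→L[ℝ] ℂ) (β : V [⋀^Fin l]→L[ℝ] ℂ) (F : W →L[ℝ] V) :
      (wedge α β).compContinuousLinearMap F =
      wedge (α.compContinuousLinearMap F) (β.compContinuousLinearMap F) := by
  ext v
  rw [ContinuousAlternatingMap.compContinuousLinearMap_apply, wedge_apply, wedge_apply]
  rfl

section

variable {M : Type*} [TopologicalSpace M] [ChartedSpace Model M] [IsManifold (𝓡 6) ∞ M]
  (H : AlmostHermitian M)

/-- The value at `z` of a form of mixed degree. -/
def value (η : MixedForm M) (z : M) : Fiber := fun k => η k z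

/-- The fibrewise operator `O₀` on `⨁ₖ Λ^k(ℝ⁶)` describes the operator `O` on forms in all unitary
frames. -/
def Represents (O : FormOp M) (O₀ : Fiber →ₗ[ℝ] Fiber) : Prop :=
  ∀ (η : MixedForm M) (z : M) (F : Model →L[ℝ] Model), IsUnitary H z F →
    pull F (value (O η) z) = O₀ (pull F (value η z))

variable {H} {z : M} {F : Model →L[ℝ] Model}

theorem IsUnitary.omega (hF : IsUnitary H z F) :
    ContinuousAlternatingMap.compContinuousLinearMap (H.omega z) F = stdOmega := by
  ext v
  have h1 := hF.metric (stdJ (v 0)) (v 1)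
  rw [← hF.complex] at h1
  exact congrArg Complex.ofReal h1

theorem smul_comp {V W : Type*} [AddCommGroup V] [Module ℝ V] [TopologicalSpace V]
    [AddCommGroup W] [Module ℝ W] [TopologicalSpace W] {k : ℕ} (c : ℂ) (σ : V [⋀^Fin k]→L[ℝ] ℂ)
    (F : W →L[ℝ] V) : (c • σ).compContinuousLinearMap F = c • σ.compContinuousLinearMap F := rfl

theorem cube_comp {V : Type*} [AddCommGroup V] [Module ℝ V] [TopologicalSpace V]
    {σ : V [⋀^Fin 2]→L[ℝ] ℂ} {F : Model →L[ℝ] V} (h : σ.compContinuousLinearMap F = stdOmega) :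
    ((6 : ℂ)⁻¹ • wedge σ (wedge σ σ)).compContinuousLinearMap F =
      (6 : ℂ)⁻¹ • wedge stdOmega (wedge stdOmega stdOmega) := by
  rw [smul_comp, wedge_comp, wedge_comp, h]

theorem IsUnitary.vol (hF : IsUnitary H z F) :
    ContinuousAlternatingMap.compContinuousLinearMap (H.vol z)
      (F : Model →L[ℝ] TangentSpace (𝓡 6) z) = stdVol :=
  cube_comp (V := TangentSpace (𝓡 6) z) (σ := H.omega z) (F := F) hF.omega

/-- A conjugate-linear operator as a real-linear one. -/
def realStar : Fiber →ₗ[ℝ] Fiber where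
  toFun := stdStar
  map_add' := _root_.map_add stdStar
  map_smul' c η := by
    have := stdStar.map_smulₛₗ (c : ℂ) η
    rw [Complex.conj_ofReal] at this
    exact this

/-- The star operator is described by the standard star operator in all unitary frames. -/
theorem represents_star : Represents H H.star realStar := by
  intro η z F hF
  funext m
  change _ = stdStar _ m
  by_cases hm : m ≤ 6
  · have h1 : (6 - m) + m = 6 := Nat.sub_add_cancel hm
    rw [stdStar, starFiber_apply _ _ _ _ h1]
    have h2 : value (H.star η) z m = hodgeStar (V := Model) (H.g.inner z) stdVec (H.vol z) h1
        (value η z (6 - m)) := dif_pos hm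
    change ContinuousAlternatingMap.compContinuousLinearMap (value (H.star η) z m) F = _
    rw [h2]
    refine (hodgeStar_comp (G := H.g.inner z) hF.metric (H.vol z) h1 (value η z (6 - m))).trans ?_
    exact congrArg (fun t => hodgeStar stdG stdVec t h1 _) hF.vol
  · exact (form_eq_zero_of_six_lt (by omega) _).trans (form_eq_zero_of_six_lt (by omega) _).symm

theorem IsUnitary.typeProj (hF : IsUnitary H z F) (p q : ℤ) {k : ℕ} (η : Model [⋀^Fin k]→L[ℝ] ℂ) :
    (NearlyKahler.typeProj (V := Model) (H.J z) p q η).compContinuousLinearMap F =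
      NearlyKahler.typeProj stdJ p q (η.compContinuousLinearMap F) :=
  typeProj_comp stdJ (H.J z) F (fun v => (hF.complex v).symm) p q η

/-- An endomorphism of `ℂ³` that preserves the Hermitian structure. -/
def IsU3 (A : Model →L[ℝ] Model) : Prop :=
  (∀ v w, stdG (A v) (A w) = stdG v w) ∧ ∀ v, stdJ (A v) = A (stdJ v)

theorem stdG_pos (v : Model) (h : stdG v v = 0) : v = 0 := by
  change inner ℝ v v = 0 at h
  exact inner_self_eq_zero.mp h

theorem IsUnitary.injective (hF : IsUnitary H z F) : Function.Injective F := by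
  intro v w h
  have h1 : F (v - w) = 0 := by rw [_root_.map_sub, h, sub_self]
  have h2 := hF.metric (v - w) (v - w)
  rw [h1] at h2
  exact sub_eq_zero.mp (stdG_pos _ (h2.symm.trans (_root_.map_zero _)))

theorem IsUnitary.exists_inverse (hF : IsUnitary H z F) :
    ∃ F' : Model →L[ℝ] Model, (∀ v, F (F' v) = v) ∧ ∀ v, F' (F v) = v := by
  let e := LinearEquiv.ofInjectiveEndo (F : Model →ₗ[ℝ] Model) hF.injective
  refine ⟨LinearMap.toContinuousLinearMap (e.symm : Model →ₗ[ℝ] Model), fun v => ?_, fun v => ?_⟩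
  · exact e.apply_symm_apply v
  · exact e.symm_apply_apply v

theorem exists_isUnitary (H : AlmostHermitian M) (z : M) : ∃ F, IsUnitary H z F := by
  obtain ⟨W, P, Q, hy, hW⟩ := exists_unitaryFrame H (mem_extChartAt_target (I := 𝓡 6) z)
  have := hW.unitary _ hy
  rw [extChartAt_to_inv] at this
  exact ⟨_, this⟩

theorem pull_pull (A B : Model →L[ℝ] Model) (η : Fiber) : pull A (pull B η) = pull (B.comp A) η :=
    rfl

theorem pull_eq_self {A : Model →L[ℝ] Model} (hA : ∀ v, A v = v) (η : Fiber) : pull A η = η := by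
  funext k; ext v; simp [hA]

/-- The operator on forms described by an invariant operator on `⨁ₖ Λ^k(ℝ⁶)`. -/
def liftOp (H : AlmostHermitian M) (O₀ : Fiber →ₗ[ℝ] Fiber) : FormOp M := fun η k z =>
  pull (exists_isUnitary H z).choose_spec.exists_inverse.choose
    (O₀ (pull (exists_isUnitary H z).choose (value η z))) k

theorem represents_liftOp (H : AlmostHermitian M) {O₀ : Fiber →ₗ[ℝ] Fiber}
    (hO : ∀ A, IsU3 A → ∀ η, pull A (O₀ η) = O₀ (pull A η)) : Represents H (liftOp H O₀) O₀ := by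
  intro η z F hF
  set F₀ := (exists_isUnitary H z).choose
  have hF₀ : IsUnitary H z F₀ := (exists_isUnitary H z).choose_spec
  set F' := (exists_isUnitary H z).choose_spec.exists_inverse.choose
  have hF' : (∀ v, F₀ (F' v) = v) ∧ ∀ v, F' (F₀ v) = v :=
    (exists_isUnitary H z).choose_spec.exists_inverse.choose_spec
  have hA : IsU3 (F'.comp F) := by
    constructor
    · intro v w
      refine (hF₀.metric _ _).symm.trans ?_
      simp only [ContinuousLinearMap.comp_apply, hF'.1]
      exact hF.metric v w
    · intro v
      apply hF₀.injective
      rw [← hF₀.complex]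
      simp only [ContinuousLinearMap.comp_apply, hF'.1, hF.complex]
  have h1 : value (liftOp H O₀ η) z = pull F' (O₀ (pull F₀ (value η z))) := rfl
  rw [h1, pull_pull, hO _ hA, pull_pull]
  congr 2
  have : F₀.comp (F'.comp F) = F := by ext1 v; exact hF'.1 _
  rw [this]

end

/-! ### Smooth forms in charts and frames -/

section

variable {M : Type*} [TopologicalSpace M] [ChartedSpace Model M]

/-- The expression of a form of mixed degree in the preferred chart at `x₀`. -/
def chartRep (η : MixedForm M) (x₀ : M) (y : Model) : Fiber := fun k => inChart x₀ (η k) y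

/-- The components of a form of mixed degree in a frame. -/
def frameRep (η : MixedForm M) (x₀ : M) (P : Model → Model →L[ℝ] Model) (y : Model) : Fiber :=
  pull (P y) (chartRep η x₀ y)

theorem frameRep_eq (η : MixedForm M) (x₀ : M) (P : Model → Model →L[ℝ] Model) (y : Model) :
    frameRep η x₀ P y = pull ((chartInv x₀ y).comp (P y))
      (value η ((extChartAt (𝓡 6) x₀).symm y)) := rfl

/-- The forms of mixed degree all of whose components are smooth. -/
def IsSmoothMixed (η : MixedForm M) : Prop := ∀ k, IsSmooth (η k)

theorem IsSmoothMixed.smoothOn_chartRep {η : MixedForm M} (hη : IsSmoothMixed η) (x₀ : M) :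
    SmoothOn (chartRep η x₀) (extChartAt (𝓡 6) x₀).target := fun k => hη k x₀

theorem SmoothOn.pull {f : Model → Fiber} {W : Set Model} (hf : SmoothOn f W)
    {A : Model → Model →L[ℝ] Model} (hA : ContDiffOn ℝ ∞ A W) :
    SmoothOn (fun y => NearlyKahler.pull (A y) (f y)) W :=
  fun k => contDiffOn_compContinuousLinearMap (hf k) hA

variable [IsManifold (𝓡 6) ∞ M] {H : AlmostHermitian M} {x₀ : M} {W : Set Model}
  {P Q : Model → Model →L[ℝ] Model}

theorem IsUnitaryFrame.smoothOn_frameRep (hP : IsUnitaryFrame H x₀ W P Q) {η : MixedForm M}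
    (hη : IsSmoothMixed η) : SmoothOn (frameRep η x₀ P) W :=
  SmoothOn.pull (fun k => ((hη.smoothOn_chartRep x₀) k).mono hP.subset) hP.smooth

theorem IsUnitaryFrame.pull_frameRep (hP : IsUnitaryFrame H x₀ W P Q) (η : MixedForm M) {y : Model}
    (hy : y ∈ W) : pull (Q y) (frameRep η x₀ P y) = chartRep η x₀ y := by
  rw [frameRep, pull_pull]
  exact pull_eq_self (hP.right_inv y hy) _

theorem Represents.frameRep {O : FormOp M} {O₀ : Fiber →ₗ[ℝ] Fiber} (hO : Represents H O O₀)
    (hP : IsUnitaryFrame H x₀ W P Q) (η : MixedForm M) {y : Model} (hy : y ∈ W) :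
    NearlyKahler.frameRep (O η) x₀ P y = O₀ (NearlyKahler.frameRep η x₀ P y) :=
  hO η _ _ (hP.unitary y hy)

/-- A form is smooth if its components in unitary frames are. -/
theorem isSmoothMixed_of_frameRep (H : AlmostHermitian M) {η : MixedForm M}
    (h : ∀ x₀ W P Q, IsUnitaryFrame H x₀ W P Q → SmoothOn (frameRep η x₀ P) W) :
    IsSmoothMixed η := by
  intro k x₀ y hy
  obtain ⟨W, P, Q, hyW, hP⟩ := exists_unitaryFrame H hy
  have h1 : SmoothOn (fun y => pull (Q y) (frameRep η x₀ P y)) W :=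
    (h x₀ W P Q hP).pull hP.smooth_inv
  have h2 : ContDiffOn ℝ ∞ (inChart x₀ (η k)) W := (h1 k).congr fun z hz =>
    congrFun (hP.pull_frameRep η hz).symm k
  exact ((h2 y hyW).contDiffAt (hP.isOpen.mem_nhds hyW)).contDiffWithinAt

theorem Represents.isSmoothMixed {O : FormOp M} {O₀ : Fiber →ₗ[ℝ] Fiber} (hO : Represents H O O₀)
    {η : MixedForm M} (hη : IsSmoothMixed η) : IsSmoothMixed (O η) := by
  refine isSmoothMixed_of_frameRep H fun x₀ W P Q hP k => ?_
  exact (((hP.smoothOn_frameRep hη).map O₀) k).congr fun y hy => congrFun (hO.frameRep hP η hy) k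

/-- The de Rham differential computed in an arbitrary chart. -/
theorem inChart_extD {k : ℕ} {η : Form M k} (hη : IsSmooth η) (x₀ : M) {y : Model}
    (hy : y ∈ (extChartAt (𝓡 6) x₀).target) :
    inChart x₀ (extD η) y = extDeriv (inChart x₀ η) y := by
  set z₀ := (extChartAt (𝓡 6) x₀).symm y with hz₀
  let τ : Model → Model := fun y' => extChartAt (𝓡 6) z₀ ((extChartAt (𝓡 6) x₀).symm y')
  have : IsManifold (𝓡 6) 1 M := IsManifold.of_le (n := ∞) (by norm_cast)
  -- on a neighbourhood of `y` the transition map `τ` is defined and smooth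
  let U : Set Model := (extChartAt (𝓡 6) x₀).target ∩
    (extChartAt (𝓡 6) x₀).symm ⁻¹' (extChartAt (𝓡 6) z₀).source
  have hUo : IsOpen U := (continuousOn_extChartAt_symm (I := 𝓡 6) x₀).isOpen_inter_preimage
    (isOpen_extChartAt_target x₀) (isOpen_extChartAt_source z₀)
  have hyU : y ∈ U := ⟨hy, mem_extChartAt_source (I := 𝓡 6) z₀⟩
  have hsm : ∀ y' ∈ U, ContMDiffAt 𝓘(ℝ, Model) (𝓡 6) ∞ (extChartAt (𝓡 6) x₀).symm y' :=
    fun y' hy' => (contMDiffOn_extChartAt_symm x₀).contMDiffAt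
      ((isOpen_extChartAt_target x₀).mem_nhds hy'.1)
  have hch : ∀ y' ∈ U, ContMDiffAt (𝓡 6) 𝓘(ℝ, Model) ∞ (extChartAt (𝓡 6) z₀)
      ((extChartAt (𝓡 6) x₀).symm y') :=
    fun y' hy' => contMDiffAt_extChartAt' (by rw [← extChartAt_source (𝓡 6)]; exact hy'.2)
  have hτ : ∀ y' ∈ U, fderiv ℝ τ y' =
      (chartDer z₀ ((extChartAt (𝓡 6) x₀).symm y')).comp (chartInv x₀ y') := by
    intro y' hy'
    rw [← mfderiv_eq_fderiv]
    exact mfderiv_comp y' ((hch y' hy').mdifferentiableAt (by simp))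
      ((hsm y' hy').mdifferentiableAt (by simp))
  have hτs : ContDiffAt ℝ ∞ τ y := ((hch y hyU).comp y (hsm y hyU)).contDiffAt
  have hU : ∀ y' ∈ U, inChart x₀ η y' =
      (inChart z₀ η (τ y')).compContinuousLinearMap (fderiv ℝ τ y') := by
    intro y' hy'
    have hinv : (extChartAt (𝓡 6) z₀).symm (τ y') = (extChartAt (𝓡 6) x₀).symm y' :=
      (extChartAt (𝓡 6) z₀).left_inv hy'.2
    have ht : τ y' ∈ (extChartAt (𝓡 6) z₀).target := (extChartAt (𝓡 6) z₀).map_source hy'.2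
    have h1 : ∀ v, chartInv z₀ (τ y') (fderiv ℝ τ y' v) = chartInv x₀ y' v := by
      intro v
      rw [hτ y' hy', ContinuousLinearMap.comp_apply, ← hinv, chartInv_chartDer ht]
    let E : M → Model [⋀^Fin k]→L[ℝ] ℂ := fun z => η z
    have h2 : E ((extChartAt (𝓡 6) z₀).symm (τ y')) = E ((extChartAt (𝓡 6) x₀).symm y') :=
      congrArg E hinv
    ext v
    change E _ (fun i => chartInv x₀ y' (v i)) =
      E _ (fun i => chartInv z₀ (τ y') (fderiv ℝ τ y' (v i)))
    simp only [h1, h2]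
  have hd : DifferentiableAt ℝ (inChart z₀ η) (τ y) :=
    ((hη z₀).contDiffAt ((isOpen_extChartAt_target z₀).mem_nhds
      ((extChartAt (𝓡 6) z₀).map_source hyU.2))).differentiableAt (by simp)
  rw [Filter.EventuallyEq.extDeriv_eq (Filter.eventuallyEq_of_mem (hUo.mem_nhds hyU) hU),
    extDeriv_pullback hd hτs (by simp only [minSmoothness_of_isRCLikeNormedField]; norm_cast),
      hτ y hyU]
  rfl

set_option synthInstance.maxHeartbeats 200000 in
theorem isSmooth_extD {k : ℕ} {η : Form M k} (hη : IsSmooth η) : IsSmooth (extD η) := by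
  intro x₀
  have ho : IsOpen (extChartAt (𝓡 6) x₀).target := isOpen_extChartAt_target x₀
  refine ContDiffOn.congr ?_ fun y hy => inChart_extD hη x₀ hy
  have h1 : ContDiffOn ℝ ∞ (fderiv ℝ (inChart x₀ η)) (extChartAt (𝓡 6) x₀).target :=
    (hη x₀).fderiv_of_isOpen ho (by norm_cast)
  exact (alternatizeUncurryFinCLM (n := k) ℝ Model ℂ).contDiff.comp_contDiffOn h1

theorem extD_extD {k : ℕ} {η : Form M k} (hη : IsSmooth η) : extD (extD η) = 0 := by
  funext x
  have ho : IsOpen (extChartAt (𝓡 6) x).target := isOpen_extChartAt_target x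
  have hx := mem_extChartAt_target (I := 𝓡 6) x
  have h1 : extDeriv (inChart x (extD η)) (extChartAt (𝓡 6) x x) = 0 := by
    rw [Filter.EventuallyEq.extDeriv_eq (Filter.eventuallyEq_of_mem (ho.mem_nhds hx)
      fun y hy => inChart_extD hη x hy)]
    exact extDeriv_extDeriv_apply ((hη x).contDiffAt (ho.mem_nhds hx))
      (by simp only [minSmoothness_of_isRCLikeNormedField]; norm_cast)
  rw [extD, h1]
  rfl

theorem isSmoothMixed_deRham {η : MixedForm M} (hη : IsSmoothMixed η) :
    IsSmoothMixed (deRham η) := by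
  intro k
  cases k with
  | zero => intro x₀; exact contDiffOn_const (c := 0)
  | succ k => exact isSmooth_extD (hη k)

theorem deRham_deRham {η : MixedForm M} (hη : IsSmoothMixed η) : deRham (deRham η) = 0 := by
  funext k
  rcases k with _ | _ | k
  · rfl
  · funext x
    change extD (0 : Form M 0) x = 0
    have h1 : inChart x (0 : Form M 0) = fun _ => 0 := rfl
    rw [extD, h1]
    ext v
    change extDeriv (fun _ => (0 : Model [⋀^Fin 0]→L[ℝ] ℂ)) _ _ = 0
    simp [extDeriv, alternatizeUncurryFin_apply]
  · exact extD_extD (hη k)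

/-- The de Rham differential in a unitary frame. -/
theorem IsUnitaryFrame.frameRep_deRham (hP : IsUnitaryFrame H x₀ W P Q) {η : MixedForm M}
    (hη : IsSmoothMixed η) {y : Model} (hy : y ∈ W) :
    frameRep (deRham η) x₀ P y = ∑ i, cre i (dirDeriv (frameRep η x₀ P) y (P y (stdVec i)) +
        derivation ((fderiv ℝ Q y (P y (stdVec i))).comp (P y)) (frameRep η x₀ P y)) := by
  funext k
  cases k with
  | zero =>
    rw [Finset.sum_apply]
    refine Eq.trans ?_ (Finset.sum_eq_zero fun i _ => ?_).symm
    · rfl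
    · rfl
  | succ k =>
    have hsm := hP.smoothOn_frameRep hη
    have h1 := extDeriv_frame (fun k => hsm.differentiableAt hP.isOpen hy k)
      ((hP.smooth_inv.contDiffAt (hP.isOpen.mem_nhds hy)).differentiableAt (by simp))
      (hP.left_inv y hy) k
    rw [← h1]
    change (inChart x₀ (extD (η k)) y).compContinuousLinearMap (P y) = _
    rw [inChart_extD (hη k) x₀ (hP.subset hy)]
    congr 1
    refine Filter.EventuallyEq.extDeriv_eq (Filter.eventuallyEq_of_mem (hP.isOpen.mem_nhds hy) ?_)
    intro z hz
    exact congrFun (hP.pull_frameRep η hz).symm k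

end

/-! ### Operators invariant under the unitary group -/

/-- Invariance under pullback by the elements of `U(3)`. -/
def IsInvariant (O : Fiber →ₗ[ℝ] Fiber) : Prop :=
  ∀ A, IsU3 A → ∀ η, pull A (O η) = O (pull A η)

/-- The Lie algebra of `U(3)`. -/
structure IsSkewHermitian (B : Model →L[ℝ] Model) : Prop where
  skew : ∀ v w, stdG (B v) w = -stdG v (B w)
  complex : ∀ v, stdJ (B v) = B (stdJ v)

theorem IsSkewHermitian.isU3_exp {B : Model →L[ℝ] Model} (hB : IsSkewHermitian B) (t : ℝ) :
    IsU3 (NormedSpace.exp (t • B)) := by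
  let _ : NormedAlgebra ℚ (Model →L[ℝ] Model) := NormedAlgebra.restrictScalars ℚ ℝ _
  constructor
  · have h1 : t • B ∈ skewAdjoint (Model →L[ℝ] Model) := by
      refine skewAdjoint.smul_mem t ?_
      rw [skewAdjoint.mem_iff, ContinuousLinearMap.star_eq_adjoint]
      refine ContinuousLinearMap.ext fun w => ext_inner_left ℝ fun v => ?_
      rw [ContinuousLinearMap.adjoint_inner_right, _root_.neg_apply, inner_neg_right]
      exact hB.skew v w
    exact (ContinuousLinearMap.inner_map_map_of_mem_unitary
      (NormedSpace.exp_mem_unitary_of_mem_skewAdjoint h1))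
  · have h1 : Commute stdJ (t • B) := ContinuousLinearMap.ext fun v => by
      change stdJ (t • B v) = t • B (stdJ v)
      rw [_root_.map_smul, hB.complex]
    have h2 : Commute stdJ (NormedSpace.exp (t • B)) := h1.exp_right
    exact fun v => congrArg (fun A : Model →L[ℝ] Model => A v) h2

theorem hasFDerivAt_pull_exp (B : Model →L[ℝ] Model) (f : Fiber) (k : ℕ) :
    ∃ L : Model →L[ℝ] (Model [⋀^Fin k]→L[ℝ] ℂ),
      HasFDerivAt (fun y : Model => pull (NormedSpace.exp (y 0 • B)) f k) L 0 ∧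
      L (stdVec 0) = derivation B f k := by
  let T : Model →L[ℝ] Model →L[ℝ] Model :=
    (EuclideanSpace.proj (0 : Fin 6) : Model →L[ℝ] ℝ).smulRight B
  have h0 : HasFDerivAt (NormedSpace.exp : (Model →L[ℝ] Model) → _)
      (1 : (Model →L[ℝ] Model) →L[ℝ] (Model →L[ℝ] Model)) (T 0) := by
    rw [_root_.map_zero]; exact hasFDerivAt_exp_zero
  have h1 : HasFDerivAt (fun y : Model => NormedSpace.exp (y 0 • B)) T 0 :=
    h0.comp (0 : Model) T.hasFDerivAt
  have h2 :=
    (hasFDerivAt_const (f k) (0 : Model)).continuousAlternatingMapCompContinuousLinearMap h1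
  refine ⟨_, h2, ?_⟩
  ext w
  have h3 : ∀ v, T (stdVec 0) v = B v := by intro v; simp [T, stdVec]
  simp only [derivation_apply, _root_.add_apply, ContinuousLinearMap.comp_apply,
    ContinuousAlternatingMap.add_apply, compContinuousLinearMapCLM_apply,
    ContinuousAlternatingMap.fderivCompContinuousLinearMap_apply]
  simp
  refine Finset.sum_congr rfl fun p _ => ?_
  congr 1
  funext i
  by_cases hi : i = p
  · subst hi; simp [h3]
  · have h4 : NormedSpace.exp ((0 : ℝ) • B) (w i) = w i := by
      rw [zero_smul ℝ B, NormedSpace.exp_zero]; rfl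
    simp [hi, h4]

/-- An invariant operator commutes with the infinitesimal action of `U(3)`. -/
theorem IsInvariant.derivation {O : Fiber →ₗ[ℝ] Fiber} (hO : IsInvariant O)
    {B : Model →L[ℝ] Model} (hB : IsSkewHermitian B) (f : Fiber) :
    NearlyKahler.derivation B (O f) = O (NearlyKahler.derivation B f) := by
  have h : ∀ f, dirDeriv (fun y => pull (NormedSpace.exp (y 0 • B)) f) 0 (stdVec 0) =
      NearlyKahler.derivation B f := by
    intro f
    funext k
    obtain ⟨L, hL, h1⟩ := hasFDerivAt_pull_exp B f k
    rw [dirDeriv, hL.fderiv, h1]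
  rw [← h, ← h, ← dirDeriv_map fun k => (hasFDerivAt_pull_exp B f k).choose_spec.1.differentiableAt]
  congr 1
  funext y
  exact hO _ (hB.isU3_exp _) f

theorem rotMap_comm {A : Model →L[ℝ] Model} (hA : ∀ v, stdJ (A v) = A (stdJ v)) (ζ : ℂ)
    (v : Model) :
    rotMap ζ (A v) = A (rotMap ζ v) := by
  simp [rotMap_apply, hA]

theorem isInvariant_rot (ζ : Circle) : IsInvariant ((rot ζ).restrictScalars ℝ) := by
  intro A hA η
  change pull A (pull _ η) = pull _ (pull A η)
  have h : (rotMap ζ).comp A = A.comp (rotMap ζ) :=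
    ContinuousLinearMap.ext fun v => rotMap_comm hA.2 ζ v
  exact congrArg (fun C => pull C η) h

theorem isInvariant_parity : IsInvariant (parity.restrictScalars ℝ) := by
  intro A hA η
  funext k
  rfl

/-- The star operator is natural under orientation-preserving isometries, in particular under
`U(3)`. -/
theorem isInvariant_realStar : IsInvariant realStar := by
  intro A hA η
  have hω : stdOmega.compContinuousLinearMap A = stdOmega := by
    ext v
    have h1 := hA.1 (stdJ (v 0)) (v 1)
    rw [← hA.2] at h1
    exact congrArg Complex.ofReal h1
  funext m
  change (stdStar η m).compContinuousLinearMap A = stdStar (pull A η) m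
  by_cases hm : m ≤ 6
  · have h1 : (6 - m) + m = 6 := Nat.sub_add_cancel hm
    rw [stdStar, starFiber_apply _ _ _ _ h1, starFiber_apply _ _ _ _ h1, hodgeStar_comp hA.1]
    congr 1
    exact cube_comp hω
  · rw [form_eq_zero_of_six_lt (by omega) (stdStar (pull A η) m),
      form_eq_zero_of_six_lt (by omega) (stdStar η m)]
    rfl

/-- The contraction with the Hermitian form. -/
def contraction : Module.End ℂ Fiber := lefschetzDual (annA ann) (annB ann)

theorem contraction_eq :
    contraction = (-(2⁻¹) : ℂ) • ∑ i, interior (stdVec i) * interior (stdJ (stdVec i)) := by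
  have hn : ∀ v, interior (-v) = -interior v := fun v => _root_.map_neg interiorLM v
  have key : ∀ {R : Type} [Ring R] [Algebra ℂ R] (c : Fin 6 → R),
      (∀ i j, c i * c j = -(c j * c i)) → lefschetzDual (annA c) (annB c) = (-(2⁻¹) : ℂ) •
        ∑ k, (c (reIdx k) * c (imIdx k) + c (imIdx k) * -c (reIdx k)) := by
    intro R _ _ c hc
    have h0 : ∀ i, c i * c i = 0 := by
      intro i
      have h2 : (2 : ℂ) • (c i * c i) = 0 := by
        rw [two_smul]; nth_rewrite 1 [hc i i]; simp
      simpa using h2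
    simp only [lefschetzDual, annA, annB, Finset.smul_sum]
    refine Finset.sum_congr rfl fun k _ => ?_
    simp only [smul_mul_assoc, mul_smul_comm, sub_mul, mul_add, mul_neg, smul_smul, h0,
      hc (imIdx k) (reIdx k), neg_neg]
    simp only [smul_sub, smul_add, smul_smul, smul_neg, smul_zero]
    have hI := Complex.I_mul_I
    have : (2 * Complex.I * (2⁻¹ * 2⁻¹) * Complex.I : ℂ) = -(2⁻¹) := by
      linear_combination (2⁻¹ : ℂ) * hI
    match_scalars <;> linear_combination hI
  rw [contraction, key ann realCAR.cc, sum_six]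
  simp only [stdJ_re, stdJ_im, hn, ann]

theorem isInvariant_contraction : IsInvariant (contraction.restrictScalars ℝ) := by
  intro A hA η
  let C : Matrix (Fin 6) (Fin 6) ℝ := Matrix.of fun j i => A (stdVec i) j
  have hC : C.transpose * C = 1 := by
    ext i j
    have := hA.1 (stdVec i) (stdVec j)
    rw [stdG_apply, show stdG (stdVec i) (stdVec j) = gram stdG stdVec i j from rfl,
      gram_stdG_stdVec] at this
    exact this
  have hC' : C * C.transpose = 1 := mul_eq_one_comm.mp hC
  have hrow : ∀ j l, ∑ i, C j i * C l i = if j = l then 1 else 0 := by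
    intro j l
    have := congrFun (congrFun hC' j) l
    rw [Matrix.one_apply] at this
    exact this
  have hA' : ∀ i, A (stdVec i) = ∑ j, C j i • stdVec j := fun i => (sum_coord_smul_stdVec _).symm
  have hs : ∀ (c : Fin 6 → ℝ) (u : Fin 6 → Model),
      interior (∑ j, c j • u j) = ∑ j, (c j : ℂ) • interior (u j) := by
    intro c u
    exact (_root_.map_sum interiorLM _ _).trans (Finset.sum_congr rfl fun j _ => interior_smul _ _)
  have h1 : ∑ i, interior (A (stdVec i)) * interior (A (stdJ (stdVec i))) =
      ∑ i, interior (stdVec i) * interior (stdJ (stdVec i)) := by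
    have e : ∀ i, interior (A (stdVec i)) * interior (A (stdJ (stdVec i))) =
        ∑ j, ∑ l, ((C j i * C l i : ℝ) : ℂ) •
          (interior (stdVec j) * interior (stdJ (stdVec l))) := by
      intro i
      rw [← hA.2, hA', _root_.map_sum]
      simp only [_root_.map_smul, hs, Finset.sum_mul, Finset.mul_sum, smul_mul_assoc,
        mul_smul_comm, Finset.smul_sum, smul_smul]
      rw [Finset.sum_comm]
      refine Finset.sum_congr rfl fun j _ => Finset.sum_congr rfl fun l _ => ?_
      rw [Complex.ofReal_mul, mul_comm]
    rw [Finset.sum_congr rfl fun i _ => e i, Finset.sum_comm]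
    refine Finset.sum_congr rfl fun j _ => ?_
    rw [Finset.sum_comm]
    have e2 : ∀ l, ∑ i, ((C j i * C l i : ℝ) : ℂ) •
        (interior (stdVec j) * interior (stdJ (stdVec l))) =
        if j = l then interior (stdVec j) * interior (stdJ (stdVec l)) else 0 := by
      intro l
      rw [← Finset.sum_smul, ← Complex.ofReal_sum, hrow]
      split_ifs
      · rw [Complex.ofReal_one, one_smul]
      · rw [Complex.ofReal_zero, zero_smul]
    rw [Finset.sum_congr rfl fun l _ => e2 l, Finset.sum_ite_eq, if_pos (Finset.mem_univ _)]
  have h2 : contraction * pull A = pull A * contraction := by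
    rw [contraction_eq, smul_mul_assoc, mul_smul_comm, Finset.sum_mul, Finset.mul_sum]
    congr 1
    have : ∀ i, interior (stdVec i) * interior (stdJ (stdVec i)) * pull A =
        pull A * (interior (A (stdVec i)) * interior (A (stdJ (stdVec i)))) := by
      intro i
      rw [mul_assoc, interior_mul_pull, ← mul_assoc, interior_mul_pull, mul_assoc]
    rw [Finset.sum_congr rfl fun i _ => this i, ← Finset.mul_sum, h1, Finset.mul_sum]
  exact congrArg (fun T : Module.End ℂ Fiber => T η) h2.symm

/-- The projection of `⨁ₖ Λ^k(ℝ⁶)` to the forms of type `(p, q)` in degree `k`. -/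
def stdType (k : ℕ) (p q : ℤ) : Module.End ℂ Fiber where
  toFun η := Pi.single k (typeProj stdJ p q (η k))
  map_add' η ξ := by
    funext m
    by_cases hm : m = k
    · subst hm
      ext v
      simp [typeProj_apply, slotInsert_apply, mul_add, Finset.sum_add_distrib]
    · simp [hm]
  map_smul' c η := by
    funext m
    by_cases hm : m = k
    · subst hm
      ext v
      simp [typeProj_apply, slotInsert_apply, Finset.mul_sum, mul_left_comm]
    · simp only [Pi.smul_apply, Pi.single_eq_of_ne hm, RingHom.id_apply]
      ext v
      simp

theorem isInvariant_stdType (k : ℕ) (p q : ℤ) :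
    IsInvariant ((stdType k p q).restrictScalars ℝ) := by
  intro A hA η
  funext m
  change (stdType k p q η m).compContinuousLinearMap A = stdType k p q (pull A η) m
  by_cases hm : m = k
  · subst hm
    simp only [stdType, LinearMap.coe_mk, AddHom.coe_mk, Pi.single_eq_same]
    exact typeProj_comp stdJ stdJ A (fun v => (hA.2 v).symm) p q (η m)
  · simp [stdType, hm]
    rfl

section

variable {M : Type*} [TopologicalSpace M] [ChartedSpace Model M] [IsManifold (𝓡 6) ∞ M]

/-- The projection of a form of mixed degree to its part of type `(p, q)` in degree `k`. -/
def typePart (H : AlmostHermitian M) (k : ℕ) (p q : ℤ) : FormOp M := fun η =>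
  Pi.single k (fun x => typeProj (H.J x) p q (η k x))

theorem represents_typePart (H : AlmostHermitian M) (k : ℕ) (p q : ℤ) :
    Represents H (typePart H k p q) ((stdType k p q).restrictScalars ℝ) := by
  intro η z F hF
  funext m
  change (value (typePart H k p q η) z m).compContinuousLinearMap F =
    stdType k p q (pull F (value η z)) m
  by_cases hm : m = k
  · subst hm
    simp only [stdType, LinearMap.coe_mk, AddHom.coe_mk, Pi.single_eq_same, typePart, value]
    exact hF.typeProj p q (η m z)
  · simp [stdType, hm, typePart, value]
    rfl

end

/-! ### Torsion of a unitary frame -/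

theorem stdG_stdJ_left (v w : Model) : stdG (stdJ v) w = -stdG v (stdJ w) := by
  have := stdG_stdJ v (stdJ w)
  rw [stdJ_stdJ, _root_.map_neg] at this
  rw [← this, neg_neg]

/-- The torsion `(X, Y) ↦ A_X Y - A_Y X` of a family of endomorphisms. -/
def torsion (A : Model → Model →L[ℝ] Model) (X Y : Model) : Model := A X Y - A Y X

/-- The part of the torsion that is antilinear in the first and linear in the second argument. -/
def torsionMixed (A : Model →ₗ[ℝ] Model →L[ℝ] Model) (X : Model) : Model →L[ℝ] Model :=
  LinearMap.toContinuousLinearMap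
  { toFun := fun Y => (4⁻¹ : ℝ) • (torsion A X Y + torsion A (stdJ X) (stdJ Y) +
      stdJ (torsion A (stdJ X) Y) - stdJ (torsion A X (stdJ Y)))
    map_add' := by
      intro Y Z
      simp only [torsion, _root_.map_add, _root_.map_sub, _root_.add_apply]
      module
    map_smul' := by
      intro c Y
      simp only [torsion, _root_.map_smul, _root_.map_sub, _root_.smul_apply, RingHom.id_apply]
      module }

/-- The correction that turns the flat connection of a unitary frame into a Hermitian connection
without torsion of mixed type. -/
def hermitianCorrection (A : Model →ₗ[ℝ] Model →L[ℝ] Model) (X : Model) : Model →L[ℝ] Model :=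
  ContinuousLinearMap.adjoint (torsionMixed A X) - torsionMixed A X

variable (A : Model →ₗ[ℝ] Model →L[ℝ] Model)

theorem torsionMixed_apply (X Y : Model) : torsionMixed A X Y =
    (4⁻¹ : ℝ) • (torsion A X Y + torsion A (stdJ X) (stdJ Y) +
      stdJ (torsion A (stdJ X) Y) - stdJ (torsion A X (stdJ Y))) := rfl

theorem torsion_neg_left (X Y : Model) : torsion A (-X) Y = -torsion A X Y := by
  simp only [torsion, _root_.map_neg, _root_.neg_apply]; abel

theorem torsion_neg_right (X Y : Model) : torsion A X (-Y) = -torsion A X Y := by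
  simp only [torsion, _root_.map_neg, _root_.neg_apply]; abel

theorem torsion_swap (A : Model → Model →L[ℝ] Model) (X Y : Model) :
    torsion A Y X = -torsion A X Y := by simp [torsion]

theorem stdG_adjoint (B : Model →L[ℝ] Model) (v w : Model) :
    stdG (ContinuousLinearMap.adjoint B v) w = stdG v (B w) :=
  ContinuousLinearMap.adjoint_inner_left B w v

theorem torsionMixed_stdJ (X Y : Model) :
    torsionMixed A X (stdJ Y) = stdJ (torsionMixed A X Y) := by
  simp only [torsionMixed_apply, stdJ_stdJ, torsion_neg_right, _root_.map_smul, _root_.map_sub,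
    _root_.map_add, _root_.map_neg]
  module

theorem isSkewHermitian_hermitianCorrection (X : Model) :
    IsSkewHermitian (hermitianCorrection A X) := by
  have hext : ∀ v w : Model, (∀ Z, stdG v Z = stdG w Z) → v = w :=
    fun v w h => ext_inner_right ℝ h
  constructor
  · intro v w
    have h1 : ∀ u v, stdG u (ContinuousLinearMap.adjoint (torsionMixed A X) v) =
        stdG (torsionMixed A X u) v := by
      intro u v; rw [stdG_symm, stdG_adjoint, stdG_symm]
    simp only [hermitianCorrection, _root_.sub_apply, _root_.map_sub, stdG_adjoint, h1]
    ring
  · intro v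
    refine hext _ _ fun Z => ?_
    simp only [hermitianCorrection, _root_.sub_apply, _root_.map_sub, stdG_adjoint,
      stdG_stdJ_left, torsionMixed_stdJ]

theorem stdG_hermitianCorrection (X Y Z : Model) : stdG (hermitianCorrection A X Y) Z =
    stdG (torsionMixed A X Z) Y - stdG (torsionMixed A X Y) Z := by
  rw [hermitianCorrection, _root_.sub_apply, _root_.map_sub, _root_.sub_apply, stdG_adjoint,
    stdG_symm Y]

/-- If `dω` is of type `(3,0) + (0,3)`, then the corrected torsion is antilinear. -/
theorem torsion_antilinear (hA : ∀ X Y Z,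
      stdG (torsion A (stdJ X) (stdJ Y)) (stdJ Z) + stdG (torsion A (stdJ Y) Z) (stdJ (stdJ X)) +
          stdG (torsion A Z (stdJ X)) (stdJ (stdJ Y)) =
        -(stdG (torsion A X Y) (stdJ Z) + stdG (torsion A Y Z) (stdJ X) +
          stdG (torsion A Z X) (stdJ Y))) (X Y : Model) :
    torsion (fun X => A X + hermitianCorrection A X) (stdJ X) Y =
      -stdJ (torsion (fun X => A X + hermitianCorrection A X) X Y) := by
  have hext : ∀ v w : Model, (∀ Z, stdG v Z = stdG w Z) → v = w :=
    fun v w h => ext_inner_right ℝ h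
  refine hext _ _ fun Z => ?_
  have e : ∀ X Y, torsion (fun X => A X + hermitianCorrection A X) X Y =
      torsion A X Y + hermitianCorrection A X Y - hermitianCorrection A Y X := by
    intro X Y; simp only [torsion, _root_.add_apply]; abel
  have hsw := torsion_swap A
  have gneg : ∀ u v, stdG (-u) v = -stdG u v := by intro u v; simp [stdG_apply]
  have gneg2 : ∀ u v, stdG u (-v) = -stdG u v := by intro u v; simp [stdG_apply]
  have gadd : ∀ u u' v, stdG (u + u') v = stdG u v + stdG u' v := by
    intro u u' v; simp [stdG_apply]
  have gsub : ∀ u u' v, stdG (u - u') v = stdG u v - stdG u' v := by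
    intro u u' v; simp [stdG_apply]
  have gsmul : ∀ (c : ℝ) u v, stdG (c • u) v = c * stdG u v := by
    intro c u v; simp [stdG_apply, Finset.mul_sum]
  rw [gneg, stdG_stdJ_left, neg_neg, e, e]
  simp only [gadd, gsub, gsmul,
    stdG_hermitianCorrection, torsionMixed_apply,
    stdG_stdJ_left, stdJ_stdJ, torsion_neg_left, torsion_neg_right, gneg, gneg2, stdJ.map_neg]
  have h := hA
  simp only [stdJ_stdJ, gneg2] at h
  have a1 := h X Y Z
  have a2 := h Y Z X
  have a3 := h Z X Y
  have a4 := h X Y (stdJ Z)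
  have a5 := h Y Z (stdJ X)
  have a6 := h Z X (stdJ Y)
  simp only [hsw X Y, hsw X Z, hsw X (stdJ Y), hsw Y (stdJ X),
    hsw Z (stdJ Y), hsw X (stdJ Z), hsw Z (stdJ X), hsw (stdJ X) (stdJ Y),
    hsw (stdJ X) (stdJ Z), stdJ_stdJ, gneg, gneg2] at a1 a2 a3 a4 a5 a6 ⊢
  linarith

section Clifford

variable {R : Type*} [Ring R] [Algebra ℂ R]

/-- The operator `½ ∑ z^l_{jk} b_j b_k α_l` of degree one attached to an array `z`. -/
def torsionOp (b α : Fin 3 → R) (z : Fin 3 → Fin 3 → Fin 3 → ℂ) : R :=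
  ∑ j, ∑ k, ∑ l, (2⁻¹ * z j k l) • (b j * b k * α l)

/-- The components of a vector-valued two-form in complex coordinates. -/
def complexComponent (u : Fin 3 → Fin 3 → Model) (j k l : Fin 3) : ℂ :=
  u j k (reIdx l) + Complex.I * u j k (imIdx l)

theorem sum_antisymm {w c : Fin 6 → R} (hw : ∀ i j, w i * w j = -(w j * w i))
    (C u : Fin 6 → Fin 6 → Fin 6 → ℂ) (hu : ∀ i m j, u i m j = C i m j - C m i j) :
    ∑ i, ∑ m, ∑ j, C i m j • (w i * w m * c j) =
      ∑ i, ∑ m, ∑ j, (2⁻¹ * u i m j) • (w i * w m * c j) := by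
  have h1 : ∑ i, ∑ m, ∑ j, C i m j • (w i * w m * c j) =
      -∑ i, ∑ m, ∑ j, C m i j • (w i * w m * c j) := by
    rw [Finset.sum_comm]
    simp only [← Finset.sum_neg_distrib]
    refine Finset.sum_congr rfl fun i _ => Finset.sum_congr rfl fun m _ =>
      Finset.sum_congr rfl fun j _ => ?_
    rw [hw m i, neg_mul, smul_neg]
  have h2 : ∑ i, ∑ m, ∑ j, (2⁻¹ * u i m j) • (w i * w m * c j) =
      (2⁻¹ : ℂ) • (∑ i, ∑ m, ∑ j, C i m j • (w i * w m * c j) -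
        ∑ i, ∑ m, ∑ j, C m i j • (w i * w m * c j)) := by
    simp only [← Finset.sum_sub_distrib, Finset.smul_sum]
    refine Finset.sum_congr rfl fun i _ => Finset.sum_congr rfl fun m _ =>
      Finset.sum_congr rfl fun j _ => ?_
    rw [hu, ← sub_smul, smul_smul]
  rw [h2, eq_neg_iff_add_eq_zero.mp h1 |> eq_neg_of_add_eq_zero_right]
  module

theorem sum_torsion {w c : Fin 6 → R} (U : Fin 6 → Fin 6 → Model)
    (h1 : ∀ a b, U (imIdx a) (reIdx b) = -stdJ (U (reIdx a) (reIdx b)))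
    (h2 : ∀ a b, U (reIdx a) (imIdx b) = -stdJ (U (reIdx a) (reIdx b)))
    (h3 : ∀ a b, U (imIdx a) (imIdx b) = -U (reIdx a) (reIdx b)) :
    ∑ i, ∑ m, ∑ j, (2⁻¹ * (U i m j : ℂ)) • (w i * w m * c j) =
      torsionOp (creB w) (annA c) (complexComponent fun a b => U (reIdx a) (reIdx b)) +
        torsionOp (creA w) (annB c) (fun a b l => starRingEnd ℂ
          (complexComponent (fun a b => U (reIdx a) (reIdx b)) a b l)) := by
  simp only [sum_six, h1, h2, h3, PiLp.neg_apply, stdJ_reIdx, stdJ_imIdx,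
    torsionOp, complexComponent, _root_.map_add, _root_.map_mul,
    Complex.conj_ofReal, Complex.conj_I]
  simp only [← Finset.sum_add_distrib]
  refine Finset.sum_congr rfl fun a _ => Finset.sum_congr rfl fun b _ =>
    Finset.sum_congr rfl fun l _ => ?_
  generalize (U (reIdx a) (reIdx b) (reIdx l) : ℝ) = x
  generalize (U (reIdx a) (reIdx b) (imIdx l) : ℝ) = y
  simp only [creA, creB, annA, annB, sub_mul, add_mul, mul_add, mul_sub, smul_mul_assoc,
    mul_smul_comm, smul_smul, smul_add, smul_sub, neg_neg, Complex.ofReal_neg]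
  have hI := Complex.I_sq
  match_scalars <;> ring_nf <;> simp only [Complex.I_sq, Complex.I_pow_four] <;> ring

end Clifford

theorem wedgeOne_coord_comp (B : Model →L[ℝ] Model) (j : Fin 6) :
    wedgeOne ((coord j).comp B) = ∑ m, (B (stdVec m) j : ℂ) • cre m := by
  have h : (coord j).comp B = ∑ m, (B (stdVec m) j : ℂ) • coord m := by
    ext v
    conv_lhs => rw [← sum_coord_smul_stdVec v]
    simp [_root_.sum_apply, mul_comm]
  rw [h]
  exact (_root_.map_sum wedgeOneLM _ _).trans (Finset.sum_congr rfl fun m _ => wedgeOne_smul _ _)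

/-- The part of the exterior derivative that is due to antilinear torsion. -/
theorem sum_cre_mul_derivation (C : Model → Model →L[ℝ] Model)
    (hC : ∀ X Y, torsion C (stdJ X) Y = -stdJ (torsion C X Y)) :
    ∃ z : Fin 3 → Fin 3 → Fin 3 → ℂ, (∀ j k l, z k j l = -z j k l) ∧
      ∑ i, cre i * derivation (C (stdVec i)) = torsionOp (creB cre) (annA ann) z +
        torsionOp (creA cre) (annB ann) fun j k l => starRingEnd ℂ (z j k l) := by
  refine ⟨complexComponent fun a b => torsion C (stdVec (reIdx a)) (stdVec (reIdx b)), ?_, ?_⟩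
  · intro j k l
    simp only [complexComponent, torsion_swap C (stdVec (reIdx j))]
    simp
    ring
  · have hC2 : ∀ X Y, torsion C X (stdJ Y) = -stdJ (torsion C X Y) := by
      intro X Y
      rw [torsion_swap, hC, torsion_swap C X Y, _root_.map_neg, neg_neg]
    rw [← sum_torsion fun i m => torsion C (stdVec i) (stdVec m)]
    · rw [← sum_antisymm realCAR.ww (fun i m j => (C (stdVec i) (stdVec m) j : ℂ))]
      · refine Finset.sum_congr rfl fun i _ => ?_
        rw [derivation, Finset.mul_sum, Finset.sum_comm]
        refine Finset.sum_congr rfl fun j _ => ?_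
        rw [wedgeOne_coord_comp, Finset.sum_mul, Finset.mul_sum]
        refine Finset.sum_congr rfl fun m _ => ?_
        rw [smul_mul_assoc, mul_smul_comm, mul_assoc]
        rfl
      · intro i m j
        simp [torsion]
    · intro a b; rw [← stdJ_re, hC]
    · intro a b; rw [← stdJ_re, hC2]
    · intro a b; rw [← stdJ_re, ← stdJ_re, hC, hC2, _root_.map_neg, stdJ_stdJ, neg_neg]

/-! ### The structure equation determines the torsion -/

section Clifford

variable {R : Type*} [Ring R] [Algebra ℂ R]

theorem torsionOp_eq_cyclic {b α : Fin 3 → R} (hb : ∀ i j, b i * b j = -(b j * b i)) {κ : ℂ}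
    {z : Fin 3 → Fin 3 → Fin 3 → ℂ}
    (hz : ∀ p q l, z p q l = κ * ((if l + 1 = p ∧ l + 2 = q then 1 else 0) -
      if l + 1 = q ∧ l + 2 = p then 1 else 0)) :
    torsionOp b α z = κ • cyclic b b α := by
  simp only [torsionOp, hz, Fin.sum_univ_three, cyclic]
  have e1 : (0 : Fin 3) + 1 = 1 := rfl
  have e2 : (0 : Fin 3) + 2 = 2 := rfl
  have e3 : (1 : Fin 3) + 1 = 2 := rfl
  have e4 : (1 : Fin 3) + 2 = 0 := rfl
  have e5 : (2 : Fin 3) + 1 = 0 := rfl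
  have e6 : (2 : Fin 3) + 2 = 1 := rfl
  simp only [e1, e2, e3, e4, e5, e6]
  simp [hb 1 0, hb 2 1, hb 0 2]
  module

end Clifford

section Fock

variable {E : Type*} [AddCommGroup E] [Module ℂ E] {a b α β : Fin 3 → Module.End ℂ E}

theorem torsionOp_apply (z : Fin 3 → Fin 3 → Fin 3 → ℂ) (v : E) :
    torsionOp b α z v = ∑ j, ∑ k, ∑ l, (2⁻¹ * z j k l) • b j (b k (α l v)) := by
  simp only [torsionOp, LinearMap.sum_apply, LinearMap.smul_apply, Module.End.mul_apply]

namespace CAR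

variable (h : CAR a b α β)
include h

theorem β_b_apply (p q : Fin 3) (v : E) : β p (b q v) = (if p = q then v else 0) - b q (β p v) := by
  have := LinearMap.congr_fun (h.βb p q) v
  refine this.trans ?_
  split_ifs <;> rfl

theorem α_a_apply (p q : Fin 3) (v : E) : α p (a q v) = (if p = q then v else 0) - a q (α p v) :=
  h.symm.β_b_apply p q v

theorem β_a_apply (p q : Fin 3) (v : E) : β p (a q v) = -a q (β p v) :=
  LinearMap.congr_fun (h.βa p q) v

theorem β_α_apply (p q : Fin 3) (v : E) : β p (α q v) = -α q (β p v) :=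
  LinearMap.congr_fun (h.symm.αβ p q) v

theorem α_α_apply (p q : Fin 3) (v : E) : α p (α q v) = -α q (α p v) :=
  LinearMap.congr_fun (h.αα p q) v

theorem α_α_self_apply (p : Fin 3) (v : E) : α p (α p v) = 0 := by
  have h2 : (2 : ℂ) • α p (α p v) = 0 := by
    rw [two_smul]; nth_rewrite 1 [h.α_α_apply]; simp
  simpa using h2

theorem a_b_apply (p q : Fin 3) (v : E) : a p (b q v) = -b q (a p v) :=
  LinearMap.congr_fun (h.ab p q) v

theorem a_a_apply (p q : Fin 3) (v : E) : a p (a q v) = -a q (a p v) :=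
  LinearMap.congr_fun (h.aa p q) v

theorem β_lefschetz_apply (p : Fin 3) (v : E) : β p (∑ k, a k (b k v)) =
    ∑ k, a k (b k (β p v)) - a p v := by
  simp only [_root_.map_sum, h.β_a_apply, h.β_b_apply, _root_.map_sub, neg_sub,
    Finset.sum_sub_distrib]
  congr 1
  rw [Finset.sum_eq_single p]
  · rw [if_pos rfl]
  · intro k _ hk
    rw [if_neg hk.symm, _root_.map_zero]
  · simp

theorem lefschetz_a_apply (p : Fin 3) (v : E) :
    ∑ k, a k (b k (a p v)) = a p (∑ k, a k (b k v)) := by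
  rw [_root_.map_sum]
  refine Finset.sum_congr rfl fun k _ => ?_
  rw [h.a_a_apply p k, h.a_b_apply p k, _root_.map_neg, neg_neg]

/-- Suppose that the torsion `z` occurs in the exterior derivative of a `(3,0)`-form `Φ` as
`dΦ = ∑ dz_i ∧ Ψ_i + ∑ dz̄_i ∧ Ψ'_i + N̄ Φ` with forms `Ψ_i`, `Ψ'_i` of type `(3,0)`, and that `dΦ`
is a multiple of `ω²`, where `ω = c ∑ dz_k ∧ dz̄_k`. Contracting with `∂/∂z̄_q`, `∂/∂z̄_p` and two
of the `∂/∂z_k` one sees that `z` is totally antisymmetric. -/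
theorem torsion_of_structure_equation {Φ one : E} {Ψ Ψ' : Fin 3 → E}
    {z z' : Fin 3 → Fin 3 → Fin 3 → ℂ} (hz : ∀ j k l, z k j l = -z j k l) {μ t : ℂ}
    (hΦ : ∀ k, β k Φ = 0) (hΨ : ∀ i k, β k (Ψ i) = 0) (hΨ' : ∀ i k, β k (Ψ' i) = 0) (ht : t ≠ 0)
    (hα1 : ∀ k, α k one = 0) (hβ1 : ∀ k, β k one = 0) (hone : one ≠ 0)
    (hΦt : α 2 (α 1 (α 0 Φ)) = t • one)
    (heq : ∑ i, (a i (Ψ i) + b i (Ψ' i)) + (torsionOp b α z + torsionOp a β z') Φ =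
      μ • ∑ k, a k (b k (∑ k, a k (b k one)))) :
    ∃ κ : ℂ, ∀ p q l, z p q l = κ * ((if l + 1 = p ∧ l + 2 = q then 1 else 0) -
      if l + 1 = q ∧ l + 2 = p then 1 else 0) := by
  have hl : ∀ p l, β p (α l Φ) = 0 := by
    intro p l; rw [h.β_α_apply, hΦ, _root_.map_zero, neg_zero]
  have hif : ∀ (c : Prop) [Decidable c] (X : Module.End ℂ E) (v : E),
      X (if c then v else 0) = if c then X v else 0 := by
    intro c _ X v; split_ifs <;> simp
  have h1 : ∀ p q i, β q (β p (a i (Ψ i))) = 0 := by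
    intro p q i
    rw [h.β_a_apply, hΨ, _root_.map_zero, neg_zero, _root_.map_zero]
  have h1' : ∀ p q i, β q (β p (b i (Ψ' i))) = 0 := by
    intro p q i
    rw [h.β_b_apply, hΨ', _root_.map_zero, sub_zero, hif, hΨ']
    simp
  have h2 : ∀ p q j k l, β q (β p (b j (b k (α l Φ)))) =
      (if p = j then if q = k then α l Φ else 0 else 0) -
        if q = j then if p = k then α l Φ else 0 else 0 := by
    intro p q j k l
    simp only [h.β_b_apply, _root_.map_sub, hl, _root_.map_zero, sub_zero, hif]
    congr 1
    split_ifs <;> rfl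
  have h3 : ∀ p q, β q (β p (∑ k, a k (b k (∑ k, a k (b k one))))) =
      -(2 : ℂ) • a p (a q one) := by
    intro p q
    rw [h.β_lefschetz_apply, h.β_lefschetz_apply, hβ1]
    simp only [_root_.map_zero, Finset.sum_const_zero, zero_sub, _root_.map_neg,
      Finset.sum_neg_distrib, _root_.map_sub, h.lefschetz_a_apply, h.β_a_apply,
      h.β_lefschetz_apply, hβ1]
    module
  have key : ∀ p q, ∑ l, z p q l • α l Φ = (-2 * μ) • a p (a q one) := by
    intro p q
    have h4 := congrArg (fun v => β q (β p v)) heq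
    simp only [_root_.map_add, _root_.map_sum (β p), _root_.map_sum (β q), _root_.map_smul,
      LinearMap.add_apply, torsionOp_apply, h1, h1', h2,
      hΦ, _root_.map_zero, smul_zero, Finset.sum_const_zero, zero_add, add_zero] at h4
    have h5 := h3 p q
    simp only [_root_.map_sum (β p), _root_.map_sum (β q)] at h5
    rw [h5, smul_smul] at h4
    rw [show -2 * μ = μ * -2 by ring, ← h4]
    have e1 : ∀ j k l, (2⁻¹ * z j k l) • ((if p = j then if q = k then α l Φ else 0 else 0) -
        if q = j then if p = k then α l Φ else 0 else 0) =
        (if p = j then if q = k then (2⁻¹ * z p q l) • α l Φ else 0 else 0) +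
        if q = j then if p = k then (2⁻¹ * z p q l) • α l Φ else 0 else 0 := by
      intro j k l
      have e2 : (2⁻¹ * z q p l) • α l Φ = -((2⁻¹ * z p q l) • α l Φ) := by rw [hz p q l]; module
      rw [smul_sub, sub_eq_add_neg]
      congr 1
      · split_ifs with h1 h2
        · rw [h1, h2]
        · exact smul_zero _
        · exact smul_zero _
      · split_ifs with h1 h2
        · rw [← h1, ← h2, e2, neg_neg]
        · rw [smul_zero, neg_zero]
        · rw [smul_zero, neg_zero]
    simp only [e1]
    have e3 : ∀ j k, (∑ l, ((if p = j then if q = k then (2⁻¹ * z p q l) • α l Φ else 0 else 0) +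
        if q = j then if p = k then (2⁻¹ * z p q l) • α l Φ else 0 else 0)) =
        (if p = j then if q = k then ∑ l, (2⁻¹ * z p q l) • α l Φ else 0 else 0) +
        if q = j then if p = k then ∑ l, (2⁻¹ * z p q l) • α l Φ else 0 else 0 := by
      intro j k
      rw [Finset.sum_add_distrib]
      congr 1 <;> split_ifs <;> simp
    have e4 : ∀ (i j : Fin 3) (x : E), ∑ k, ∑ m,
        (if i = k then if j = m then x else 0 else 0) = x := by
      intro i j x; simp
    simp only [e3, Finset.sum_add_distrib, e4]
    rw [← Finset.sum_add_distrib]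
    refine Finset.sum_congr rfl fun l _ => ?_
    module
  have h6 : ∀ p q r s, α s (α r (a p (a q one))) =
      ((if r = p then if s = q then 1 else 0 else 0) -
        if s = p then if r = q then 1 else 0 else 0 : ℂ) • one := by
    intro p q r s
    simp only [h.α_a_apply, _root_.map_sub, hα1, _root_.map_zero, sub_zero, hif, sub_smul]
    congr 1 <;> split_ifs <;> simp
  have h7 : ∀ p q r s, ∑ l, z p q l • α s (α r (α l Φ)) =
      (-2 * μ) • ((if r = p then if s = q then 1 else 0 else 0) -
        if s = p then if r = q then 1 else 0 else 0 : ℂ) • one := by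
    intro p q r s
    have := congrArg (fun v => α s (α r v)) (key p q)
    simp only [_root_.map_sum, _root_.map_smul] at this
    rw [this, h6]
  have t1 : α 0 (α 2 (α 1 Φ)) = t • one := by
    rw [h.α_α_apply 0 2, h.α_α_apply 0 1, _root_.map_neg, neg_neg, hΦt]
  have t2 : α 1 (α 0 (α 2 Φ)) = t • one := by
    rw [h.α_α_apply 0 2, _root_.map_neg, h.α_α_apply 1 2, neg_neg, hΦt]
  refine ⟨-2 * μ / t, fun p q l => ?_⟩
  have h8 : z p q l • t • one = (-2 * μ) • ((if l + 1 = p then if l + 2 = q then 1 else 0 else 0) -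
        if l + 2 = p then if l + 1 = q then 1 else 0 else 0 : ℂ) • one := by
    rw [← h7, Fin.sum_univ_three]
    fin_cases l
    · change _ = z p q 0 • α 2 (α 1 (α 0 Φ)) + z p q 1 • α 2 (α 1 (α 1 Φ)) +
        z p q 2 • α 2 (α 1 (α 2 Φ))
      rw [hΦt, h.α_α_self_apply 1, h.α_α_apply 1 2, _root_.map_neg, h.α_α_self_apply]
      simp
    · change _ = z p q 0 • α 0 (α 2 (α 0 Φ)) + z p q 1 • α 0 (α 2 (α 1 Φ)) +
        z p q 2 • α 0 (α 2 (α 2 Φ))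
      rw [t1, h.α_α_self_apply 2, h.α_α_apply 2 0, _root_.map_neg, h.α_α_self_apply]
      simp
    · change _ = z p q 0 • α 1 (α 0 (α 0 Φ)) + z p q 1 • α 1 (α 0 (α 1 Φ)) +
        z p q 2 • α 1 (α 0 (α 2 Φ))
      rw [t2, h.α_α_self_apply 0, h.α_α_apply 0 1, _root_.map_neg, h.α_α_self_apply]
      simp
  rw [smul_smul, smul_smul] at h8
  have h9 := smul_left_injective ℂ hone h8
  rw [div_mul_eq_mul_div, eq_div_iff ht]
  refine h9.trans ?_
  have hc : (l + 1 = q ∧ l + 2 = p) ↔ (l + 2 = p ∧ l + 1 = q) := and_comm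
  simp only [hc, ite_and]

end CAR
end Fock

/-! ### Weights of the creation and annihilation operators -/

/-- The operator `O` raises weights by `w`. -/
def HasShift (w : ℤ) (O : Module.End ℂ Fiber) : Prop :=
  ∀ (ζ : Circle) (η : Fiber), rot ζ (O η) = ((ζ : ℂ) ^ w) • O (rot ζ η)

theorem HasShift.hasWeight {w w' : ℤ} {O : Module.End ℂ Fiber} (hO : HasShift w O) {η : Fiber}
    (hη : HasWeight w' η) : HasWeight (w + w') (O η) := by
  intro ζ
  rw [hO, hη, _root_.map_smul, smul_smul, zpow_add₀ ζ.coe_ne_zero]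

theorem HasShift.mul {w w' : ℤ} {O O' : Module.End ℂ Fiber} (hO : HasShift w O)
    (hO' : HasShift w' O') : HasShift (w + w') (O * O') := by
  intro ζ η
  rw [Module.End.mul_apply, hO, hO', _root_.map_smul, smul_smul, zpow_add₀ ζ.coe_ne_zero]
  rfl

theorem HasShift.add {w : ℤ} {O O' : Module.End ℂ Fiber} (hO : HasShift w O)
    (hO' : HasShift w O') : HasShift w (O + O') := by
  intro ζ η
  rw [LinearMap.add_apply, LinearMap.add_apply, _root_.map_add, hO, hO', smul_add]

theorem HasShift.smul {w : ℤ} {O : Module.End ℂ Fiber} (c : ℂ) (hO : HasShift w O) :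
    HasShift w (c • O) := by
  intro ζ η
  rw [LinearMap.smul_apply, LinearMap.smul_apply, _root_.map_smul, hO, smul_comm]

theorem rotMap_re (ζ : ℂ) (k : Fin 3) : rotMap ζ (stdVec (reIdx k)) =
    ζ.re • stdVec (reIdx k) + ζ.im • stdVec (imIdx k) := by rw [rotMap_apply, stdJ_re]

theorem rotMap_im (ζ : ℂ) (k : Fin 3) : rotMap ζ (stdVec (imIdx k)) =
    ζ.re • stdVec (imIdx k) + (-ζ.im) • stdVec (reIdx k) := by
  rw [rotMap_apply, stdJ_im, smul_neg, neg_smul]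

theorem ann_rot (i : Fin 6) (ζ : Circle) (η : Fiber) :
    ann i (rot ζ η) = rot ζ (interior (rotMap ζ (stdVec i)) η) :=
  LinearMap.congr_fun (interior_mul_pull (rotMap ζ) (stdVec i)) η

theorem interior_comb (x y : ℝ) (i j : Fin 6) (η : Fiber) :
    interior (x • stdVec i + y • stdVec j) η = (x : ℂ) • ann i η + (y : ℂ) • ann j η := by
  rw [interior_add, interior_smul, interior_smul]
  rfl

theorem coe_circle_inv (ζ : Circle) : (ζ : ℂ)⁻¹ = (ζ : ℂ).re - (ζ : ℂ).im * Complex.I := by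
  rw [← Circle.coe_inv, Circle.coe_inv_eq_conj]
  apply Complex.ext <;> simp

theorem hasShift_annA (k : Fin 3) : HasShift (-1) (annA ann k) := by
  intro ζ η
  have e : ∀ v, annA ann k v =
    (2⁻¹ : ℂ) • (ann (reIdx k) v - Complex.I • ann (imIdx k) v) := fun v => rfl
  have h : annA ann k (rot ζ η) = (ζ : ℂ) • rot ζ (annA ann k η) := by
    rw [e, ann_rot, ann_rot, e, rotMap_re, rotMap_im, interior_comb,
      interior_comb]
    have hz := (Complex.re_add_im (ζ : ℂ)).symm
    simp only [_root_.map_smul, _root_.map_add, _root_.map_sub]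
    have hI := Complex.I_mul_I
    push_cast
    match_scalars
    · linear_combination (-2⁻¹ : ℂ) * hz
    · linear_combination (2⁻¹ * Complex.I) * hz + (2⁻¹ * (ζ : ℂ).im) * hI
  rw [h, smul_smul, zpow_neg_one, inv_mul_cancel₀ ζ.coe_ne_zero, one_smul]

theorem hasShift_annB (k : Fin 3) : HasShift 1 (annB ann k) := by
  intro ζ η
  have e : ∀ v, annB ann k v =
    (2⁻¹ : ℂ) • (ann (reIdx k) v + Complex.I • ann (imIdx k) v) := fun v => rfl
  have h : annB ann k (rot ζ η) = (ζ : ℂ)⁻¹ • rot ζ (annB ann k η) := by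
    rw [e, ann_rot, ann_rot, e, rotMap_re, rotMap_im, interior_comb,
      interior_comb, coe_circle_inv]
    simp only [_root_.map_smul, _root_.map_add]
    have hI := Complex.I_mul_I
    push_cast
    match_scalars
    · ring
    · linear_combination (2⁻¹ * (ζ : ℂ).im) * hI
  rw [h, smul_smul, zpow_one, mul_inv_cancel₀ ζ.coe_ne_zero, one_smul]

theorem hasShift_wedgeOne {w : ℤ} {θ : Model →L[ℝ] ℂ}
    (h : ∀ (ζ : Circle) v, θ (rotMap ζ v) = (ζ : ℂ) ^ w * θ v) : HasShift w (wedgeOne θ) :=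
  fun ζ η => LinearMap.congr_fun (rot_mul_wedgeOne h ζ) η

theorem hasShift_creA (k : Fin 3) : HasShift 1 (creA cre k) := by
  have e : creA cre k = wedgeOne (coord (reIdx k) + Complex.I • coord (imIdx k)) := by
    rw [wedgeOne_add, wedgeOne_smul]; rfl
  rw [e]
  refine hasShift_wedgeOne fun ζ v => ?_
  have hI := Complex.I_mul_I
  rw [zpow_one]
  nth_rewrite 2 [← Complex.re_add_im (ζ : ℂ)]
  simp only [rotMap_apply, _root_.add_apply, _root_.smul_apply, coord_apply, PiLp.add_apply,
    PiLp.smul_apply, smul_eq_mul, stdJ_reIdx, stdJ_imIdx]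
  push_cast
  linear_combination (-((ζ : ℂ).im * (v (imIdx k) : ℂ))) * hI

theorem hasShift_creB (k : Fin 3) : HasShift (-1) (creB cre k) := by
  have e : creB cre k = wedgeOne (coord (reIdx k) + (-Complex.I) • coord (imIdx k)) := by
    rw [wedgeOne_add, wedgeOne_smul]
    change cre (reIdx k) - Complex.I • cre (imIdx k) =
      cre (reIdx k) + (-Complex.I) • cre (imIdx k)
    module
  rw [e]
  refine hasShift_wedgeOne fun ζ v => ?_
  have hI := Complex.I_mul_I
  rw [zpow_neg_one, coe_circle_inv]
  simp only [rotMap_apply, _root_.add_apply, _root_.smul_apply, coord_apply, PiLp.add_apply,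
    PiLp.smul_apply, smul_eq_mul, stdJ_reIdx, stdJ_imIdx]
  push_cast
  linear_combination (-((ζ : ℂ).im * (v (imIdx k) : ℂ))) * hI

theorem HasShift.cyclic {w w' : ℤ} {x y : Fin 3 → Module.End ℂ Fiber} (hx : ∀ k, HasShift w (x k))
    (hy : ∀ k, HasShift w' (y k)) : HasShift (w + w + w') (cyclic x x y) :=
  ((((hx 0).mul (hx 1)).mul (hy 2)).add (((hx 1).mul (hx 2)).mul (hy 0))).add
    (((hx 2).mul (hx 0)).mul (hy 1))

theorem HasWeight.eq_zero_of_lt {w : ℤ} {η : Fiber} (h : HasWeight w η) {k : ℕ} (hk : (k : ℤ) < w) :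
    η k = 0 := by
  rw [← sum_typeProj_eq (η k)]
  refine Finset.sum_eq_zero fun p hp => ?_
  have hp' : p ≤ k := Nat.lt_succ_iff.mp (Finset.mem_range.mp hp)
  rw [typeProj_of_hasWeight h (by omega), if_neg (by omega)]

theorem hasWeight_stdType (k p : ℕ) (hp : p ≤ k) (η : Fiber) :
    HasWeight (2 * (p : ℤ) - k) (stdType k p ((k : ℤ) - p) η) := hasWeight_typeProj p hp (η k)

theorem stdType_apply_of_ne {k m : ℕ} (h : m ≠ k) (p q : ℤ) (η : Fiber) :
    stdType k p q η m = 0 := by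
  exact Pi.single_eq_of_ne h _

theorem stdType_apply_self (k : ℕ) (p q : ℤ) (η : Fiber) :
    stdType k p q η k = typeProj stdJ p q (η k) := by
  exact Pi.single_eq_same _ _

/-- Forms of type `(3,0)` are annihilated by the contractions with `∂/∂z̄_k`. -/
theorem annB_stdType (l : Fin 3) (η : Fiber) : annB ann l (stdType 3 3 0 η) = 0 := by
  have hw : HasWeight 3 (stdType 3 3 0 η) := hasWeight_stdType 3 3 le_rfl η
  have hw2 := (hasShift_annB l).hasWeight hw
  funext m
  by_cases hm : m = 2
  · subst hm
    exact hw2.eq_zero_of_lt (by norm_num)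
  · have h0 : stdType 3 3 0 η (m + 1) = 0 := stdType_apply_of_ne (by omega) _ _ _
    ext v
    change (2⁻¹ : ℂ) • (stdType 3 3 0 η (m + 1) _ + Complex.I • stdType 3 3 0 η (m + 1) _) = 0
    rw [h0]
    simp

/-! ### Linearity of the exterior derivative -/

section

variable {M : Type*} [TopologicalSpace M] [ChartedSpace Model M]

theorem IsSmooth.differentiableAt {k : ℕ} {η : Form M k} (hη : IsSmooth η) (x : M) :
    DifferentiableAt ℝ (inChart x η) (extChartAt (𝓡 6) x x) :=
  ((hη x).contDiffAt ((isOpen_extChartAt_target x).mem_nhds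
    (mem_extChartAt_target (I := 𝓡 6) x))).differentiableAt (by simp)

theorem inChart_add {k : ℕ} (η ξ : Form M k) (x : M) :
    inChart x (η + ξ) = inChart x η + inChart x ξ := rfl

theorem inChart_smul {k : ℕ} (c : ℂ) (η : Form M k) (x : M) :
    inChart x (c • η) = c • inChart x η := rfl

theorem IsSmooth.add {k : ℕ} {η ξ : Form M k} (hη : IsSmooth η) (hξ : IsSmooth ξ) :
    IsSmooth (η + ξ) := fun x => (hη x).add (hξ x)

theorem IsSmooth.smul {k : ℕ} (c : ℂ) {η : Form M k} (hη : IsSmooth η) : IsSmooth (c • η) := by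
  intro x
  refine contDiffOn_form fun v => ?_
  have := contDiffOn_form_apply (hη x) (v := fun _ => v) (fun i => contDiffOn_const)
  exact contDiffOn_const.mul this

theorem isSmooth_zero (k : ℕ) : IsSmooth (0 : Form M k) := fun _ => contDiffOn_const (c := 0)

theorem extD_add {k : ℕ} {η ξ : Form M k} (hη : IsSmooth η) (hξ : IsSmooth ξ) :
    extD (η + ξ) = extD η + extD ξ := by
  funext x
  rw [extD, inChart_add, extDeriv_add (hη.differentiableAt x) (hξ.differentiableAt x)]
  rfl

theorem extD_smul {k : ℕ} (c : ℂ) {η : Form M k} (hη : IsSmooth η) :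
    extD (c • η) = c • extD η := by
  funext x
  have h1 : extDeriv (c • inChart x η) (extChartAt (𝓡 6) x x) =
      c • extDeriv (inChart x η) (extChartAt (𝓡 6) x x) := by
    ext v
    have hd := hη.differentiableAt x
    rw [← inChart_smul, ContinuousAlternatingMap.smul_apply,
      extDeriv_apply ((hη.smul c).differentiableAt x),
      extDeriv_apply hd, Finset.smul_sum]
    refine Finset.sum_congr rfl fun i _ => ?_
    have hd' : DifferentiableAt ℝ (fun y => inChart x η y (i.removeNth v))
        (extChartAt (𝓡 6) x x) := hd.continuousAlternatingMap_apply_const _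
    have : (fun y => inChart x (c • η) y (i.removeNth v)) =
      fun y => c * inChart x η y (i.removeNth v) := rfl
    rw [this, fderiv_const_mul hd']
    simp only [_root_.smul_apply, smul_eq_mul, zsmul_eq_mul]
    ring
  rw [extD, inChart_smul, h1]
  rfl

theorem extD_zero (k : ℕ) : extD (0 : Form M k) = 0 := by
  have h := extD_smul 0 (isSmooth_zero (M := M) k)
  have h0 : (0 : ℂ) • (0 : Form M k) = 0 := by funext x; ext v; simp
  rw [h0] at h
  rw [h]
  funext x
  ext v
  simp

theorem isSmooth_compCLM {k : ℕ} {η : Form M k} (hη : IsSmooth η) (L : ℂ →L[ℝ] ℂ) :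
    IsSmooth (fun x => L.compContinuousAlternatingMap (η x)) := by
  intro x
  refine contDiffOn_form fun v => ?_
  have := contDiffOn_form_apply (hη x) (v := fun _ => v) (fun i => contDiffOn_const)
  exact L.contDiff.comp_contDiffOn this

/-- A homogeneous form, as a form of mixed degree. -/
def single (k : ℕ) (η : Form M k) : MixedForm M := Pi.single k η

theorem isSmoothMixed_single {k : ℕ} {η : Form M k} (hη : IsSmooth η) :
    IsSmoothMixed (single k η) := by
  intro m
  by_cases hm : m = k
  · subst hm
    rw [single, Pi.single_eq_same]
    exact hη
  · rw [single, Pi.single_eq_of_ne hm]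
    exact isSmooth_zero m

theorem deRham_single {k : ℕ} (η : Form M k) : deRham (single k η) = single (k + 1) (extD η) := by
  funext m
  rcases m with _ | m
  · exact (Pi.single_eq_of_ne (by omega) _).symm
  · change extD (single k η m) = _
    by_cases hm : m = k
    · subst hm
      rw [single, single, Pi.single_eq_same, Pi.single_eq_same]
    · rw [single, single, Pi.single_eq_of_ne hm, Pi.single_eq_of_ne (by omega), extD_zero]

theorem pull_single {k : ℕ} (A : Model →L[ℝ] Model) (η : Form M k) (z : M) :
    pull A (value (single k η) z) = Pi.single k (ContinuousAlternatingMap.compContinuousLinearMap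
      (η z) (A : Model →L[ℝ] TangentSpace (𝓡 6) z)) := by
  funext m
  change ContinuousAlternatingMap.compContinuousLinearMap (single k η m z)
    (A : Model →L[ℝ] TangentSpace (𝓡 6) z) = _
  by_cases hm : m = k
  · subst hm
    rw [single, Pi.single_eq_same, Pi.single_eq_same]
  · rw [single, Pi.single_eq_of_ne hm, Pi.single_eq_of_ne hm]
    rfl

end

/-! ### The structure equations in a unitary frame -/

section

variable {M : Type*} [TopologicalSpace M] [ChartedSpace Model M] [IsManifold (𝓡 6) ∞ M]
  {x₀ : M} {W : Set Model} {P Q : Model → Model →L[ℝ] Model} {y : Model}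

theorem IsUnitaryFrame.frameRep_omega {H : AlmostHermitian M} (hP : IsUnitaryFrame H x₀ W P Q)
    (hy : y ∈ W) : frameRep (single 2 H.omega) x₀ P y = Pi.single 2 stdOmega := by
  rw [frameRep_eq, pull_single]
  congr 1
  exact (hP.unitary y hy).omega

theorem isSmooth_omega (H : AlmostHermitian M) : IsSmooth H.omega := by
  have : IsSmoothMixed (single 2 H.omega) :=
    isSmoothMixed_of_frameRep H fun x₀ W P Q hP k =>
      contDiffOn_const.congr fun y hy => congrFun (hP.frameRep_omega hy) k
  have h := this 2
  rwa [single, Pi.single_eq_same] at h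

/-- The connection form of the flat connection of a frame. -/
def frameConnection (P Q : Model → Model →L[ℝ] Model) (y : Model) :
    Model →ₗ[ℝ] Model →L[ℝ] Model where
  toFun u := (fderiv ℝ Q y (P y u)).comp (P y)
  map_add' u v := by ext; simp
  map_smul' c u := by ext; simp

theorem derivation_stdOmega (B : Model →L[ℝ] Model) (v : Fin 2 → Model) :
    derivation B (Pi.single 2 stdOmega) 2 v =
      ((stdG (stdJ (B (v 0))) (v 1) + stdG (stdJ (v 0)) (B (v 1)) : ℝ) : ℂ) := by
  have h : ∀ u : Fin 2 → Model, (Pi.single 2 stdOmega : Fiber) 2 u =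
      ((stdG (stdJ (u 0)) (u 1) : ℝ) : ℂ) := by
    intro u; rw [Pi.single_eq_same]; rfl
  rw [derivation_apply, Fin.sum_univ_two, h, h]
  simp

/-- The exterior derivative of the Hermitian form in terms of the torsion. -/
theorem IsUnitaryFrame.extD_omega {H : AlmostHermitian M} (hP : IsUnitaryFrame H x₀ W P Q)
    (hy : y ∈ W) (X Y Z : Model) :
    frameRep (deRham (single 2 H.omega)) x₀ P y 3 ![X, Y, Z] =
      ((-(stdG (torsion (frameConnection P Q y) X Y) (stdJ Z) +
        stdG (torsion (frameConnection P Q y) Y Z) (stdJ X) +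
        stdG (torsion (frameConnection P Q y) Z X) (stdJ Y)) : ℝ) : ℂ) := by
  have h0 : ∀ v, dirDeriv (frameRep (single 2 H.omega) x₀ P) y v = 0 := by
    intro v
    funext k
    have : (fun z => frameRep (single 2 H.omega) x₀ P z k) =ᶠ[nhds y]
        fun _ => (Pi.single 2 stdOmega : Fiber) k :=
      Filter.eventuallyEq_of_mem (hP.isOpen.mem_nhds hy)
        fun z hz => congrFun (hP.frameRep_omega hz) k
    rw [dirDeriv, this.fderiv_eq, fderiv_const_apply]
    rfl
  rw [hP.frameRep_deRham (isSmoothMixed_single (isSmooth_omega H)) hy, hP.frameRep_omega hy]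
  simp only [h0, zero_add, Finset.sum_apply, ContinuousAlternatingMap.sum_apply, cre,
    wedgeOne_apply, derivation_stdOmega, coord_apply]
  have hA : ∀ u, ∑ i, u i • frameConnection P Q y (stdVec i) = frameConnection P Q y u := by
    intro u
    conv_rhs => rw [← sum_coord_smul_stdVec u]
    simp
  have key : ∀ u v w : Model, ∑ i, (u i : ℂ) *
      ((stdG (stdJ (frameConnection P Q y (stdVec i) v)) w +
        stdG (stdJ v) (frameConnection P Q y (stdVec i) w) : ℝ) : ℂ) =
      ((stdG (stdJ (frameConnection P Q y u v)) w +
        stdG (stdJ v) (frameConnection P Q y u w) : ℝ) : ℂ) := by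
    intro u v w
    simp only [← Complex.ofReal_mul, ← Complex.ofReal_sum]
    congr 1
    rw [← hA u]
    simp only [_root_.sum_apply, _root_.smul_apply, _root_.map_sum, _root_.map_smul, smul_eq_mul,
      mul_add, Finset.sum_add_distrib]
  rw [Finset.sum_comm, Fin.sum_univ_three]
  simp only [← Finset.mul_sum]
  change _ * ∑ i, (X i : ℂ) * (((stdG (stdJ (frameConnection P Q y (stdVec i) Y))) Z +
      stdG (stdJ Y) (frameConnection P Q y (stdVec i) Z) : ℝ) : ℂ) +
    _ * ∑ i, (Y i : ℂ) * (((stdG (stdJ (frameConnection P Q y (stdVec i) X))) Z +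
      stdG (stdJ X) (frameConnection P Q y (stdVec i) Z) : ℝ) : ℂ) +
    _ * ∑ i, (Z i : ℂ) * (((stdG (stdJ (frameConnection P Q y (stdVec i) X))) Y +
      stdG (stdJ X) (frameConnection P Q y (stdVec i) Y) : ℝ) : ℂ) = _
  rw [key, key, key]
  have s : ∀ u v, stdG (stdJ u) v = -stdG (stdJ v) u := by
    intro u v; rw [stdG_stdJ_left, stdG_symm]
  have gsub : ∀ u u' v, stdG (u - u') v = stdG u v - stdG u' v := by
    intro u u' v; simp [stdG_apply]
  have s' : ∀ u v, stdG u (stdJ v) = stdG (stdJ v) u := fun u v => stdG_symm _ _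
  simp only [torsion, gsub, s']
  rw [s _ Z, s _ Z, s _ Y]
  simp
  ring

end

/-! ### The Hermitian connection -/

/-- The covariant derivative in the direction of the `i`-th vector of the frame `P`, for the
connection whose connection form has the values `-B i`. -/
def covDeriv (P : Model → Model →L[ℝ] Model) (B : Fin 6 → Model →L[ℝ] Model) (y : Model) (i : Fin 6)
    (f : Model → Fiber) : Fiber :=
  dirDeriv f y (P y (stdVec i)) - derivation (B i) (f y)

section

variable {P : Model → Model →L[ℝ] Model} {B : Fin 6 → Model →L[ℝ] Model} {W : Set Model}
  {y : Model} {f g : Model → Fiber}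

theorem covDeriv_congr (hW : IsOpen W) (hy : y ∈ W) (h : ∀ z ∈ W, f z = g z) (i : Fin 6) :
    covDeriv P B y i f = covDeriv P B y i g := by
  have : dirDeriv f y (P y (stdVec i)) = dirDeriv g y (P y (stdVec i)) := by
    funext k
    have h1 : (fun z => f z k) =ᶠ[nhds y] fun z => g z k :=
      Filter.eventuallyEq_of_mem (hW.mem_nhds hy) fun z hz => congrFun (h z hz) k
    rw [dirDeriv, dirDeriv, h1.fderiv_eq]
  rw [covDeriv, covDeriv, this, h y hy]

/-- Covariant derivatives commute with invariant operators. -/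
theorem covDeriv_map (hB : ∀ i, IsSkewHermitian (B i)) (hW : IsOpen W) (hy : y ∈ W)
    (hf : SmoothOn f W) {O : Fiber →ₗ[ℝ] Fiber} (hO : IsInvariant O) (i : Fin 6) :
    covDeriv P B y i (fun z => O (f z)) = O (covDeriv P B y i f) := by
  rw [covDeriv, covDeriv, dirDeriv_map fun k => hf.differentiableAt hW hy k, hO.derivation (hB i),
    _root_.map_sub]

theorem isInvariant_smul (c : ℂ) :
    IsInvariant ((LinearMap.lsmul ℂ Fiber c).restrictScalars ℝ) :=
  fun A _ η => _root_.map_smul (pull A) c η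

end

/-- A first-order operator of the form `∑ e^i ∧ D_i`, written in complex coordinates. -/
theorem sum_cre_eq (D : Fin 6 → Fiber) : ∑ i, cre i (D i) =
    ∑ k, (creA cre k ((2⁻¹ : ℂ) • (D (reIdx k) - Complex.I • D (imIdx k))) +
      creB cre k ((2⁻¹ : ℂ) • (D (reIdx k) + Complex.I • D (imIdx k)))) := by
  rw [sum_six]
  refine Finset.sum_congr rfl fun k _ => ?_
  have e1 : cre (reIdx k) = (2⁻¹ : ℂ) • (creA cre k + creB cre k) := cre_re cre k
  have e2 : cre (imIdx k) = (-(2⁻¹ * Complex.I) : ℂ) • (creA cre k - creB cre k) := cre_im cre k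
  rw [e1, e2]
  simp only [LinearMap.smul_apply, LinearMap.add_apply, LinearMap.sub_apply, _root_.map_smul,
    _root_.map_add, _root_.map_sub]
  module

theorem eq_I_smul {E : Type*} [AddCommGroup E] [Module ℂ E] {x y : E}
    (h : (2⁻¹ : ℂ) • (x + Complex.I • y) = 0) : y = Complex.I • x := by
  have hI := Complex.I_mul_I
  have : y - Complex.I • x = (-(2 * Complex.I)) • ((2⁻¹ : ℂ) • (x + Complex.I • y)) := by
    match_scalars
    · linear_combination hI
    · ring
  rw [h, smul_zero] at this
  exact sub_eq_zero.mp this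

theorem interior_stdType (Φ : Fiber) (v : Model) :
    interior (stdJ v) (stdType 3 3 0 Φ) = Complex.I • interior v (stdType 3 3 0 Φ) := by
  have hk : ∀ k, ann (imIdx k) (stdType 3 3 0 Φ) = Complex.I • ann (reIdx k) (stdType 3 3 0 Φ) := by
    intro k
    have h := annB_stdType k Φ
    change (2⁻¹ : ℂ) • (ann (reIdx k) (stdType 3 3 0 Φ) + Complex.I •
      ann (imIdx k) (stdType 3 3 0 Φ)) = 0 at h
    exact eq_I_smul h
  have h1 : ∀ i, interior (stdJ (stdVec i)) (stdType 3 3 0 Φ) =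
      Complex.I • interior (stdVec i) (stdType 3 3 0 Φ) := by
    intro i
    obtain ⟨k, rfl | rfl⟩ : ∃ k, i = reIdx k ∨ i = imIdx k := by
      refine Fin.addCases (m := 3) (n := 3) (fun k => ⟨k, Or.inl rfl⟩) (fun k => ⟨k, Or.inr rfl⟩) i
    · rw [stdJ_re]; exact hk k
    · have hn : interior (-stdVec (reIdx k)) = -interior (stdVec (reIdx k)) :=
        _root_.map_neg interiorLM _
      rw [stdJ_im, hn, show interior (stdVec (imIdx k)) (stdType 3 3 0 Φ) = _ from hk k, smul_smul,
        Complex.I_mul_I]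
      change -ann (reIdx k) _ = _
      module
  have hs : ∀ (c : Fin 6 → ℝ) (u : Fin 6 → Model) (η : Fiber),
      interior (∑ j, c j • u j) η = ∑ j, (c j : ℂ) • interior (u j) η := by
    intro c u η
    have : interior (∑ j, c j • u j) = ∑ j, (c j : ℂ) • interior (u j) :=
      (_root_.map_sum interiorLM _ _).trans (Finset.sum_congr rfl fun j _ => interior_smul _ _)
    rw [this, LinearMap.sum_apply]
    rfl
  conv_lhs => rw [← sum_coord_smul_stdVec v]
  conv_rhs => rw [← sum_coord_smul_stdVec v]
  rw [_root_.map_sum]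
  simp only [_root_.map_smul, hs, h1, Finset.smul_sum]
  exact Finset.sum_congr rfl fun j _ => smul_comm _ _ _

section

variable {M : Type*} [TopologicalSpace M] [ChartedSpace Model M] [IsManifold (𝓡 6) ∞ M]
  {x₀ : M} {W : Set Model} {P Q : Model → Model →L[ℝ] Model} {y : Model} {S : SU3Structure M}

theorem IsUnitaryFrame.frameRep_Omega (hP : IsUnitaryFrame S.toAlmostHermitian x₀ W P Q)
    (hy : y ∈ W) : frameRep (single 3 S.Omega) x₀ P y =
      stdType 3 3 0 (frameRep (single 3 S.Omega) x₀ P y) := by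
  have h := represents_typePart S.toAlmostHermitian 3 3 0 (single 3 S.Omega) _ _ (hP.unitary y hy)
  have h2 : typePart S.toAlmostHermitian 3 3 0 (single 3 S.Omega) = single 3 S.Omega := by
    rw [typePart, single, Pi.single_eq_same]
    congr 1
    funext x
    exact S.Omega_type x
  rw [h2] at h
  exact h

/-- The form `Ω` has a nonzero component in a unitary frame. -/
theorem IsUnitaryFrame.annA_frameRep_Omega (hP : IsUnitaryFrame S.toAlmostHermitian x₀ W P Q)
    (hy : y ∈ W) : ∃ t : ℂ, t ≠ 0 ∧
      annA ann 2 (annA ann 1 (annA ann 0 (frameRep (single 3 S.Omega) x₀ P y))) =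
        t • scalar 1 := by
  set Φ := frameRep (single 3 S.Omega) x₀ P y with hΦ
  have hβ : ∀ k, annB ann k Φ = 0 := by
    intro k
    rw [hΦ, hP.frameRep_Omega hy]
    exact annB_stdType k _
  have hre : ∀ k v, annB ann k v = 0 → annA ann k v = ann (reIdx k) v := by
    intro k v h
    have e : ann (reIdx k) = annA ann k + annB ann k := ann_re ann k
    rw [e, LinearMap.add_apply, h, add_zero]
  have hβ' : ∀ k l v, annB ann k v = 0 → annB ann k (annA ann l v) = 0 := by
    intro k l v h
    rw [car.β_α_apply, h, _root_.map_zero, neg_zero]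
  rw [hre 2 _ (hβ' _ _ _ (hβ' _ _ _ (hβ 2))), hre 1 _ (hβ' _ _ _ (hβ 1)), hre 0 _ (hβ 0)]
  have hdeg : ∀ m, m ≠ 3 → Φ m = 0 := by
    intro m hm
    rw [hΦ, hP.frameRep_Omega hy]
    exact stdType_apply_of_ne hm _ _ _
  refine ⟨Φ 3 ![stdVec (reIdx 0), stdVec (reIdx 1), stdVec (reIdx 2)], ?_, ?_⟩
  · have hF := hP.unitary y hy
    have h1 := S.Omega_unit _ (fun i => (chartInv x₀ y).comp (P y) (stdVec (reIdx i)))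
      (by
        intro i j
        refine (hF.metric _ _).trans ?_
        have := congrFun (congrFun gram_stdG_stdVec (reIdx i)) (reIdx j)
        rw [Matrix.one_apply] at this
        refine this.trans ?_
        simp only [reIdx_inj])
      (by
        intro i j
        have h2 := hF.complex (stdVec (reIdx i))
        have h3 := hF.metric (stdJ (stdVec (reIdx i))) (stdVec (reIdx j))
        rw [← h2, stdJ_re] at h3
        refine h3.trans ?_
        have := congrFun (congrFun gram_stdG_stdVec (imIdx i)) (reIdx j)
        rw [Matrix.one_apply, if_neg (reIdx_ne_imIdx j i).symm] at this
        exact this)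
    have h2 : Φ 3 ![stdVec (reIdx 0), stdVec (reIdx 1), stdVec (reIdx 2)] =
        S.Omega ((extChartAt (𝓡 6) x₀).symm y)
        (fun i => (chartInv x₀ y).comp (P y) (stdVec (reIdx i))) := by
      rw [hΦ, frameRep_eq, pull_single, Pi.single_eq_same]
      change S.Omega _ _ = S.Omega _ _
      congr 1
      funext i
      fin_cases i <;> rfl
    intro h0
    rw [h2] at h0
    have h3 := congrArg norm h0
    rw [norm_zero] at h3
    exact one_ne_zero (h1.symm.trans h3)
  · funext m
    rcases m with _ | m
    · ext v
      change Φ 3 _ = Φ 3 _ * 1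
      rw [mul_one]
      congr 1
      funext i
      fin_cases i <;> rfl
    · ext v
      have h0 : ∀ u, Φ (m + 1 + 3) u = 0 := by
        intro u; rw [hdeg _ (by omega)]; rfl
      exact (h0 (Matrix.vecCons (stdVec (reIdx 0)) (Matrix.vecCons (stdVec (reIdx 1))
        (Matrix.vecCons (stdVec (reIdx 2)) v)))).trans
          (mul_zero (Φ 3 ![stdVec (reIdx 0), stdVec (reIdx 1), stdVec (reIdx 2)])).symm

end

/-! ### The exterior derivative on a nearly Kähler manifold -/

theorem derivation_add (A B : Model →L[ℝ] Model) (f : Fiber) :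
    derivation (A + B) f = derivation A f + derivation B f := by
  have : derivation (A + B) = derivation A + derivation B := by
    simp only [derivation, ContinuousLinearMap.comp_add, wedgeOne_add, add_mul,
      Finset.sum_add_distrib]
  rw [this]
  rfl

theorem stdType_stdJ_stdJ (Φ : Fiber) (X Y Z : Model) :
    stdType 3 3 0 Φ 3 ![stdJ X, stdJ Y, Z] = -stdType 3 3 0 Φ 3 ![X, Y, Z] := by
  have h : ∀ U V W, stdType 3 3 0 Φ 3 ![stdJ U, V, W] =
      Complex.I * stdType 3 3 0 Φ 3 ![U, V, W] := fun U V W =>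
    congrArg (fun η : Fiber => η 2 ![V, W]) (interior_stdType Φ U)
  have sw : ∀ U V W, stdType 3 3 0 Φ 3 ![U, V, W] = -stdType 3 3 0 Φ 3 ![V, U, W] := by
    intro U V W
    have h1 := (stdType 3 3 0 Φ 3).map_swap ![V, U, W] (i := 0) (j := 1) (by decide)
    refine Eq.trans ?_ h1
    change stdType 3 3 0 Φ 3 ![U, V, W] = stdType 3 3 0 Φ 3 (![V, U, W] ∘ ⇑(Equiv.swap 0 1))
    congr 1
    funext i
    fin_cases i <;> rfl
  rw [h, sw, h, sw Y X]
  linear_combination stdType 3 3 0 Φ 3 ![X, Y, Z] * Complex.I_mul_I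

section

variable {M : Type*} [TopologicalSpace M] [ChartedSpace Model M] [IsManifold (𝓡 6) ∞ M]
  {x₀ : M} {W : Set Model} {P Q : Model → Model →L[ℝ] Model} {y : Model} {S : SU3Structure M}

/-- On a nearly Kähler manifold `dΩ = -2√-1 λ ω²`: the real part of `Ω` is exact. -/
theorem SU3Structure.IsNearlyKahler.extD_Omega {c : ℝ} (hc : c ≠ 0)
    (h1 : ∀ x : M, extD S.omega x = (3 * c : ℂ) • rePart (S.Omega x))
    (h2 : ∀ x : M, extD (fun y => imPart (S.Omega y)) x =
      (-2 * c : ℂ) • wedge (S.omega x) (S.omega x)) :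
    extD S.Omega = fun x => (Complex.I * (-2 * c : ℂ)) • wedge (S.omega x) (S.omega x) := by
  let re : Form M 3 := fun x => rePart (S.Omega x)
  let im : Form M 3 := fun x => imPart (S.Omega x)
  have hre : IsSmooth re := isSmooth_compCLM S.Omega_smooth _
  have him : IsSmooth im := isSmooth_compCLM S.Omega_smooth _
  have hω : extD S.omega = (3 * c : ℂ) • re := funext h1
  have hd : (3 * c : ℂ) • extD re = 0 := by
    rw [← extD_smul _ hre, ← hω]
    exact extD_extD (isSmooth_omega S.toAlmostHermitian)
  have hd' : ∀ x v, extD re x v = 0 := by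
    intro x v
    have := congrArg (fun η : Form M 4 => η x v) hd
    exact (mul_eq_zero.mp this).resolve_left
      (mul_ne_zero (by norm_num) (Complex.ofReal_ne_zero.mpr hc))
  have hO : S.Omega = re + Complex.I • im := by
    funext x
    ext v
    change S.Omega x v = ((S.Omega x v).re : ℂ) + Complex.I * ((S.Omega x v).im : ℂ)
    rw [mul_comm, Complex.re_add_im]
  rw [hO, extD_add hre (him.smul _), extD_smul _ him]
  funext x
  ext v
  change extD re x v + Complex.I * extD im x v = (Complex.I * (-2 * c : ℂ)) * _
  rw [hd', zero_add, show extD im x = _ from h2 x, mul_assoc]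
  rfl

theorem wedge_comp_eq {V : Type*} [AddCommGroup V] [Module ℝ V] [TopologicalSpace V]
    {σ : V [⋀^Fin 2]→L[ℝ] ℂ} {F : Model →L[ℝ] V} (h : σ.compContinuousLinearMap F = stdOmega)
    (c : ℂ) : (c • wedge σ σ).compContinuousLinearMap F = c • wedge stdOmega stdOmega := by
  rw [smul_comp, wedge_comp, h]

theorem lefschetz_lefschetz_one :
    lefschetz (lefschetz (scalar 1)) = Pi.single 4 (wedge stdOmega stdOmega) := by
  have h2 : stdOmega = lefschetz (scalar 1) 2 := by ext v; exact stdOmega_eq v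
  have hw : ∀ (η : Fiber) k, (∀ m, m ≠ k → η m = 0) → ∀ m, m ≠ k + 2 → lefschetz η m = 0 := by
    intro η k h m hm
    have h' : ∀ i (η : Fiber) k, (∀ m, m ≠ k → η m = 0) → ∀ m, m ≠ k + 1 → cre i η m = 0 := by
      intro i η k h m hm
      rcases m with _ | m
      · rfl
      · rw [cre, wedgeOne_succ, h m (by omega)]
        ext v
        simp [alternatizeUncurryFin_apply]
    rw [lefschetz, LinearMap.sum_apply, Finset.sum_apply]
    exact Finset.sum_eq_zero fun j _ => h' _ _ (k + 1) (h' _ _ k h) m hm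
  funext m
  by_cases hm : m = 4
  · subst hm
    rw [Pi.single_eq_same]
    exact (wedge_stdOmega_eq (l := 2) h2.symm).symm
  · rw [Pi.single_eq_of_ne hm]
    refine hw _ 2 (hw _ 0 fun m hm => ?_) m hm
    rcases m with _ | m
    · exact absurd rfl hm
    · rfl

/-- The torsion of the flat connection of a unitary frame, in terms of `dω = 3λ Re Ω`. -/
theorem IsUnitaryFrame.torsion_eq {c : ℝ}
    (h1 : ∀ x : M, extD S.omega x = (3 * c : ℂ) • rePart (S.Omega x))
    (hP : IsUnitaryFrame S.toAlmostHermitian x₀ W P Q) (hy : y ∈ W) (X Y Z : Model) :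
    -(stdG (torsion (frameConnection P Q y) X Y) (stdJ Z) +
      stdG (torsion (frameConnection P Q y) Y Z) (stdJ X) +
      stdG (torsion (frameConnection P Q y) Z X) (stdJ Y)) =
        3 * c * (frameRep (single 3 S.Omega) x₀ P y 3 ![X, Y, Z]).re := by
  have h3 := hP.extD_omega hy X Y Z
  rw [deRham_single, frameRep_eq, pull_single, Pi.single_eq_same] at h3
  have h4 : frameRep (single 3 S.Omega) x₀ P y 3 ![X, Y, Z] =
      S.Omega ((extChartAt (𝓡 6) x₀).symm y)
        (fun i => (chartInv x₀ y).comp (P y) (![X, Y, Z] i)) := by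
    rw [frameRep_eq, pull_single, Pi.single_eq_same]
    rfl
  have h5 := (congrArg (fun σ => σ (fun i => (chartInv x₀ y).comp (P y) (![X, Y, Z] i)))
    (h1 ((extChartAt (𝓡 6) x₀).symm y))).symm.trans h3
  apply Complex.ofReal_injective
  rw [← h5, h4]
  push_cast
  rfl

/-- The torsion of the corrected connection is antilinear on a nearly Kähler manifold. -/
theorem IsUnitaryFrame.torsion_antilinear {c : ℝ}
    (h1 : ∀ x : M, extD S.omega x = (3 * c : ℂ) • rePart (S.Omega x))
    (hP : IsUnitaryFrame S.toAlmostHermitian x₀ W P Q) (hy : y ∈ W) (X Y : Model) :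
    torsion (fun X => frameConnection P Q y X + hermitianCorrection (frameConnection P Q y) X)
        (stdJ X) Y =
      -stdJ (torsion (fun X => frameConnection P Q y X +
        hermitianCorrection (frameConnection P Q y) X) X Y) := by
  refine NearlyKahler.torsion_antilinear _ (fun X Y Z => ?_) X Y
  have h3 := hP.torsion_eq h1 hy X Y Z
  have h4 := hP.torsion_eq h1 hy (stdJ X) (stdJ Y) Z
  rw [hP.frameRep_Omega hy, stdType_stdJ_stdJ, ← hP.frameRep_Omega hy, Complex.neg_re] at h4
  linarith

theorem IsUnitaryFrame.frameRep_deRham_eq {H : AlmostHermitian M}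
    (hP : IsUnitaryFrame H x₀ W P Q) (hy : y ∈ W) (B : Fin 6 → Model →L[ℝ] Model)
    {η : MixedForm M} (hη : IsSmoothMixed η) : frameRep (deRham η) x₀ P y =
      ∑ i, cre i (covDeriv P B y i (frameRep η x₀ P)) +
        (∑ i, cre i * derivation (frameConnection P Q y (stdVec i) + B i))
          (frameRep η x₀ P y) := by
  rw [hP.frameRep_deRham hη hy, LinearMap.sum_apply, ← Finset.sum_add_distrib]
  refine Finset.sum_congr rfl fun i _ => ?_
  rw [Module.End.mul_apply, derivation_add, ← _root_.map_add, covDeriv]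
  congr 1
  change _ + derivation (frameConnection P Q y (stdVec i)) _ = _
  abel

/-- The second structure equation: `dΩ` is a multiple of `ω²`, here written in complex coordinates.
-/
theorem IsUnitaryFrame.frameRep_deRham_Omega {c : ℝ} (hc : c ≠ 0)
    (h1 : ∀ x : M, extD S.omega x = (3 * c : ℂ) • rePart (S.Omega x))
    (h2 : ∀ x : M, extD (fun y => imPart (S.Omega y)) x =
      (-2 * c : ℂ) • wedge (S.omega x) (S.omega x))
    (hP : IsUnitaryFrame S.toAlmostHermitian x₀ W P Q) (hy : y ∈ W) :
    ∃ μ : ℂ, frameRep (deRham (single 3 S.Omega)) x₀ P y =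
      μ • ∑ k, creA cre k (creB cre k (∑ k, creA cre k (creB cre k (scalar 1)))) := by
  have hlef : ∀ v, lefschetz v = (2⁻¹ * Complex.I) • ∑ k, creA cre k (creB cre k v) := by
    intro v
    rw [lefschetz_eq, LinearMap.smul_apply, LinearMap.sum_apply]
    rfl
  have heq : frameRep (deRham (single 3 S.Omega)) x₀ P y =
      (Complex.I * (-2 * c : ℂ)) • lefschetz (lefschetz (scalar 1)) := by
    rw [deRham_single, SU3Structure.IsNearlyKahler.extD_Omega hc h1 h2, frameRep_eq, pull_single,
      lefschetz_lefschetz_one]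
    funext m
    by_cases hm : m = 4
    · subst hm
      rw [Pi.single_eq_same, Pi.smul_apply, Pi.single_eq_same]
      exact wedge_comp_eq (V := TangentSpace (𝓡 6) ((extChartAt (𝓡 6) x₀).symm y))
        (hP.unitary y hy).omega _
    · rw [Pi.single_eq_of_ne hm, Pi.smul_apply, Pi.single_eq_of_ne hm]
      ext v
      simp
  rw [hlef, hlef] at heq
  simp only [_root_.map_smul, ← Finset.smul_sum] at heq
  rw [smul_smul, smul_smul] at heq
  exact ⟨_, heq⟩

/-- In a unitary frame on a nearly Kähler manifold, the exterior derivative is the sum of the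
antisymmetrized covariant derivative of a Hermitian connection and of the algebraic operators `N`
and `N̄`, which are given by the totally antisymmetric torsion of this connection. -/
theorem IsUnitaryFrame.exists_connection (hS : S.IsNearlyKahler)
    (hP : IsUnitaryFrame S.toAlmostHermitian x₀ W P Q) (hy : y ∈ W) :
    ∃ (B : Fin 6 → Model →L[ℝ] Model) (κ : ℂ), (∀ i, IsSkewHermitian (B i)) ∧
      ∀ η : MixedForm M, IsSmoothMixed η → frameRep (deRham η) x₀ P y =
        ∑ i, cre i (covDeriv P B y i (frameRep η x₀ P)) +
          (starRingEnd ℂ κ • cyclic (creA cre) (creA cre) (annB ann) +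
            κ • cyclic (creB cre) (creB cre) (annA ann)) (frameRep η x₀ P y) := by
  obtain ⟨c, hc, h1, h2⟩ := hS
  obtain ⟨z, hz, hsum⟩ := sum_cre_mul_derivation _ (hP.torsion_antilinear h1 hy)
  let B : Fin 6 → Model →L[ℝ] Model := fun i =>
    hermitianCorrection (frameConnection P Q y) (stdVec i)
  have hBs : ∀ i, IsSkewHermitian (B i) := fun i => isSkewHermitian_hermitianCorrection _ _
  have hd : ∀ η : MixedForm M, IsSmoothMixed η → frameRep (deRham η) x₀ P y =
      ∑ i, cre i (covDeriv P B y i (frameRep η x₀ P)) +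
        (torsionOp (creB cre) (annA ann) z + torsionOp (creA cre) (annB ann)
          fun j k l => starRingEnd ℂ (z j k l)) (frameRep η x₀ P y) := by
    intro η hη
    rw [← hsum]
    exact hP.frameRep_deRham_eq hy B hη
  -- the structure equation for `Ω` forces the torsion to be totally antisymmetric
  have hΦs : IsSmoothMixed (single 3 S.Omega) := isSmoothMixed_single S.Omega_smooth
  have hcov : ∀ i, covDeriv P B y i (frameRep (single 3 S.Omega) x₀ P) =
      stdType 3 3 0 (covDeriv P B y i (frameRep (single 3 S.Omega) x₀ P)) := fun i =>
    (covDeriv_congr hP.isOpen hy (fun z hz => hP.frameRep_Omega hz) i).trans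
      (covDeriv_map hBs hP.isOpen hy (hP.smoothOn_frameRep hΦs) (isInvariant_stdType 3 3 0) i)
  have hβ : ∀ k i, annB ann k (covDeriv P B y i (frameRep (single 3 S.Omega) x₀ P)) = 0 := by
    intro k i
    rw [hcov]
    exact annB_stdType k _
  have hβ0 : ∀ k, annB ann k (frameRep (single 3 S.Omega) x₀ P y) = 0 := by
    intro k
    rw [hP.frameRep_Omega hy]
    exact annB_stdType k _
  obtain ⟨t, ht, hΦ0⟩ := hP.annA_frameRep_Omega hy
  obtain ⟨μ, heq⟩ := hP.frameRep_deRham_Omega hc h1 h2 hy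
  rw [hd _ hΦs, sum_cre_eq] at heq
  have hann : ∀ i, ann i (scalar 1) = 0 := fun i => interior_scalar _ _
  have hcomb : ∀ (c : ℂ) (k : Fin 3) (x y : Fiber), annB ann k x = 0 → annB ann k y = 0 →
      annB ann k ((2⁻¹ : ℂ) • (x + c • y)) = 0 := by
    intro c k x y hx hy
    rw [_root_.map_smul, _root_.map_add, _root_.map_smul, hx, hy]
    ext; simp
  have hcomb2 : ∀ (c : ℂ) (x y : Fiber), x = 0 → y = 0 → (2⁻¹ : ℂ) • (x + c • y) = 0 := by
    rintro c _ _ rfl rfl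
    ext; simp
  have hsub : ∀ x y : Fiber, x - Complex.I • y = x + (-Complex.I) • y := by intro x y; module
  obtain ⟨κ, hκ⟩ := car.torsion_of_structure_equation hz hβ0
    (fun i k => by rw [hsub]; exact hcomb _ k _ _ (hβ _ _) (hβ _ _))
    (fun i k => hcomb _ k _ _ (hβ _ _) (hβ _ _)) ht
    (fun k => (congrArg ((2⁻¹ : ℂ) • ·) (hsub _ _)).trans (hcomb2 _ _ _ (hann _) (hann _)))
    (fun k => hcomb2 _ _ _ (hann _) (hann _))
    (fun h => one_ne_zero (congrArg (fun η : Fiber => η 0 Fin.elim0) h)) hΦ0 heq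
  refine ⟨B, κ, hBs, fun η hη => ?_⟩
  rw [hd η hη, torsionOp_eq_cyclic car.bb hκ,
    torsionOp_eq_cyclic car.aa (κ := starRingEnd ℂ κ), add_comm (κ • _)]
  intro p q l
  rw [hκ, _root_.map_mul, _root_.map_sub]
  congr 2 <;> split_ifs <;> simp

end

/-! ### The components of the exterior derivative in a unitary frame -/

/-- An operator of degree `d` on forms of mixed degree. -/
def HasDegree (d : ℤ) (O : Module.End ℂ Fiber) : Prop :=
  ∀ (ξ : Fiber) (m : ℕ), (∀ k : ℕ, (k : ℤ) + d = m → ξ k = 0) → O ξ m = 0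

theorem HasDegree.mul {d d' : ℤ} {O O' : Module.End ℂ Fiber} (hO : HasDegree d O)
    (hO' : HasDegree d' O') : HasDegree (d + d') (O * O') :=
  fun ξ m h => hO _ m fun j hj => hO' ξ j fun k hk => h k (by omega)

theorem HasDegree.add {d : ℤ} {O O' : Module.End ℂ Fiber} (hO : HasDegree d O)
    (hO' : HasDegree d O') : HasDegree d (O + O') := by
  intro ξ m h
  rw [LinearMap.add_apply, Pi.add_apply, hO ξ m h, hO' ξ m h, add_zero]

theorem HasDegree.smul {d : ℤ} {O : Module.End ℂ Fiber} (c : ℂ) (hO : HasDegree d O) :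
    HasDegree d (c • O) := by
  intro ξ m h
  rw [LinearMap.smul_apply, Pi.smul_apply, hO ξ m h]
  ext v; simp

theorem HasDegree.sub {d : ℤ} {O O' : Module.End ℂ Fiber} (hO : HasDegree d O)
    (hO' : HasDegree d O') : HasDegree d (O - O') := by
  intro ξ m h
  rw [LinearMap.sub_apply, Pi.sub_apply, hO ξ m h, hO' ξ m h, sub_zero]

theorem hasDegree_cre (i : Fin 6) : HasDegree 1 (cre i) := by
  intro ξ m h
  rcases m with _ | m
  · rfl
  · rw [cre, wedgeOne_succ, h m (by push_cast; ring)]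
    ext v
    simp [alternatizeUncurryFin_apply]

theorem hasDegree_ann (i : Fin 6) : HasDegree (-1) (ann i) := by
  intro ξ m h
  ext v
  rw [ann, interior_apply, h (m + 1) (by push_cast; ring)]
  rfl

theorem hasDegree_creA (k : Fin 3) : HasDegree 1 (creA cre k) :=
  (hasDegree_cre _).add ((hasDegree_cre _).smul _)

theorem hasDegree_creB (k : Fin 3) : HasDegree 1 (creB cre k) :=
  (hasDegree_cre _).sub ((hasDegree_cre _).smul _)

theorem hasDegree_annB (k : Fin 3) : HasDegree (-1) (annB ann k) :=
  ((hasDegree_ann _).add ((hasDegree_ann _).smul _)).smul _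

theorem hasDegree_annA (k : Fin 3) : HasDegree (-1) (annA ann k) :=
  ((hasDegree_ann _).sub ((hasDegree_ann _).smul _)).smul _

theorem HasDegree.cyclic {d d' : ℤ} {x y : Fin 3 → Module.End ℂ Fiber} (hx : ∀ k, HasDegree d (x k))
    (hy : ∀ k, HasDegree d' (y k)) : HasDegree (d + d + d') (cyclic x x y) :=
  ((((hx 0).mul (hx 1)).mul (hy 2)).add (((hx 1).mul (hx 2)).mul (hy 0))).add
    (((hx 2).mul (hx 0)).mul (hy 1))

theorem sum_stdType (k : ℕ) (ξ : Fiber) :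
    ∑ p ∈ Finset.range (k + 1), stdType k p ((k : ℤ) - p) ξ k = ξ k := by
  simp only [stdType_apply_self]
  exact sum_typeProj_eq (ξ k)

/-- An operator of degree one that raises weights by `w` contributes to the component of bidegree
`(a, b)` if and only if `w = a - b`. -/
theorem sum_stdType_shift {O : Module.End ℂ Fiber} {w a b : ℤ} (hd : HasDegree 1 O)
    (hw : HasShift w O) (hab : a + b = 1) (k : ℕ) (ξ : Fiber) :
    ∑ p ∈ Finset.range (k + 1), stdType (k + 1) (p + a) ((k : ℤ) - p + b)
      (O (stdType k p ((k : ℤ) - p) ξ)) (k + 1) = (if w = a - b then O ξ else 0) (k + 1) := by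
  have h1 : ∀ p ∈ Finset.range (k + 1), stdType (k + 1) (p + a) ((k : ℤ) - p + b)
      (O (stdType k p ((k : ℤ) - p) ξ)) (k + 1) =
      if w = a - b then O (stdType k p ((k : ℤ) - p) ξ) (k + 1) else 0 := by
    intro p hp
    have hp' : p ≤ k := Nat.lt_succ_iff.mp (Finset.mem_range.mp hp)
    rw [stdType_apply_self, typeProj_of_hasWeight (hw.hasWeight (hasWeight_stdType k p hp' ξ))
      (by push_cast; linarith)]
    refine if_congr ?_ rfl rfl
    constructor <;> intro h <;> linarith
  rw [Finset.sum_congr rfl h1]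
  split_ifs with h
  · rw [← Finset.sum_apply, ← _root_.map_sum]
    have h2 := hd (∑ p ∈ Finset.range (k + 1), stdType k p ((k : ℤ) - p) ξ - ξ) (k + 1) (by
      intro j hj
      obtain rfl : j = k := by push_cast at hj; omega
      rw [Pi.sub_apply, Finset.sum_apply, sum_stdType, sub_self])
    rw [_root_.map_sub, Pi.sub_apply] at h2
    exact sub_eq_zero.mp h2
  · rw [Finset.sum_const_zero]
    rfl

/-- The covariant derivative in the direction `∂/∂z_k`. -/
def covDerivZ (P : Model → Model →L[ℝ] Model) (B : Fin 6 → Model →L[ℝ] Model) (y : Model)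
    (k : Fin 3) (f : Model → Fiber) : Fiber :=
  (2⁻¹ : ℂ) • (covDeriv P B y (reIdx k) f - Complex.I • covDeriv P B y (imIdx k) f)

/-- The covariant derivative in the direction `∂/∂z̄_k`. -/
def covDerivZBar (P : Model → Model →L[ℝ] Model) (B : Fin 6 → Model →L[ℝ] Model) (y : Model)
    (k : Fin 3) (f : Model → Fiber) : Fiber :=
  (2⁻¹ : ℂ) • (covDeriv P B y (reIdx k) f + Complex.I • covDeriv P B y (imIdx k) f)

/-- The local expressions of `N`, `∂`, `∂̄` and `N̄`. -/
def localOp (P : Model → Model →L[ℝ] Model) (B : Fin 6 → Model →L[ℝ] Model) (κ : ℂ) (y : Model) :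
    Fin 4 → (Model → Fiber) → Fiber :=
  ![fun f => (starRingEnd ℂ κ • cyclic (creA cre) (creA cre) (annB ann)) (f y),
    fun f => ∑ k, creA cre k (covDerivZ P B y k f),
    fun f => ∑ k, creB cre k (covDerivZBar P B y k f),
    fun f => (κ • cyclic (creB cre) (creB cre) (annA ann)) (f y)]

/-- The weights of `N`, `∂`, `∂̄` and `N̄`. -/
def dPartWeight : Fin 4 → ℤ := ![3, 1, -1, -3]

section

variable {P : Model → Model →L[ℝ] Model} {B : Fin 6 → Model →L[ℝ] Model} {W : Set Model}
  {y : Model} {f g : Model → Fiber} {κ : ℂ}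

theorem localOp_N : localOp P B κ y 0 f =
    (starRingEnd ℂ κ • cyclic (creA cre) (creA cre) (annB ann)) (f y) := rfl

theorem localOp_del : localOp P B κ y 1 f = ∑ k, creA cre k (covDerivZ P B y k f) := rfl

theorem localOp_delBar : localOp P B κ y 2 f = ∑ k, creB cre k (covDerivZBar P B y k f) := rfl

theorem localOp_NBar : localOp P B κ y 3 f =
    (κ • cyclic (creB cre) (creB cre) (annA ann)) (f y) := rfl

theorem localOp_congr (hW : IsOpen W) (hy : y ∈ W) (h : ∀ z ∈ W, f z = g z) (i : Fin 4) :
    localOp P B κ y i f = localOp P B κ y i g := by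
  have h1 : ∀ k, covDerivZ P B y k f = covDerivZ P B y k g := by
    intro k
    rw [covDerivZ, covDerivZ, covDeriv_congr hW hy h, covDeriv_congr hW hy h]
  have h2 : ∀ k, covDerivZBar P B y k f = covDerivZBar P B y k g := by
    intro k
    rw [covDerivZBar, covDerivZBar, covDeriv_congr hW hy h, covDeriv_congr hW hy h]
  match i with
  | 0 => rw [localOp_N, localOp_N, h y hy]
  | 1 => simp only [localOp_del, h1]
  | 2 => simp only [localOp_delBar, h2]
  | 3 => rw [localOp_NBar, localOp_NBar, h y hy]

theorem covDerivZ_map (hB : ∀ i, IsSkewHermitian (B i)) (hW : IsOpen W) (hy : y ∈ W)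
    (hf : SmoothOn f W) {O : Module.End ℂ Fiber} (hO : IsInvariant (O.restrictScalars ℝ))
    (k : Fin 3) : covDerivZ P B y k (fun z => O (f z)) = O (covDerivZ P B y k f) := by
  have h : ∀ i, covDeriv P B y i (fun z => O (f z)) = O (covDeriv P B y i f) :=
    fun i => covDeriv_map hB hW hy hf hO i
  rw [covDerivZ, covDerivZ, h, h, _root_.map_smul, _root_.map_sub, _root_.map_smul]

theorem covDerivZBar_map (hB : ∀ i, IsSkewHermitian (B i)) (hW : IsOpen W) (hy : y ∈ W)
    (hf : SmoothOn f W) {O : Module.End ℂ Fiber} (hO : IsInvariant (O.restrictScalars ℝ))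
    (k : Fin 3) : covDerivZBar P B y k (fun z => O (f z)) = O (covDerivZBar P B y k f) := by
  have h : ∀ i, covDeriv P B y i (fun z => O (f z)) = O (covDeriv P B y i f) :=
    fun i => covDeriv_map hB hW hy hf hO i
  rw [covDerivZBar, covDerivZBar, h, h, _root_.map_smul, _root_.map_add, _root_.map_smul]

theorem covDerivZ_star (hB : ∀ i, IsSkewHermitian (B i)) (hW : IsOpen W) (hy : y ∈ W)
    (hf : SmoothOn f W) (k : Fin 3) :
    covDerivZ P B y k (fun z => stdStar (f z)) = stdStar (covDerivZBar P B y k f) := by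
  have h : ∀ i, covDeriv P B y i (fun z => stdStar (f z)) = stdStar (covDeriv P B y i f) :=
    fun i => covDeriv_map hB hW hy hf isInvariant_realStar i
  rw [covDerivZ, covDerivZBar, h, h, map_smulₛₗ, _root_.map_add, map_smulₛₗ, Complex.conj_I,
    map_inv₀, map_ofNat]
  module

theorem covDerivZBar_star (hB : ∀ i, IsSkewHermitian (B i)) (hW : IsOpen W) (hy : y ∈ W)
    (hf : SmoothOn f W) (k : Fin 3) :
    covDerivZBar P B y k (fun z => stdStar (f z)) = stdStar (covDerivZ P B y k f) := by
  have h : ∀ i, covDeriv P B y i (fun z => stdStar (f z)) = stdStar (covDeriv P B y i f) :=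
    fun i => covDeriv_map hB hW hy hf isInvariant_realStar i
  rw [covDerivZ, covDerivZBar, h, h, map_smulₛₗ, _root_.map_sub, map_smulₛₗ, Complex.conj_I,
    map_inv₀, map_ofNat]
  module

/-- The local expressions commute with an invariant operator up to the scalar by which it commutes
with the creation and annihilation operators. -/
theorem localOp_map (hB : ∀ i, IsSkewHermitian (B i)) (hW : IsOpen W) (hy : y ∈ W)
    (hf : SmoothOn f W) {O : Module.End ℂ Fiber} (hO : IsInvariant (O.restrictScalars ℝ))
    {c : Fin 4 → ℂ}
    (h0 : ∀ v, cyclic (creA cre) (creA cre) (annB ann) (O v) =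
      c 0 • O (cyclic (creA cre) (creA cre) (annB ann) v))
    (h1 : ∀ k v, creA cre k (O v) = c 1 • O (creA cre k v))
    (h2 : ∀ k v, creB cre k (O v) = c 2 • O (creB cre k v))
    (h3 : ∀ v, cyclic (creB cre) (creB cre) (annA ann) (O v) =
      c 3 • O (cyclic (creB cre) (creB cre) (annA ann) v)) (i : Fin 4) :
    localOp P B κ y i (fun z => O (f z)) = c i • O (localOp P B κ y i f) := by
  match i with
  | 0 => rw [localOp_N, localOp_N, LinearMap.smul_apply, LinearMap.smul_apply, h0, _root_.map_smul,
      smul_comm]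
  | 1 =>
    rw [localOp_del, localOp_del, _root_.map_sum, Finset.smul_sum]
    refine Finset.sum_congr rfl fun k _ => ?_
    rw [covDerivZ_map hB hW hy hf hO, h1]
  | 2 =>
    rw [localOp_delBar, localOp_delBar, _root_.map_sum, Finset.smul_sum]
    refine Finset.sum_congr rfl fun k _ => ?_
    rw [covDerivZBar_map hB hW hy hf hO, h2]
  | 3 => rw [localOp_NBar, localOp_NBar, LinearMap.smul_apply, LinearMap.smul_apply, h3,
      _root_.map_smul, smul_comm]

theorem HasShift.apply_rot {w : ℤ} {O : Module.End ℂ Fiber} (h : HasShift w O) (ζ : Circle)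
    (v : Fiber) : O (rot ζ v) = ((ζ : ℂ) ^ (-w)) • rot ζ (O v) := by
  rw [h, smul_smul, ← zpow_add₀ ζ.coe_ne_zero, neg_add_cancel, zpow_zero, one_smul]

/-- The local expressions of `N`, `∂`, `∂̄` and `N̄` are homogeneous for the circle action, with
weights `3`, `1`, `-1` and `-3`. -/
theorem localOp_rot (hB : ∀ i, IsSkewHermitian (B i)) (hW : IsOpen W) (hy : y ∈ W)
    (hf : SmoothOn f W) (ζ : Circle) (i : Fin 4) :
    localOp P B κ y i (fun z => rot ζ (f z)) =
      ((ζ : ℂ) ^ (-dPartWeight i)) • rot ζ (localOp P B κ y i f) :=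
  localOp_map (c := fun i => (ζ : ℂ) ^ (-dPartWeight i)) hB hW hy hf (isInvariant_rot ζ)
    (fun v => (HasShift.cyclic hasShift_creA hasShift_annB).apply_rot ζ v)
    (fun k v => (hasShift_creA k).apply_rot ζ v) (fun k v => (hasShift_creB k).apply_rot ζ v)
    (fun v => (HasShift.cyclic hasShift_creB hasShift_annA).apply_rot ζ v) i

theorem localOp_smul (hB : ∀ i, IsSkewHermitian (B i)) (hW : IsOpen W) (hy : y ∈ W)
    (hf : SmoothOn f W) (c : ℂ) (i : Fin 4) :
    localOp P B κ y i (fun z => c • f z) = c • localOp P B κ y i f := by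
  have := localOp_map (κ := κ) (P := P) (c := fun _ => 1) hB hW hy hf
    (O := LinearMap.lsmul ℂ Fiber c) (isInvariant_smul c)
    (fun v => by simp) (fun k v => by simp) (fun k v => by simp) (fun v => by simp) i
  rw [one_smul] at this
  exact this

end

/-! ### Operators on smooth forms -/

section

variable {M : Type*} [TopologicalSpace M] [ChartedSpace Model M] {x₀ : M}
  {P : Model → Model →L[ℝ] Model} {y : Model}

theorem frameRep_add (η ξ : MixedForm M) (x₀ : M) (P : Model → Model →L[ℝ] Model) (y : Model) :
    frameRep (η + ξ) x₀ P y = frameRep η x₀ P y + frameRep ξ x₀ P y := rfl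

theorem frameRep_neg (η : MixedForm M) (x₀ : M) (P : Model → Model →L[ℝ] Model) (y : Model) :
    frameRep (-η) x₀ P y = -frameRep η x₀ P y := rfl

theorem frameRep_smul (c : ℂ) (η : MixedForm M) (x₀ : M) (P : Model → Model →L[ℝ] Model)
    (y : Model) : frameRep (c • η) x₀ P y = c • frameRep η x₀ P y := rfl

theorem frameRep_zero (x₀ : M) (P : Model → Model →L[ℝ] Model) (y : Model) :
    frameRep (0 : MixedForm M) x₀ P y = 0 := rfl

theorem frameRep_sum {ι : Type*} (s : Finset ι) (η : ι → MixedForm M) (x₀ : M)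
    (P : Model → Model →L[ℝ] Model) (y : Model) :
    frameRep (∑ i ∈ s, η i) x₀ P y = ∑ i ∈ s, frameRep (η i) x₀ P y := by
  induction s using Finset.cons_induction with
  | empty => rw [Finset.sum_empty, Finset.sum_empty]; rfl
  | cons i s hi ih => rw [Finset.sum_cons, Finset.sum_cons, frameRep_add, ih]

theorem frameRep_sub (η ξ : MixedForm M) (x₀ : M) (P : Model → Model →L[ℝ] Model) (y : Model) :
    frameRep (η - ξ) x₀ P y = frameRep η x₀ P y - frameRep ξ x₀ P y := rfl

theorem IsSmoothMixed.add {η ξ : MixedForm M} (hη : IsSmoothMixed η) (hξ : IsSmoothMixed ξ) :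
    IsSmoothMixed (η + ξ) := fun k => (hη k).add (hξ k)

theorem IsSmoothMixed.smul (c : ℂ) {η : MixedForm M} (hη : IsSmoothMixed η) :
    IsSmoothMixed (c • η) := fun k => (hη k).smul c

theorem isSmoothMixed_zero : IsSmoothMixed (0 : MixedForm M) := fun k => isSmooth_zero k

theorem IsSmoothMixed.sum {ι : Type*} {s : Finset ι} {η : ι → MixedForm M}
    (h : ∀ i ∈ s, IsSmoothMixed (η i)) : IsSmoothMixed (∑ i ∈ s, η i) := by
  induction s using Finset.cons_induction with
  | empty => rw [Finset.sum_empty]; exact isSmoothMixed_zero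
  | cons i s hi ih =>
    rw [Finset.sum_cons]
    exact (h i (Finset.mem_cons_self i s)).add (ih fun j hj => h j (Finset.mem_cons_of_mem hj))

theorem frameRep_congr_degree {η ξ : MixedForm M} {m : ℕ} (h : η m = ξ m) :
    frameRep η x₀ P y m = frameRep ξ x₀ P y m := by
  change (inChart x₀ (η m) y).compContinuousLinearMap (P y) =
    (inChart x₀ (ξ m) y).compContinuousLinearMap (P y)
  rw [h]

theorem real_smul_eq (c : ℝ) (η : MixedForm M) : c • η = (c : ℂ) • η := by
  funext k z
  ext v
  exact (Complex.real_smul (x := c) (z := η k z v))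

theorem frameRep_real_smul (c : ℝ) (η : MixedForm M) (x₀ : M) (P : Model → Model →L[ℝ] Model)
    (y : Model) : frameRep (c • η) x₀ P y = c • frameRep η x₀ P y := rfl

theorem I_smul_I_smul (η : MixedForm M) : Complex.I • Complex.I • η = -η := by
  rw [smul_smul, Complex.I_mul_I]
  funext k z
  exact neg_one_smul ℂ (η k z)

theorem two_smul_eq_add (η : MixedForm M) : (2 : ℂ) • η = η + η := by
  funext k z
  exact two_smul ℂ (η k z)

end

section

variable {M : Type*} [TopologicalSpace M] [ChartedSpace Model M] [IsManifold (𝓡 6) ∞ M]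
  {x₀ : M} {W : Set Model} {P Q : Model → Model →L[ℝ] Model} {y : Model}

/-- Forms are determined by their components in unitary frames. -/
theorem frameRep_ext (H : AlmostHermitian M) {η ξ : MixedForm M}
    (h : ∀ x₀ W P Q y, IsUnitaryFrame H x₀ W P Q → y ∈ W →
      frameRep η x₀ P y = frameRep ξ x₀ P y) : η = ξ := by
  have key : ∀ z, value η z = value ξ z := by
    intro z
    obtain ⟨W, P, Q, hy, hW⟩ := exists_unitaryFrame H (mem_extChartAt_target (I := 𝓡 6) z)
    have h1 := h z W P Q _ hW hy
    have hF := hW.unitary _ hy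
    rw [frameRep_eq, frameRep_eq, extChartAt_to_inv] at h1
    rw [extChartAt_to_inv] at hF
    obtain ⟨F', hF', -⟩ := hF.exists_inverse
    have h2 := congrArg (pull F') h1
    rw [pull_pull, pull_pull] at h2
    rwa [pull_eq_self hF', pull_eq_self hF'] at h2
  funext k z
  exact congrFun (key z) k

/-- The component of bidegree `(a, b)` of the de Rham differential, in terms of the projections to
the forms of a given type. -/
theorem dComp_succ (H : AlmostHermitian M) (a b : ℤ) (η : MixedForm M) (k : ℕ) :
    H.dComp a b η (k + 1) = (∑ p ∈ Finset.range (k + 1),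
      typePart H (k + 1) (p + a) ((k : ℤ) - p + b)
        (deRham (typePart H k p ((k : ℤ) - p) η))) (k + 1) := by
  funext x
  rw [Finset.sum_apply, Finset.sum_apply]
  refine Finset.sum_congr rfl fun p _ => ?_
  rw [typePart, Pi.single_eq_same]
  change typeProj (H.J x) _ _ _ = typeProj (H.J x) _ _ (extD (typePart H k p ((k : ℤ) - p) η k) x)
  rw [typePart, Pi.single_eq_same]

theorem isSmoothMixed_dComp (H : AlmostHermitian M) (a b : ℤ) {η : MixedForm M}
    (hη : IsSmoothMixed η) : IsSmoothMixed (H.dComp a b η) := by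
  intro k
  rcases k with _ | k
  · exact isSmooth_zero 0
  · rw [dComp_succ]
    refine IsSmoothMixed.sum (fun p _ => ?_) (k + 1)
    exact (represents_typePart H _ _ _).isSmoothMixed
      (isSmoothMixed_deRham ((represents_typePart H _ _ _).isSmoothMixed hη))

/-- `N`, `∂`, `∂̄` and `N̄`. -/
def dPart (H : AlmostHermitian M) : Fin 4 → FormOp M := ![H.N, H.del, H.delBar, H.NBar]

theorem exists_dPart_eq (H : AlmostHermitian M) (i : Fin 4) :
    ∃ a b, a + b = 1 ∧ a - b = dPartWeight i ∧ dPart H i = H.dComp a b := by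
  fin_cases i
  · exact ⟨2, -1, by norm_num, by norm_num [dPartWeight], rfl⟩
  · exact ⟨1, 0, by norm_num, by norm_num [dPartWeight], rfl⟩
  · exact ⟨0, 1, by norm_num, by norm_num [dPartWeight], rfl⟩
  · exact ⟨-1, 2, by norm_num, by norm_num [dPartWeight], rfl⟩

/-- The components of `d` preserve smoothness. -/
theorem isSmoothMixed_dPart (H : AlmostHermitian M) (i : Fin 4) {η : MixedForm M}
    (hη : IsSmoothMixed η) : IsSmoothMixed (dPart H i η) := by
  obtain ⟨a, b, -, -, h⟩ := exists_dPart_eq H i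
  rw [h]
  exact isSmoothMixed_dComp H a b hη

/-- The local expressions of the components of the exterior derivative. -/
theorem IsUnitaryFrame.exists_localOp {S : SU3Structure M} (hS : S.IsNearlyKahler)
    (hP : IsUnitaryFrame S.toAlmostHermitian x₀ W P Q) (hy : y ∈ W) :
    ∃ (B : Fin 6 → Model →L[ℝ] Model) (κ : ℂ), (∀ i, IsSkewHermitian (B i)) ∧
      (∀ η : MixedForm M, IsSmoothMixed η → frameRep (deRham η) x₀ P y =
        ∑ i, localOp P B κ y i (frameRep η x₀ P)) ∧
      ∀ i (η : MixedForm M), IsSmoothMixed η → frameRep (dPart S.toAlmostHermitian i η) x₀ P y =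
        localOp P B κ y i (frameRep η x₀ P) := by
  obtain ⟨B, κ, hB, hd⟩ := hP.exists_connection hS hy
  have hd' : ∀ η : MixedForm M, IsSmoothMixed η → frameRep (deRham η) x₀ P y =
      ∑ i, localOp P B κ y i (frameRep η x₀ P) := by
    intro η hη
    rw [hd η hη, sum_cre_eq, Finset.sum_add_distrib, LinearMap.add_apply, Fin.sum_univ_four]
    rw [localOp_N, localOp_del, localOp_delBar, localOp_NBar]
    simp only [covDerivZ, covDerivZBar]
    abel
  refine ⟨B, κ, hB, hd', fun i η hη => ?_⟩
  obtain ⟨a, b, hab, hw, h⟩ := exists_dPart_eq S.toAlmostHermitian i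
  rw [h]
  set f := frameRep η x₀ P with hf
  -- the operators that make up `d`, the forms to which they are applied, and their weights
  let ι := Unit ⊕ Fin 3 ⊕ Fin 3 ⊕ Unit
  let O : ι → Module.End ℂ Fiber := Sum.elim
    (fun _ => starRingEnd ℂ κ • cyclic (creA cre) (creA cre) (annB ann))
    (Sum.elim (creA cre) (Sum.elim (creB cre)
      (fun _ => κ • cyclic (creB cre) (creB cre) (annA ann))))
  let ξ : ι → (Model → Fiber) → Fiber := Sum.elim (fun _ f => f y)
    (Sum.elim (covDerivZ P B y) (Sum.elim (covDerivZBar P B y) (fun _ f => f y)))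
  let w : ι → ℤ := Sum.elim (fun _ => 3) (Sum.elim (fun _ => 1) (Sum.elim (fun _ => -1)
    (fun _ => -3)))
  have hO1 : ∀ j, HasDegree 1 (O j) := by
    rintro (_ | j | j | _)
    · exact (HasDegree.cyclic hasDegree_creA hasDegree_annB).smul _
    · exact hasDegree_creA j
    · exact hasDegree_creB j
    · exact (HasDegree.cyclic hasDegree_creB hasDegree_annA).smul _
  have hOw : ∀ j, HasShift (w j) (O j) := by
    rintro (_ | j | j | _)
    · exact (HasShift.cyclic hasShift_creA hasShift_annB).smul _
    · exact hasShift_creA j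
    · exact hasShift_creB j
    · exact (HasShift.cyclic hasShift_creB hasShift_annA).smul _
  have hsum : ∀ g, ∑ i, localOp P B κ y i g = ∑ j, O j (ξ j g) := by
    intro g
    simp only [ι, Fintype.sum_sum_type, Fin.sum_univ_four, Finset.univ_unique,
      Finset.sum_singleton, ← add_assoc]
    rfl
  have hmap : ∀ j k p q, ξ j (fun z => stdType k p q (f z)) = stdType k p q (ξ j f) := by
    rintro (_ | j | j | _) k p q
    · rfl
    · exact covDerivZ_map hB hP.isOpen hy (hP.smoothOn_frameRep hη) (isInvariant_stdType k p q) j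
    · exact covDerivZBar_map hB hP.isOpen hy (hP.smoothOn_frameRep hη) (isInvariant_stdType k p q) j
    · rfl
  have hloc : localOp P B κ y i f = ∑ j, if w j = a - b then O j (ξ j f) else 0 := by
    rw [hw]
    simp only [ι, Fintype.sum_sum_type, w, Sum.elim_inl, Sum.elim_inr]
    fin_cases i <;> simp [dPartWeight] <;> rfl
  have hpart : ∀ k p q, frameRep (deRham (typePart S.toAlmostHermitian k p q η)) x₀ P y =
      ∑ j, O j (stdType k p q (ξ j f)) := by
    intro k p q
    have hr := represents_typePart S.toAlmostHermitian k p q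
    rw [hd' _ (hr.isSmoothMixed hη), Finset.sum_congr rfl fun i _ =>
      localOp_congr hP.isOpen hy (fun z hz => hr.frameRep hP η hz) i]
    refine (hsum _).trans (Finset.sum_congr rfl fun j _ => ?_)
    exact congrArg (O j) (hmap j k p q)
  rw [hloc]
  funext m
  rcases m with _ | k
  · rw [Finset.sum_apply, Finset.sum_eq_zero]
    · rfl
    · intro j _
      split_ifs
      · exact hO1 j _ 0 fun k hk => by exfalso; omega
      · rfl
  · have h1 : frameRep (S.dComp a b η) x₀ P y (k + 1) = frameRep (∑ p ∈ Finset.range (k + 1),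
        typePart S.toAlmostHermitian (k + 1) (p + a) ((k : ℤ) - p + b)
        (deRham (typePart S.toAlmostHermitian k p ((k : ℤ) - p) η))) x₀ P y (k + 1) := by
      exact frameRep_congr_degree (dComp_succ S.toAlmostHermitian a b η k)
    rw [h1, frameRep_sum, Finset.sum_apply, Finset.sum_apply]
    have h3 : ∀ p ∈ Finset.range (k + 1), frameRep (typePart S.toAlmostHermitian (k + 1) (p + a)
        ((k : ℤ) - p + b) (deRham (typePart S.toAlmostHermitian k p ((k : ℤ) - p) η))) x₀ P y
          (k + 1) =
        ∑ j, stdType (k + 1) (p + a) ((k : ℤ) - p + b)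
          (O j (stdType k p ((k : ℤ) - p) (ξ j f))) (k + 1) := by
      intro p _
      rw [(represents_typePart S.toAlmostHermitian _ _ _).frameRep hP _ hy, hpart, _root_.map_sum,
        Finset.sum_apply]
      rfl
    rw [Finset.sum_congr rfl h3, Finset.sum_comm]
    exact Finset.sum_congr rfl fun j _ => sum_stdType_shift (hO1 j) (hOw j) hab k (ξ j f)

end

/-! ### The Kähler identities in a unitary frame -/

section

variable {P : Model → Model →L[ℝ] Model} {B : Fin 6 → Model →L[ℝ] Model} {W : Set Model}
  {y : Model} {f g : Model → Fiber} {κ : ℂ}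

theorem covDeriv_add (hW : IsOpen W) (hy : y ∈ W) (hf : SmoothOn f W) (hg : SmoothOn g W)
    (i : Fin 6) : covDeriv P B y i (f + g) = covDeriv P B y i f + covDeriv P B y i g := by
  have h : dirDeriv (f + g) y (P y (stdVec i)) =
      dirDeriv f y (P y (stdVec i)) + dirDeriv g y (P y (stdVec i)) := by
    funext k
    have := fderiv_add (hf.differentiableAt hW hy k) (hg.differentiableAt hW hy k)
    exact congrArg (fun L : Model →L[ℝ] Model [⋀^Fin k]→L[ℝ] ℂ => L (P y (stdVec i))) this
  rw [covDeriv, covDeriv, covDeriv, h, Pi.add_apply, _root_.map_add]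
  abel

theorem localOp_add (hW : IsOpen W) (hy : y ∈ W) (hf : SmoothOn f W) (hg : SmoothOn g W)
    (i : Fin 4) : localOp P B κ y i (f + g) = localOp P B κ y i f + localOp P B κ y i g := by
  have hZ : ∀ k, covDerivZ P B y k (f + g) = covDerivZ P B y k f + covDerivZ P B y k g := by
    intro k
    rw [covDerivZ, covDerivZ, covDerivZ, covDeriv_add hW hy hf hg, covDeriv_add hW hy hf hg]
    module
  have hZ' : ∀ k, covDerivZBar P B y k (f + g) =
      covDerivZBar P B y k f + covDerivZBar P B y k g := by
    intro k
    rw [covDerivZBar, covDerivZBar, covDerivZBar, covDeriv_add hW hy hf hg,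
      covDeriv_add hW hy hf hg]
    module
  match i with
  | 0 => exact _root_.map_add _ _ _
  | 1 =>
    rw [localOp_del, localOp_del, localOp_del, ← Finset.sum_add_distrib]
    exact Finset.sum_congr rfl fun k _ => by rw [hZ, _root_.map_add]
  | 2 =>
    rw [localOp_delBar, localOp_delBar, localOp_delBar, ← Finset.sum_add_distrib]
    exact Finset.sum_congr rfl fun k _ => by rw [hZ', _root_.map_add]
  | 3 => exact _root_.map_add _ _ _

theorem neg_one_smul_fiber (v : Fiber) : (-1 : ℂ) • v = -v := by
  funext k
  exact neg_one_smul ℂ (v k)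

theorem cyclic_parity {x z : Fin 3 → Module.End ℂ Fiber}
    (hx : ∀ i v, x i (parity v) = -parity (x i v))
    (hz : ∀ i v, z i (parity v) = -parity (z i v)) (v : Fiber) :
    cyclic x x z (parity v) = -parity (cyclic x x z v) := by
  have h : ∀ i j k, (x i * x j * z k) (parity v) = -parity ((x i * x j * z k) v) := by
    intro i j k
    simp only [Module.End.mul_apply, hx, hz, _root_.map_neg, neg_neg]
  simp only [cyclic, LinearMap.add_apply, h, _root_.map_add, neg_add]

theorem creA_parity (k : Fin 3) (v : Fiber) : creA cre k (parity v) = -parity (creA cre k v) := by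
  simp only [creA, LinearMap.add_apply, LinearMap.smul_apply, _root_.map_add, _root_.map_smul,
    parity_cre]
  module

theorem creB_parity (k : Fin 3) (v : Fiber) : creB cre k (parity v) = -parity (creB cre k v) := by
  simp only [creB, LinearMap.sub_apply, LinearMap.smul_apply, _root_.map_sub, _root_.map_smul,
    parity_cre]
  module

theorem annA_parity (k : Fin 3) (v : Fiber) : annA ann k (parity v) = -parity (annA ann k v) := by
  have := LinearMap.congr_fun (starConj_stdStar.Pα k) v
  exact neg_eq_iff_eq_neg.mp this.symm

theorem annB_parity (k : Fin 3) (v : Fiber) : annB ann k (parity v) = -parity (annB ann k v) := by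
  have := LinearMap.congr_fun (starConj_stdStar.Pβ k) v
  exact neg_eq_iff_eq_neg.mp this.symm

theorem localOp_parity (hB : ∀ i, IsSkewHermitian (B i)) (hW : IsOpen W) (hy : y ∈ W)
    (hf : SmoothOn f W) (i : Fin 4) :
    localOp P B κ y i (fun z => parity (f z)) = -parity (localOp P B κ y i f) := by
  refine (localOp_map (c := fun _ => -1) hB hW hy hf isInvariant_parity
    (fun v => ?_) (fun k v => ?_) (fun k v => ?_) (fun v => ?_) i).trans (neg_one_smul_fiber _)
  · rw [cyclic_parity creA_parity annB_parity, neg_one_smul_fiber]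
  · rw [creA_parity, neg_one_smul_fiber]
  · rw [creB_parity, neg_one_smul_fiber]
  · rw [cyclic_parity creB_parity annA_parity, neg_one_smul_fiber]

/-- The Hermitian adjoints of the local expressions. -/
def localAdj (P : Model → Model →L[ℝ] Model) (B : Fin 6 → Model →L[ℝ] Model) (κ : ℂ) (y : Model)
    (i : Fin 4) (f : Model → Fiber) : Fiber :=
  -stdStar (localOp P B κ y i fun z => stdStar (f z))

theorem localAdj_del (hB : ∀ i, IsSkewHermitian (B i)) (hW : IsOpen W) (hy : y ∈ W)
    (hf : SmoothOn f W) :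
    localAdj P B κ y 1 f = -∑ k, (2 : ℂ) • annA ann k (covDerivZBar P B y k f) := by
  rw [localAdj, localOp_del, _root_.map_sum]
  congr 1
  refine Finset.sum_congr rfl fun k _ => ?_
  rw [covDerivZ_star hB hW hy hf]
  exact LinearMap.congr_fun (starConj_stdStar.star_a k) _

theorem localAdj_delBar (hB : ∀ i, IsSkewHermitian (B i)) (hW : IsOpen W) (hy : y ∈ W)
    (hf : SmoothOn f W) :
    localAdj P B κ y 2 f = -∑ k, (2 : ℂ) • annB ann k (covDerivZ P B y k f) := by
  rw [localAdj, localOp_delBar, _root_.map_sum]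
  congr 1
  refine Finset.sum_congr rfl fun k _ => ?_
  rw [covDerivZBar_star hB hW hy hf]
  exact LinearMap.congr_fun (starConj_stdStar.star_b k) _

/-- The commutator of the contraction `Λ` with `∂`: `[Λ, ∂] = √-1 ∂̄*`. -/
theorem contraction_comm_del (hB : ∀ i, IsSkewHermitian (B i)) (hW : IsOpen W) (hy : y ∈ W)
    (hf : SmoothOn f W) :
    contraction (localOp P B κ y 1 f) - localOp P B κ y 1 (fun z => contraction (f z)) =
      Complex.I • localAdj P B κ y 2 f := by
  rw [localAdj_delBar hB hW hy hf, localOp_del, localOp_del, _root_.map_sum,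
    ← Finset.sum_sub_distrib, ← Finset.sum_neg_distrib, Finset.smul_sum]
  refine Finset.sum_congr rfl fun k _ => ?_
  rw [covDerivZ_map hB hW hy hf isInvariant_contraction]
  refine (LinearMap.congr_fun (car.lefschetzDual_comm_a k) _).trans ?_
  rw [LinearMap.smul_apply]
  module

/-- The commutator of the contraction `Λ` with `∂̄`: `[Λ, ∂̄] = -√-1 ∂*`. -/
theorem contraction_comm_delBar (hB : ∀ i, IsSkewHermitian (B i)) (hW : IsOpen W) (hy : y ∈ W)
    (hf : SmoothOn f W) :
    contraction (localOp P B κ y 2 f) - localOp P B κ y 2 (fun z => contraction (f z)) =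
      -(Complex.I • localAdj P B κ y 1 f) := by
  rw [localAdj_del hB hW hy hf, localOp_delBar, localOp_delBar, _root_.map_sum,
    ← Finset.sum_sub_distrib, ← Finset.sum_neg_distrib, Finset.smul_sum,
    ← Finset.sum_neg_distrib]
  refine Finset.sum_congr rfl fun k _ => ?_
  rw [covDerivZBar_map hB hW hy hf isInvariant_contraction]
  refine (LinearMap.congr_fun (car.lefschetzDual_comm_b k) _).trans ?_
  rw [LinearMap.smul_apply]
  module

theorem comm_apply_of_comm_eq {L X Y : Module.End ℂ Fiber}
    (h : L * X - X * L = (2 * Complex.I) • -Y)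
    (v : Fiber) : L (X v) - X (L v) = (2 : ℂ) • (Complex.I • -Y v) := by
  have h1 := LinearMap.congr_fun h v
  rw [smul_smul]
  exact h1

theorem comm_apply_of_comm_eq_neg {L X Y : Module.End ℂ Fiber}
    (h : L * X - X * L = -(2 * Complex.I) • -Y) (v : Fiber) :
    L (X v) - X (L v) = -((2 : ℂ) • (Complex.I • -Y v)) := by
  have h1 := LinearMap.congr_fun h v
  rw [smul_smul]
  refine h1.trans (funext fun k => ?_)
  exact neg_smul (2 * Complex.I) (-Y v k)

theorem contraction_comm_cyclic_a (κ : ℂ) :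
    contraction * (starRingEnd ℂ κ • cyclic (creA cre) (creA cre) (annB ann)) -
      (starRingEnd ℂ κ • cyclic (creA cre) (creA cre) (annB ann)) * contraction =
      (2 * Complex.I) • -starConj (κ • cyclic (creB cre) (creB cre) (annA ann)) := by
  have h := lefschetzDual_comm_N car starConj_stdStar κ
  rw [contraction]
  with_reducible exact h

theorem contraction_comm_cyclic_b (κ : ℂ) :
    contraction * (κ • cyclic (creB cre) (creB cre) (annA ann)) -
      (κ • cyclic (creB cre) (creB cre) (annA ann)) * contraction =
      -(2 * Complex.I) • -starConj (starRingEnd ℂ κ • cyclic (creA cre) (creA cre) (annB ann)) := by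
  have h := lefschetzDual_comm_NBar car starConj_stdStar κ
  rw [contraction]
  with_reducible exact h

/-- The commutator of the contraction `Λ` with `N`: `[Λ, N] = 2√-1 N̄*`. -/
theorem contraction_comm_N :
    contraction (localOp P B κ y 0 f) - localOp P B κ y 0 (fun z => contraction (f z)) =
      (2 : ℂ) • (Complex.I • localAdj P B κ y 3 f) := by
  rw [localAdj, localOp_N, localOp_N, localOp_NBar]
  have h := comm_apply_of_comm_eq (contraction_comm_cyclic_a κ) (f y)
  rw [starConj_apply] at h
  with_reducible exact h

/-- The commutator of the contraction `Λ` with `N̄`: `[Λ, N̄] = -2√-1 N*`. -/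
theorem contraction_comm_NBar :
    contraction (localOp P B κ y 3 f) - localOp P B κ y 3 (fun z => contraction (f z)) =
      -((2 : ℂ) • (Complex.I • localAdj P B κ y 0 f)) := by
  rw [localAdj, localOp_NBar, localOp_NBar, localOp_N]
  have h := comm_apply_of_comm_eq_neg (contraction_comm_cyclic_b κ) (f y)
  rw [starConj_apply] at h
  with_reducible exact h

end

/-! ### Relations between the operators on smooth forms -/

section

variable {M : Type*} [TopologicalSpace M] [ChartedSpace Model M] [IsManifold (𝓡 6) ∞ M]
  {x₀ : M} {W : Set Model} {P Q : Model → Model →L[ℝ] Model} {y : Model}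

/-- Real-linear operators on smooth forms. -/
structure IsSmoothOp (O : FormOp M) : Prop where
  smooth : ∀ η, IsSmoothMixed η → IsSmoothMixed (O η)
  add : ∀ η ξ, IsSmoothMixed η → IsSmoothMixed ξ → O (η + ξ) = O η + O ξ
  smul : ∀ (c : ℝ) (η), IsSmoothMixed η → O (c • η) = c • O η

variable (M) in
/-- The space of smooth forms. -/
def smoothForms : Submodule ℝ (MixedForm M) where
  carrier := {η | IsSmoothMixed η}
  add_mem' h h' := h.add h'
  zero_mem' := isSmoothMixed_zero
  smul_mem' c η h := by
    rw [real_smul_eq]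
    exact IsSmoothMixed.smul _ h

/-- The operator induced on the space of smooth forms. -/
def IsSmoothOp.toEnd {O : FormOp M} (h : IsSmoothOp O) : Module.End ℝ (smoothForms M) where
  toFun η := ⟨O η.1, h.smooth η.1 η.2⟩
  map_add' η ξ := Subtype.ext (h.add η.1 ξ.1 η.2 ξ.2)
  map_smul' c η := Subtype.ext (h.smul c η.1 η.2)

theorem Represents.isSmoothOp {H : AlmostHermitian M} {O : FormOp M} {O₀ : Fiber →ₗ[ℝ] Fiber}
    (hO : Represents H O O₀) : IsSmoothOp O where
  smooth _ hη := hO.isSmoothMixed hη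
  add η ξ _ _ := frameRep_ext H fun x₀ W P Q y hP hy => by
    rw [frameRep_add, hO.frameRep hP _ hy, hO.frameRep hP _ hy, hO.frameRep hP _ hy, frameRep_add,
      _root_.map_add]
  smul c η _ := frameRep_ext H fun x₀ W P Q y hP hy => by
    rw [frameRep_real_smul, hO.frameRep hP _ hy, hO.frameRep hP _ hy, frameRep_real_smul,
      _root_.map_smul]

theorem represents_smul (H : AlmostHermitian M) (c : ℂ) :
    Represents H (fun η => c • η) ((LinearMap.lsmul ℂ Fiber c).restrictScalars ℝ) :=
  fun _ _ _ _ => rfl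

section

variable {S : SU3Structure M} (hS : S.IsNearlyKahler)
include hS

theorem dPart_add (i : Fin 4) {η ξ : MixedForm M} (hη : IsSmoothMixed η) (hξ : IsSmoothMixed ξ) :
    dPart S.toAlmostHermitian i (η + ξ) =
      dPart S.toAlmostHermitian i η + dPart S.toAlmostHermitian i ξ := by
  refine frameRep_ext S.toAlmostHermitian fun x₀ W P Q y hP hy => ?_
  obtain ⟨B, κ, hB, -, hc⟩ := hP.exists_localOp hS hy
  rw [frameRep_add, hc i _ (hη.add hξ), hc i _ hη, hc i _ hξ]
  exact localOp_add hP.isOpen hy (hP.smoothOn_frameRep hη) (hP.smoothOn_frameRep hξ) i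

theorem dPart_smul (i : Fin 4) (c : ℂ) {η : MixedForm M} (hη : IsSmoothMixed η) :
    dPart S.toAlmostHermitian i (c • η) = c • dPart S.toAlmostHermitian i η := by
  refine frameRep_ext S.toAlmostHermitian fun x₀ W P Q y hP hy => ?_
  obtain ⟨B, κ, hB, -, hc⟩ := hP.exists_localOp hS hy
  rw [frameRep_smul, hc i _ (hη.smul c), hc i _ hη]
  exact localOp_smul hB hP.isOpen hy (hP.smoothOn_frameRep hη) c i

theorem isSmoothOp_dPart (i : Fin 4) : IsSmoothOp (dPart S.toAlmostHermitian i) where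
  smooth _ hη := isSmoothMixed_dPart _ i hη
  add _ _ hη hξ := dPart_add hS i hη hξ
  smul c η hη := by rw [real_smul_eq, real_smul_eq, dPart_smul hS i _ hη]

/-- The de Rham differential is the sum of its components `N`, `∂`, `∂̄` and `N̄`, all other
bidegrees being absent. -/
theorem deRham_eq_sum_dPart {η : MixedForm M} (hη : IsSmoothMixed η) :
    deRham η = ∑ i, dPart S.toAlmostHermitian i η := by
  refine frameRep_ext S.toAlmostHermitian fun x₀ W P Q y hP hy => ?_
  obtain ⟨B, κ, hB, hd, hc⟩ := hP.exists_localOp hS hy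
  rw [hd η hη, frameRep_sum]
  exact Finset.sum_congr rfl fun i _ => (hc i η hη).symm

omit hS in
theorem IsUnitaryFrame.frameRep_dPart_map {κ : ℂ} {B : Fin 6 → Model →L[ℝ] Model}
    (hP : IsUnitaryFrame S.toAlmostHermitian x₀ W P Q) (hy : y ∈ W)
    (hc : ∀ i (η : MixedForm M), IsSmoothMixed η →
      frameRep (dPart S.toAlmostHermitian i η) x₀ P y = localOp P B κ y i (frameRep η x₀ P))
    {O : FormOp M} {O₀ : Fiber →ₗ[ℝ] Fiber} (hO : Represents S.toAlmostHermitian O O₀)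
    (i : Fin 4) {η : MixedForm M} (hη : IsSmoothMixed η) :
    frameRep (dPart S.toAlmostHermitian i (O η)) x₀ P y =
      localOp P B κ y i (fun z => O₀ (frameRep η x₀ P z)) := by
  rw [hc i _ (hO.isSmoothMixed hη)]
  exact localOp_congr hP.isOpen hy (fun z hz => hO.frameRep hP η hz) i

omit hS in
theorem IsUnitaryFrame.frameRep_adj {κ : ℂ} {B : Fin 6 → Model →L[ℝ] Model}
    (hP : IsUnitaryFrame S.toAlmostHermitian x₀ W P Q) (hy : y ∈ W)
    (hc : ∀ i (η : MixedForm M), IsSmoothMixed η →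
      frameRep (dPart S.toAlmostHermitian i η) x₀ P y = localOp P B κ y i (frameRep η x₀ P))
    (i : Fin 4) {η : MixedForm M} (hη : IsSmoothMixed η) :
    frameRep (S.adj (dPart S.toAlmostHermitian i) η) x₀ P y =
      localAdj P B κ y i (frameRep η x₀ P) := by
  rw [AlmostHermitian.adj, frameRep_neg, represents_star.frameRep hP _ hy,
    hP.frameRep_dPart_map hy hc represents_star i hη]
  rfl

/-- The action of the circle on forms. -/
def rotForm (H : AlmostHermitian M) (ζ : Circle) : FormOp M :=
  liftOp H ((rot ζ).restrictScalars ℝ)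

omit hS in
theorem represents_rotForm (H : AlmostHermitian M) (ζ : Circle) :
    Represents H (rotForm H ζ) ((rot ζ).restrictScalars ℝ) :=
  represents_liftOp H (isInvariant_rot ζ)

theorem dPart_rotForm (ζ : Circle) (i : Fin 4) {η : MixedForm M} (hη : IsSmoothMixed η) :
    dPart S.toAlmostHermitian i (rotForm S.toAlmostHermitian ζ η) =
      ((ζ : ℂ) ^ (-dPartWeight i)) •
        rotForm S.toAlmostHermitian ζ (dPart S.toAlmostHermitian i η) := by
  refine frameRep_ext S.toAlmostHermitian fun x₀ W P Q y hP hy => ?_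
  obtain ⟨B, κ, hB, -, hc⟩ := hP.exists_localOp hS hy
  have hr := represents_rotForm S.toAlmostHermitian ζ
  rw [hP.frameRep_dPart_map hy hc hr i hη, frameRep_smul, hr.frameRep hP _ hy, hc i η hη]
  exact localOp_rot hB hP.isOpen hy (hP.smoothOn_frameRep hη) ζ i

theorem dPart_sum (i : Fin 4) {ι : Type*} (s : Finset ι) {η : ι → MixedForm M}
    (hη : ∀ j ∈ s, IsSmoothMixed (η j)) :
    dPart S.toAlmostHermitian i (∑ j ∈ s, η j) = ∑ j ∈ s, dPart S.toAlmostHermitian i (η j) := by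
  induction s using Finset.cons_induction with
  | empty =>
    have := dPart_add hS i (isSmoothMixed_zero (M := M)) isSmoothMixed_zero
    rw [add_zero] at this
    exact left_eq_add.mp this
  | cons j s hj ih =>
    rw [Finset.sum_cons, Finset.sum_cons, dPart_add hS i (hη j (Finset.mem_cons_self j s))
      (IsSmoothMixed.sum fun l hl => hη l (Finset.mem_cons_of_mem hl)),
      ih fun l hl => hη l (Finset.mem_cons_of_mem hl)]

/-- The components of `d² = 0`, separated by their weights under the action of the circle. -/
theorem sum_dPart_dPart_eq_zero (m : ℤ) {η : MixedForm M} (hη : IsSmoothMixed η) :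
    ∑ i, ∑ j, (if dPartWeight i + dPartWeight j = m then
      dPart S.toAlmostHermitian i (dPart S.toAlmostHermitian j η) else 0) = 0 := by
  refine frameRep_ext S.toAlmostHermitian fun x₀ W P Q y hP hy => ?_
  set F : Fin 4 × Fin 4 → Fiber := fun p => frameRep
    (dPart S.toAlmostHermitian p.1 (dPart S.toAlmostHermitian p.2 η)) x₀ P y with hF
  have key : ∀ ζ : Circle, ∑ p, ((ζ : ℂ) ^ (-(dPartWeight p.1 + dPartWeight p.2))) • F p = 0 := by
    intro ζ
    have hr := represents_rotForm S.toAlmostHermitian ζ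
    have h1 := deRham_deRham (hr.isSmoothMixed hη)
    have h2 : ∀ i j, dPart S.toAlmostHermitian i (dPart S.toAlmostHermitian j
        (rotForm S.toAlmostHermitian ζ η)) = ((ζ : ℂ) ^ (-(dPartWeight i + dPartWeight j))) •
        rotForm S.toAlmostHermitian ζ
          (dPart S.toAlmostHermitian i (dPart S.toAlmostHermitian j η)) := by
      intro i j
      have hj := isSmoothMixed_dPart S.toAlmostHermitian j hη
      rw [dPart_rotForm hS ζ j hη, dPart_smul hS i _ (hr.isSmoothMixed hj), dPart_rotForm hS ζ i hj,
        smul_smul, ← zpow_add₀ ζ.coe_ne_zero]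
      congr 2
      ring
    have h3 : ∀ j ∈ Finset.univ, IsSmoothMixed
        (dPart S.toAlmostHermitian j (rotForm S.toAlmostHermitian ζ η)) :=
      fun j _ => isSmoothMixed_dPart _ j (hr.isSmoothMixed hη)
    rw [deRham_eq_sum_dPart hS (hr.isSmoothMixed hη),
      deRham_eq_sum_dPart hS (IsSmoothMixed.sum h3)] at h1
    simp only [dPart_sum hS _ _ h3, h2] at h1
    have h4 := congrArg (fun ξ => rot ζ⁻¹ (frameRep ξ x₀ P y)) h1
    simp only [frameRep_sum, frameRep_smul, hr.frameRep hP _ hy, frameRep_zero] at h4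
    have h5 : ∀ v : Fiber, rot ζ⁻¹ (rot ζ v) = v := by
      intro v
      rw [rot_rot, mul_inv_cancel]
      refine pull_eq_self (fun w => ?_) v
      simp [rotMap_apply]
    rw [Fintype.sum_prod_type]
    refine Eq.trans ?_ (h4.trans (_root_.map_zero _))
    rw [_root_.map_sum]
    refine Finset.sum_congr rfl fun i _ => ?_
    rw [_root_.map_sum]
    refine Finset.sum_congr rfl fun j _ => ?_
    rw [_root_.map_smul]
    exact congrArg _ (h5 _).symm
  rw [frameRep_sum, frameRep_zero]
  funext k
  ext v
  have h6 := laurent_coeff_eq_zero Finset.univ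
    (fun p : Fin 4 × Fin 4 => -(dPartWeight p.1 + dPartWeight p.2)) (fun p => F p k v)
    (fun ζ => by
      have := congrArg (fun t : Fiber => t k v) (key ζ)
      simp only [Finset.sum_apply] at this
      rw [ContinuousAlternatingMap.sum_apply] at this
      exact this) (-m)
  rw [Finset.sum_apply, ContinuousAlternatingMap.sum_apply]
  rw [Finset.sum_filter, Fintype.sum_prod_type] at h6
  refine Eq.trans (Finset.sum_congr rfl fun i _ => ?_) h6
  rw [frameRep_sum, Finset.sum_apply, ContinuousAlternatingMap.sum_apply]
  refine Finset.sum_congr rfl fun j _ => ?_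
  simp only [neg_inj]
  split_ifs <;> rfl

end

end

/-! ### The Laplacian identity -/

variable (M : Type*) [TopologicalSpace M] [ChartedSpace Model M] in
/-- The ring of real-linear operators on smooth forms. -/
def SmoothOps : Type _ := Module.End ℝ (smoothForms M)

namespace SmoothOps

variable {M : Type*} [TopologicalSpace M] [ChartedSpace Model M]

instance : AddCommGroup (smoothForms M) := Submodule.addCommGroup _

instance : Ring (SmoothOps M) := inferInstanceAs (Ring (Module.End ℝ (smoothForms M)))

instance : Algebra ℝ (SmoothOps M) :=
  inferInstanceAs (Algebra ℝ (Module.End ℝ (smoothForms M)))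

/-- The value of an operator on a smooth form. -/
def apply (A : SmoothOps M) (ξ : smoothForms M) : MixedForm M :=
  ((show Module.End ℝ (smoothForms M) from A) ξ).1

theorem ext_apply {A B : SmoothOps M} (h : ∀ ξ, A.apply ξ = B.apply ξ) : A = B :=
  LinearMap.ext fun ξ => Subtype.ext (h ξ)

theorem add_apply (A B : SmoothOps M) (ξ : smoothForms M) :
    (A + B).apply ξ = A.apply ξ + B.apply ξ := rfl

theorem neg_apply (A : SmoothOps M) (ξ : smoothForms M) : (-A).apply ξ = -A.apply ξ := rfl

/-- The operator on smooth forms induced by an operator on forms. -/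
def of {O : FormOp M} (h : IsSmoothOp O) : SmoothOps M := h.toEnd

theorem of_apply {O : FormOp M} (h : IsSmoothOp O) (ξ : smoothForms M) : (of h).apply ξ = O ξ.1 :=
  rfl

theorem isSmoothMixed_apply (A : SmoothOps M) (ξ : smoothForms M) : IsSmoothMixed (A.apply ξ) :=
  ((show Module.End ℝ (smoothForms M) from A) ξ).2

theorem sum_apply {ι : Type*} (s : Finset ι) (A : ι → SmoothOps M) (ξ : smoothForms M) :
    (∑ i ∈ s, A i).apply ξ = ∑ i ∈ s, (A i).apply ξ := by
  induction s using Finset.cons_induction with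
  | empty => rw [Finset.sum_empty, Finset.sum_empty]; rfl
  | cons i s hi ih => rw [Finset.sum_cons, Finset.sum_cons, add_apply, ih]

/-- The anticommutator of operators that are represented by `A` and `A'` on smooth forms. -/
theorem anticomm_eq {D D' : FormOp M} {A A' : SmoothOps M}
    (h : ∀ ξ : smoothForms M, D ξ.1 = A.apply ξ) (h' : ∀ ξ : smoothForms M, D' ξ.1 = A'.apply ξ)
    (ξ : smoothForms M) : anticomm D D' ξ.1 = (A * A' + A' * A).apply ξ := by
  rw [add_apply]
  exact congrArg₂ (· + ·) ((congrArg D (h' ξ)).trans (h ⟨A'.apply ξ, A'.isSmoothMixed_apply ξ⟩))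
    ((congrArg D' (h ξ)).trans (h' ⟨A.apply ξ, A.isSmoothMixed_apply ξ⟩))

end SmoothOps

section

variable {M : Type*} [TopologicalSpace M] [ChartedSpace Model M] [IsManifold (𝓡 6) ∞ M]
  {S : SU3Structure M} (hS : S.IsNearlyKahler)

/-- The contraction of forms with the Hermitian form. -/
def contractionForm (H : AlmostHermitian M) : FormOp M :=
  liftOp H (contraction.restrictScalars ℝ)

theorem represents_contractionForm (H : AlmostHermitian M) :
    Represents H (contractionForm H) (contraction.restrictScalars ℝ) :=
  represents_liftOp H isInvariant_contraction

/-- The parity operator on forms. -/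
def parityForm (H : AlmostHermitian M) : FormOp M := liftOp H (parity.restrictScalars ℝ)

theorem represents_parityForm (H : AlmostHermitian M) :
    Represents H (parityForm H) (parity.restrictScalars ℝ) :=
  represents_liftOp H isInvariant_parity

theorem star_star (H : AlmostHermitian M) (η : MixedForm M) :
    H.star (H.star η) = parityForm H η :=
  frameRep_ext H fun x₀ W P Q y hP hy => by
    rw [represents_star.frameRep hP _ hy, represents_star.frameRep hP _ hy,
      (represents_parityForm H).frameRep hP _ hy]
    exact stdStar_stdStar _

theorem parityForm_parityForm (H : AlmostHermitian M) (η : MixedForm M) :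
    parityForm H (parityForm H η) = η :=
  frameRep_ext H fun x₀ W P Q y hP hy => by
    rw [(represents_parityForm H).frameRep hP _ hy, (represents_parityForm H).frameRep hP _ hy]
    exact parity_parity _

include hS

theorem parityForm_dPart (i : Fin 4) {η : MixedForm M} (hη : IsSmoothMixed η) :
    parityForm S.toAlmostHermitian (dPart S.toAlmostHermitian i η) =
      -dPart S.toAlmostHermitian i (parityForm S.toAlmostHermitian η) := by
  refine frameRep_ext S.toAlmostHermitian fun x₀ W P Q y hP hy => ?_
  obtain ⟨B, κ, hB, -, hc⟩ := hP.exists_localOp hS hy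
  have hr := represents_parityForm S.toAlmostHermitian
  rw [frameRep_neg, hP.frameRep_dPart_map hy hc hr i hη, hr.frameRep hP _ hy, hc i η hη]
  refine Eq.trans ?_ (congrArg Neg.neg
    (localOp_parity hB hP.isOpen hy (hP.smoothOn_frameRep hη) i).symm)
  exact (neg_neg _).symm

omit hS in
theorem IsUnitaryFrame.frameRep_contractionForm_comm {x₀ : M} {W : Set Model}
    {P Q : Model → Model →L[ℝ] Model} {y : Model} {κ : ℂ} {B : Fin 6 → Model →L[ℝ] Model}
    (hP : IsUnitaryFrame S.toAlmostHermitian x₀ W P Q) (hy : y ∈ W)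
    (hc : ∀ i (η : MixedForm M), IsSmoothMixed η →
      frameRep (dPart S.toAlmostHermitian i η) x₀ P y = localOp P B κ y i (frameRep η x₀ P))
    (i : Fin 4) {η : MixedForm M} (hη : IsSmoothMixed η) :
    frameRep (contractionForm S.toAlmostHermitian (dPart S.toAlmostHermitian i η) -
      dPart S.toAlmostHermitian i (contractionForm S.toAlmostHermitian η)) x₀ P y =
    contraction (localOp P B κ y i (frameRep η x₀ P)) -
      localOp P B κ y i (fun z => contraction (frameRep η x₀ P z)) := by
  have hr := represents_contractionForm S.toAlmostHermitian
  rw [frameRep_sub, hP.frameRep_dPart_map hy hc hr i hη, hr.frameRep hP _ hy, hc i η hη]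
  rfl

theorem contractionForm_comm_del {η : MixedForm M} (hη : IsSmoothMixed η) :
    contractionForm S.toAlmostHermitian (dPart S.toAlmostHermitian 1 η) -
      dPart S.toAlmostHermitian 1 (contractionForm S.toAlmostHermitian η) =
      Complex.I • S.adj (dPart S.toAlmostHermitian 2) η := by
  refine frameRep_ext S.toAlmostHermitian fun x₀ W P Q y hP hy => ?_
  obtain ⟨B, κ, hB, -, hc⟩ := hP.exists_localOp hS hy
  rw [hP.frameRep_contractionForm_comm hy hc 1 hη, frameRep_smul, hP.frameRep_adj hy hc 2 hη]
  exact contraction_comm_del hB hP.isOpen hy (hP.smoothOn_frameRep hη)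

theorem contractionForm_comm_delBar {η : MixedForm M} (hη : IsSmoothMixed η) :
    contractionForm S.toAlmostHermitian (dPart S.toAlmostHermitian 2 η) -
      dPart S.toAlmostHermitian 2 (contractionForm S.toAlmostHermitian η) =
      -(Complex.I • S.adj (dPart S.toAlmostHermitian 1) η) := by
  refine frameRep_ext S.toAlmostHermitian fun x₀ W P Q y hP hy => ?_
  obtain ⟨B, κ, hB, -, hc⟩ := hP.exists_localOp hS hy
  rw [hP.frameRep_contractionForm_comm hy hc 2 hη, frameRep_neg, frameRep_smul,
    hP.frameRep_adj hy hc 1 hη]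
  exact contraction_comm_delBar hB hP.isOpen hy (hP.smoothOn_frameRep hη)

theorem contractionForm_comm_N {η : MixedForm M} (hη : IsSmoothMixed η) :
    contractionForm S.toAlmostHermitian (dPart S.toAlmostHermitian 0 η) -
      dPart S.toAlmostHermitian 0 (contractionForm S.toAlmostHermitian η) =
      (2 : ℂ) • Complex.I • S.adj (dPart S.toAlmostHermitian 3) η := by
  refine frameRep_ext S.toAlmostHermitian fun x₀ W P Q y hP hy => ?_
  obtain ⟨B, κ, hB, -, hc⟩ := hP.exists_localOp hS hy
  rw [hP.frameRep_contractionForm_comm hy hc 0 hη, frameRep_smul, frameRep_smul,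
    hP.frameRep_adj hy hc 3 hη]
  exact contraction_comm_N

theorem contractionForm_comm_NBar {η : MixedForm M} (hη : IsSmoothMixed η) :
    contractionForm S.toAlmostHermitian (dPart S.toAlmostHermitian 3 η) -
      dPart S.toAlmostHermitian 3 (contractionForm S.toAlmostHermitian η) =
      -((2 : ℂ) • Complex.I • S.adj (dPart S.toAlmostHermitian 0) η) := by
  refine frameRep_ext S.toAlmostHermitian fun x₀ W P Q y hP hy => ?_
  obtain ⟨B, κ, hB, -, hc⟩ := hP.exists_localOp hS hy
  rw [hP.frameRep_contractionForm_comm hy hc 3 hη, frameRep_neg, frameRep_smul, frameRep_smul,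
    hP.frameRep_adj hy hc 0 hη]
  exact contraction_comm_NBar

/-- The Hodge star operator on smooth forms. -/
def starOp (H : AlmostHermitian M) : SmoothOps M := .of (represents_star (H := H)).isSmoothOp

/-- The parity of the degree, as an operator on smooth forms. -/
def parityOp (H : AlmostHermitian M) : SmoothOps M := .of (represents_parityForm H).isSmoothOp

/-- The multiplication by `√-1` on smooth forms. -/
def imaginaryOp (H : AlmostHermitian M) : SmoothOps M :=
    .of (represents_smul H Complex.I).isSmoothOp

/-- The contraction with the Hermitian form on smooth forms. -/
def contractionOp (H : AlmostHermitian M) : SmoothOps M :=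
  .of (represents_contractionForm H).isSmoothOp

/-- The operators `N`, `∂`, `∂̄` and `N̄` on smooth forms. -/
def dPartOp (i : Fin 4) : SmoothOps M := .of (isSmoothOp_dPart hS i)

local notation "𝒔" => starOp S.toAlmostHermitian
local notation "𝒑" => parityOp S.toAlmostHermitian
local notation "𝒊" => imaginaryOp S.toAlmostHermitian
local notation "𝒍" => contractionOp S.toAlmostHermitian
local notation "𝒅" => dPartOp hS

omit hS in
theorem starOp_mul_starOp (H : AlmostHermitian M) : starOp H * starOp H = parityOp H :=
  SmoothOps.ext_apply fun ξ => star_star H ξ.1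

omit hS in
theorem parityOp_mul_parityOp (H : AlmostHermitian M) : parityOp H * parityOp H = 1 :=
  SmoothOps.ext_apply fun ξ => parityForm_parityForm H ξ.1

omit hS in
theorem imaginaryOp_mul_imaginaryOp (H : AlmostHermitian M) :
    imaginaryOp H * imaginaryOp H = -1 :=
  SmoothOps.ext_apply fun ξ => I_smul_I_smul ξ.1

theorem parityOp_mul_dPartOp (i : Fin 4) : 𝒑 * 𝒅 i = -(𝒅 i * 𝒑) :=
  SmoothOps.ext_apply fun ξ => parityForm_dPart hS i ξ.2

theorem imaginaryOp_mul_dPartOp (i : Fin 4) : 𝒊 * 𝒅 i = 𝒅 i * 𝒊 :=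
  SmoothOps.ext_apply fun ξ => (dPart_smul hS i Complex.I ξ.2).symm

omit hS in
theorem imaginaryOp_mul_apply (H : AlmostHermitian M) (A : SmoothOps M) (ξ : smoothForms M) :
    (imaginaryOp H * A).apply ξ = Complex.I • A.apply ξ := rfl

theorem contractionOp_comm_apply (i : Fin 4) (ξ : smoothForms M) : (𝒍 * 𝒅 i - 𝒅 i * 𝒍).apply ξ =
    contractionForm S.toAlmostHermitian (dPart S.toAlmostHermitian i ξ.1) -
      dPart S.toAlmostHermitian i (contractionForm S.toAlmostHermitian ξ.1) := rfl

omit hS in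
/-- The adjoint of an operator that is represented by `A` on smooth forms. -/
theorem adj_eq {D : FormOp M} {A : SmoothOps M} (h : ∀ ξ : smoothForms M, D ξ.1 = A.apply ξ)
    (ξ : smoothForms M) : S.adj D ξ.1 = (starAdj 𝒔 A).apply ξ := by
  rw [starAdj, SmoothOps.neg_apply]
  exact congrArg Neg.neg (congrArg S.star (h ⟨S.star ξ.1, (𝒔).isSmoothMixed_apply ξ⟩))

theorem adj_dPart (i : Fin 4) (ξ : smoothForms M) :
    S.adj (dPart S.toAlmostHermitian i) ξ.1 = (starAdj 𝒔 (𝒅 i)).apply ξ :=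
  adj_eq (fun ξ => (SmoothOps.of_apply (isSmoothOp_dPart hS i) ξ).symm) ξ

theorem contractionOp_comm_del : 𝒍 * 𝒅 1 - 𝒅 1 * 𝒍 = 𝒊 * starAdj 𝒔 (𝒅 2) :=
  SmoothOps.ext_apply fun ξ => by
    rw [contractionOp_comm_apply, contractionForm_comm_del hS ξ.2, imaginaryOp_mul_apply,
      adj_dPart hS]

theorem contractionOp_comm_delBar : 𝒍 * 𝒅 2 - 𝒅 2 * 𝒍 = -(𝒊 * starAdj 𝒔 (𝒅 1)) :=
  SmoothOps.ext_apply fun ξ => by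
    rw [contractionOp_comm_apply, contractionForm_comm_delBar hS ξ.2, SmoothOps.neg_apply,
      imaginaryOp_mul_apply, adj_dPart hS]

theorem contractionOp_comm_N : 𝒍 * 𝒅 0 - 𝒅 0 * 𝒍 = 2 * (𝒊 * starAdj 𝒔 (𝒅 3)) :=
  SmoothOps.ext_apply fun ξ => by
    rw [two_mul, contractionOp_comm_apply, contractionForm_comm_N hS ξ.2, two_smul_eq_add,
      SmoothOps.add_apply, imaginaryOp_mul_apply, adj_dPart hS]

theorem contractionOp_comm_NBar : 𝒍 * 𝒅 3 - 𝒅 3 * 𝒍 = -(2 * (𝒊 * starAdj 𝒔 (𝒅 0))) :=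
  SmoothOps.ext_apply fun ξ => by
    rw [two_mul, contractionOp_comm_apply, contractionForm_comm_NBar hS ξ.2, two_smul_eq_add,
      SmoothOps.neg_apply, SmoothOps.add_apply, imaginaryOp_mul_apply, adj_dPart hS]

theorem sum_dPartOp_mul_dPartOp (m : ℤ) :
    ∑ i, ∑ j, (if dPartWeight i + dPartWeight j = m then 𝒅 i * 𝒅 j else 0) = 0 :=
  SmoothOps.ext_apply fun ξ => by
    refine Eq.trans ?_ (sum_dPart_dPart_eq_zero hS m ξ.2)
    rw [SmoothOps.sum_apply]
    refine Finset.sum_congr rfl fun i _ => ?_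
    rw [SmoothOps.sum_apply]
    refine Finset.sum_congr rfl fun j _ => ?_
    split_ifs <;> rfl

/-- The part of `d² = 0` of bidegree `(3, -1)`. -/
theorem N_anticomm_del : 𝒅 0 * 𝒅 1 + 𝒅 1 * 𝒅 0 = 0 := by
  have h := sum_dPartOp_mul_dPartOp hS 4
  simp only [Fin.sum_univ_four, dPartWeight, Matrix.cons_val] at h
  norm_num at h
  exact h

/-- The part of `d² = 0` of bidegree `(2, 0)`. -/
theorem del_sq : 𝒅 1 * 𝒅 1 + (𝒅 0 * 𝒅 2 + 𝒅 2 * 𝒅 0) = 0 := by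
  have h := sum_dPartOp_mul_dPartOp hS 2
  simp only [Fin.sum_univ_four, dPartWeight, Matrix.cons_val] at h
  norm_num at h
  rw [← h]
  abel

/-- The part of `d² = 0` of bidegree `(0, 2)`. -/
theorem delBar_sq : 𝒅 2 * 𝒅 2 + (𝒅 3 * 𝒅 1 + 𝒅 1 * 𝒅 3) = 0 := by
  have h := sum_dPartOp_mul_dPartOp hS (-2)
  simp only [Fin.sum_univ_four, dPartWeight, Matrix.cons_val] at h
  norm_num at h
  rw [← h]
  abel

/-- The part of `d² = 0` of bidegree `(-1, 3)`. -/
theorem NBar_anticomm_delBar : 𝒅 3 * 𝒅 2 + 𝒅 2 * 𝒅 3 = 0 := by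
  have h := sum_dPartOp_mul_dPartOp hS (-4)
  simp only [Fin.sum_univ_four, dPartWeight, Matrix.cons_val] at h
  norm_num at h
  rw [← h]
  abel

theorem deRham_eq_dPartOp (ξ : smoothForms M) :
    deRham ξ.1 = (𝒅 0 + 𝒅 1 + 𝒅 2 + 𝒅 3).apply ξ := by
  rw [deRham_eq_sum_dPart hS ξ.2, Fin.sum_univ_four]
  rfl

/-- The Laplacian identity, obtained by applying `laplacian_identity` to the operators `N`, `∂`,
`∂̄` and `N̄` in the ring of operators on smooth forms. -/
theorem laplacian_deRham {η : MixedForm M} (hη : IsSmoothMixed η) :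
    S.laplacian deRham η =
      S.laplacian S.del η + S.laplacian S.delBar η + S.laplacian (S.N + S.NBar) η
        - anticomm S.del (S.adj S.delBar) η - anticomm S.delBar (S.adj S.del) η := by
  have key := laplacian_identity (s := 𝒔) (P := 𝒑) (I := 𝒊) (Lam := 𝒍) (D := 𝒅 1)
    (E := 𝒅 2) (N := 𝒅 0) (M := 𝒅 3) (starOp_mul_starOp _) (parityOp_mul_parityOp _)
    (imaginaryOp_mul_imaginaryOp _) (parityOp_mul_dPartOp hS 1) (parityOp_mul_dPartOp hS 2)
    (parityOp_mul_dPartOp hS 0) (parityOp_mul_dPartOp hS 3) (imaginaryOp_mul_dPartOp hS 1)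
    (imaginaryOp_mul_dPartOp hS 2) (imaginaryOp_mul_dPartOp hS 0) (imaginaryOp_mul_dPartOp hS 3)
    (contractionOp_comm_del hS) (contractionOp_comm_delBar hS) (contractionOp_comm_N hS)
    (contractionOp_comm_NBar hS) (N_anticomm_del hS) (NBar_anticomm_delBar hS) (del_sq hS)
    (delBar_sq hS)
  have hd := deRham_eq_dPartOp hS
  have hdel : ∀ ξ : smoothForms M, S.del ξ.1 = (𝒅 1).apply ξ := fun _ => rfl
  have hdelBar : ∀ ξ : smoothForms M, S.delBar ξ.1 = (𝒅 2).apply ξ := fun _ => rfl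
  have hN : ∀ ξ : smoothForms M, (S.N + S.NBar) ξ.1 = (𝒅 0 + 𝒅 3).apply ξ := fun _ => rfl
  rw [AlmostHermitian.laplacian, AlmostHermitian.laplacian, AlmostHermitian.laplacian,
    AlmostHermitian.laplacian, SmoothOps.anticomm_eq hd (adj_eq hd) ⟨η, hη⟩,
    SmoothOps.anticomm_eq hdel (adj_eq hdel) ⟨η, hη⟩,
    SmoothOps.anticomm_eq hdelBar (adj_eq hdelBar) ⟨η, hη⟩,
    SmoothOps.anticomm_eq hN (adj_eq hN) ⟨η, hη⟩, SmoothOps.anticomm_eq hdel (adj_eq hdelBar)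
      ⟨η, hη⟩,
    SmoothOps.anticomm_eq hdelBar (adj_eq hdel) ⟨η, hη⟩]
  exact congrArg (fun A : SmoothOps M => A.apply ⟨η, hη⟩) key

end

end NearlyKahler

end

theorem mainTheorem3 {M : Type*} [TopologicalSpace M] [T2Space M] [SecondCountableTopology M]
    [ChartedSpace NearlyKahler.Model M] [IsManifold (𝓡 6) ∞ M]
    (S : NearlyKahler.SU3Structure M) (hS : S.IsNearlyKahler)
    (η : NearlyKahler.MixedForm M) (hη : ∀ k, NearlyKahler.IsSmooth (η k)) :
    S.laplacian NearlyKahler.deRham η =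
      S.laplacian S.del η + S.laplacian S.delBar η + S.laplacian (S.N + S.NBar) η
        - NearlyKahler.anticomm S.del (S.adj S.delBar) η
        - NearlyKahler.anticomm S.delBar (S.adj S.del) η := by
  exact NearlyKahler.laplacian_deRham hS hη
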